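/- Let $C\subset\mathbb F_2^{24}$ be the extended binary Golay code and let $M_{24}$, the Mathieu group of degree $24$, be the group of all permutations of the $24$ coordinates that preserve $C$. There are subgroups $G_1,G_2\le M_{24}$ such that: 1. $G_1\cong PSL(2,23)$, and $G_2\cong(\mathbb Z_2)^4\rtimes A_7$, where $A_7$ acts on $(\mathbb Z_2)^4$ via the embedding $A_7\subset A_8\cong SL(4,2)=\mathrm{Aut}((\mathbb Z_2)^4)$; 2. $G_1$ and $G_2$ are perfect, and they are self-normalizing in $M_{24}$, i.e. $N_{M_{24}}(G_i)=G_i$ for $i=1,2$; 3. $M_{24}=G_1G_2$ is an exact factorization, i.e. every element of $M_{24}$ is a product of an element of $G_1$ and an element of $G_2$, and $G_1\cap G_2=1$; 4. the bicrossproduct Hopf algebra $H=H(M_{24},G_1,G_2)$ is semisimple and biperfect. Here $H=\mathbb C[G_2]^*\otimes\mathbb C[G_1]$ with product $(\varphi\otimes a)(\psi\otimes b)=\varphi\,(a\cdot\psi)\otimes ab$ and coproduct $(\Delta(\varphi\otimes a))(b\otimes c)=\varphi(bc)\,a\otimes b^{-1}\cdot a$, where $G_1$ acts on $G_2=M_{24}/G_1$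 and $G_2$ acts on $G_1=M_{24}/G_2$ by left multiplication of cosets; a finite-dimensional Hopf algebra over $\mathbb C$ is called perfect if all its one-dimensional modules are trivial (given by the counit), and biperfect if both it and its dual are perfect; 5. the quantum double $D(H)$ is a semisimple quasitriangular Hopf algebra over $\mathbb C$ with $\dim D(H)>1$ whose only group-like element is $1$. Here $D(H)$ is $(H^*)^{\mathrm{cop}}\otimes H$ as a coalgebra, with product $(f\otimes u)(g\otimes v)=\sum f\,(u_{(1)}\rightharpoonup g\leftharpoonup S^{-1}(u_{(3)}))\otimes u_{(2)}v$, where $(a\rightharpoonup g\leftharpoonup b)(x)=g(bxa)$. Thus $D(H)$ gives a negative answer to the question of Etingof and Gelaki whether every semisimple quasitriangular Hopf algebra over $\mathbb C$ of dimension greater than $1$ has a nontrivial group-like element. -/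

import Mathlib

open scoped TensorProduct

namespace BiHopf

section Dual

open Coalgebra HopfAlgebra

/-- The dual `H^* = Hom_k(H, k)` of a Hopf algebra. -/
def HopfDual (k H : Type*) [Field k] [Ring H] [HopfAlgebra k H] : Type _ :=
  WithConv (H →ₗ[k] k)

/-- The product of the dual is the convolution `(f * g)(x) = ∑ f(x₁) g(x₂)`. -/
noncomputable instance (k H : Type*) [Field k] [Ring H] [HopfAlgebra k H] :
    Ring (HopfDual k H) :=
  inferInstanceAs (Ring (WithConv (H →ₗ[k] k)))

noncomputable instance (k H : Type*) [Field k] [Ring H] [HopfAlgebra k H] :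
    Algebra k (HopfDual k H) :=
  inferInstanceAs (Algebra k (WithConv (H →ₗ[k] k)))

/-- Elements of the dual Hopf algebra are the linear functionals on `H`. -/
noncomputable def HopfDual.equiv (k H : Type*) [Field k] [Ring H] [HopfAlgebra k H] :
    HopfDual k H ≃ₗ[k] (H →ₗ[k] k) where
  toFun f := WithConv.ofConv f
  invFun f := WithConv.toConv f
  map_add' _ _ := rfl
  map_smul' _ _ := rfl
  left_inv _ := rfl
  right_inv _ := rfl

variable {k H : Type*} [Field k] [Ring H] [HopfAlgebra k H]

noncomputable instance : FunLike (HopfDual k H) H k where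
  coe f := HopfDual.equiv k H f
  coe_injective _ _ h := (HopfDual.equiv k H).injective (LinearMap.ext (congrFun h))

theorem HopfDual.equiv_apply (f : HopfDual k H) (x : H) : HopfDual.equiv k H f x = f x := rfl

theorem HopfDual.symm_apply (f : H →ₗ[k] k) (x : H) : (HopfDual.equiv k H).symm f x = f x := rfl

theorem HopfDual.mul_apply (f g : HopfDual k H) (x : H) :
    (f * g) x = ∑ i ∈ (ℛ k x).index, f ((ℛ k x).left i) * g ((ℛ k x).right i) :=
  (ℛ k x).convMul_apply (WithConv.toConv (HopfDual.equiv k H f))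
    (WithConv.toConv (HopfDual.equiv k H g))

theorem HopfDual.one_apply (x : H) : (1 : HopfDual k H) x = counit (R := k) x := rfl

theorem HopfDual.sum_apply {ι : Type*} (s : Finset ι) (f : ι → HopfDual k H) (x : H) :
    (∑ i ∈ s, f i) x = ∑ i ∈ s, f i x := by
  simp only [← HopfDual.equiv_apply, map_sum, LinearMap.sum_apply]

theorem HopfDual.smul_apply (c : k) (f : HopfDual k H) (x : H) : (c • f) x = c * f x := rfl

/-- The counit of the dual: evaluation at `1`. -/
noncomputable def dualCounit : HopfDual k H →ₗ[k] k :=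
  LinearMap.applyₗ (1 : H) ∘ₗ (HopfDual.equiv k H).toLinearMap

theorem dualCounit_apply (f : HopfDual k H) : dualCounit f = f 1 := rfl

/-- The antipode of the dual: the transpose of the antipode of `H`. -/
noncomputable def dualAntipode : HopfDual k H →ₗ[k] HopfDual k H :=
  (HopfDual.equiv k H).symm.toLinearMap ∘ₗ
    (antipode k (A := H)).lcomp k k ∘ₗ (HopfDual.equiv k H).toLinearMap

theorem dualAntipode_apply (f : HopfDual k H) (x : H) : dualAntipode f x = f (antipode k x) := rfl

variable [FiniteDimensional k H]

/-- The identification `H^* ⊗ H^* = (H ⊗ H)^*`. -/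
noncomputable def dualPairing :
    HopfDual k H ⊗[k] HopfDual k H ≃ₗ[k] (H ⊗[k] H →ₗ[k] k) :=
  TensorProduct.congr (HopfDual.equiv k H) (HopfDual.equiv k H) ≪≫ₗ
    TensorProduct.dualDistribEquiv k H H

theorem dualPairing_tmul (f g : HopfDual k H) (x y : H) :
    dualPairing (f ⊗ₜ[k] g) (x ⊗ₜ[k] y) = f x * g y := by
  simp [dualPairing, TensorProduct.dualDistribEquiv, TensorProduct.dualDistribEquivOfBasis,
    HopfDual.equiv_apply]

/-- The coproduct of the dual: the transpose of the product of `H`. -/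
noncomputable def dualComul : HopfDual k H →ₗ[k] HopfDual k H ⊗[k] HopfDual k H :=
  dualPairing.symm.toLinearMap ∘ₗ (LinearMap.mul' k H).lcomp k k ∘ₗ
    (HopfDual.equiv k H).toLinearMap

theorem dualPairing_dualComul (f : HopfDual k H) (u : H ⊗[k] H) :
    dualPairing (dualComul f) u = f (LinearMap.mul' k H u) := by
  simp [dualComul, HopfDual.equiv_apply]

theorem dualPairing_ext {u v : HopfDual k H ⊗[k] HopfDual k H}
    (h : ∀ x y : H, dualPairing u (x ⊗ₜ[k] y) = dualPairing v (x ⊗ₜ[k] y)) : u = v :=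
  dualPairing.injective (TensorProduct.ext' h)

/-- The dual basis of a basis of `H`. -/
noncomputable def dualCoord (i : Module.Free.ChooseBasisIndex k H) : HopfDual k H :=
  (HopfDual.equiv k H).symm ((Module.Free.chooseBasis k H).coord i)

theorem dualComul_eq_left (f : HopfDual k H) : dualComul f = ∑ i, dualCoord i ⊗ₜ[k]
    (HopfDual.equiv k H).symm
      (HopfDual.equiv k H f ∘ₗ LinearMap.mulLeft k (Module.Free.chooseBasis k H i)) := by
  apply dualPairing_ext
  intro x y
  rw [dualPairing_dualComul, LinearMap.mul'_apply, map_sum, LinearMap.sum_apply,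
    ← HopfDual.equiv_apply]
  conv_lhs => rw [← (Module.Free.chooseBasis k H).sum_repr x, Finset.sum_mul, map_sum]
  simp [dualPairing_tmul, dualCoord, HopfDual.symm_apply]

theorem dualComul_eq_right (f : HopfDual k H) : dualComul f = ∑ i,
    (HopfDual.equiv k H).symm
      (HopfDual.equiv k H f ∘ₗ LinearMap.mulRight k (Module.Free.chooseBasis k H i))
        ⊗ₜ[k] dualCoord i := by
  apply dualPairing_ext
  intro x y
  rw [dualPairing_dualComul, LinearMap.mul'_apply, map_sum, LinearMap.sum_apply,
    ← HopfDual.equiv_apply]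
  conv_lhs => rw [← (Module.Free.chooseBasis k H).sum_repr y, Finset.mul_sum, map_sum]
  simp [dualPairing_tmul, dualCoord, HopfDual.symm_apply, mul_comm]

noncomputable instance : Coalgebra k (HopfDual k H) where
  comul := dualComul
  counit := dualCounit
  coassoc := by
    apply LinearMap.ext
    intro f
    simp only [LinearMap.comp_apply, LinearEquiv.coe_coe]
    conv_lhs => rw [dualComul_eq_right]
    conv_rhs => rw [dualComul_eq_left]
    simp only [map_sum, LinearMap.rTensor_tmul, LinearMap.lTensor_tmul]
    have h₁ := fun i => dualComul_eq_left ((HopfDual.equiv k H).symm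
      (HopfDual.equiv k H f ∘ₗ LinearMap.mulRight k (Module.Free.chooseBasis k H i)))
    have h₂ := fun i => dualComul_eq_right ((HopfDual.equiv k H).symm
      (HopfDual.equiv k H f ∘ₗ LinearMap.mulLeft k (Module.Free.chooseBasis k H i)))
    simp only [h₁, h₂, TensorProduct.tmul_sum, TensorProduct.sum_tmul, map_sum,
      TensorProduct.assoc_tmul]
    rw [Finset.sum_comm]
    refine Finset.sum_congr rfl fun i _ => Finset.sum_congr rfl fun j _ => ?_
    congr 3
    apply LinearMap.ext
    intro x
    simp [mul_assoc]
  rTensor_counit_comp_comul := by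
    apply LinearMap.ext
    intro f
    simp only [LinearMap.comp_apply]
    rw [dualComul_eq_right]
    simp only [map_sum, LinearMap.rTensor_tmul, TensorProduct.mk_apply]
    have h₁ : ∀ (c : k) (g : HopfDual k H), c ⊗ₜ[k] g = (1 : k) ⊗ₜ[k] (c • g) := by
      intro c g
      rw [← TensorProduct.smul_tmul, smul_eq_mul, mul_one]
    rw [Finset.sum_congr rfl fun i _ => h₁ _ _, ← TensorProduct.tmul_sum]
    congr 1
    apply DFunLike.ext
    intro x
    rw [← HopfDual.equiv_apply f x]
    conv_rhs => rw [← (Module.Free.chooseBasis k H).sum_repr x, map_sum]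
    simp [HopfDual.sum_apply, HopfDual.smul_apply, HopfDual.symm_apply, dualCounit_apply, dualCoord,
      mul_comm]
  lTensor_counit_comp_comul := by
    apply LinearMap.ext
    intro f
    simp only [LinearMap.comp_apply]
    rw [dualComul_eq_left]
    simp only [map_sum, LinearMap.lTensor_tmul, TensorProduct.mk_apply, LinearMap.flip_apply]
    have h₁ : ∀ (c : k) (g : HopfDual k H), g ⊗ₜ[k] c = (c • g) ⊗ₜ[k] (1 : k) := by
      intro c g
      rw [TensorProduct.smul_tmul, smul_eq_mul, mul_one]
    rw [Finset.sum_congr rfl fun i _ => h₁ _ _, ← TensorProduct.sum_tmul]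
    congr 1
    apply DFunLike.ext
    intro x
    rw [← HopfDual.equiv_apply f x]
    conv_rhs => rw [← (Module.Free.chooseBasis k H).sum_repr x, map_sum]
    simp [HopfDual.sum_apply, HopfDual.smul_apply, HopfDual.symm_apply, dualCounit_apply, dualCoord,
      mul_comm]

theorem dualPairing_one (x y : H) :
    dualPairing (1 : HopfDual k H ⊗[k] HopfDual k H) (x ⊗ₜ[k] y) =
      counit (R := k) x * counit (R := k) y := by
  rw [Algebra.TensorProduct.one_def, dualPairing_tmul, HopfDual.one_apply, HopfDual.one_apply]

theorem dualPairing_mul (u v : HopfDual k H ⊗[k] HopfDual k H) (x y : H) :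
    dualPairing (u * v) (x ⊗ₜ[k] y) =
      ∑ i ∈ (ℛ k x).index, ∑ j ∈ (ℛ k y).index,
        dualPairing u ((ℛ k x).left i ⊗ₜ[k] (ℛ k y).left j) *
          dualPairing v ((ℛ k x).right i ⊗ₜ[k] (ℛ k y).right j) := by
  induction u with
  | zero => simp
  | add u₁ u₂ h₁ h₂ => simp [add_mul, h₁, h₂, Finset.sum_add_distrib]
  | tmul f g =>
    induction v with
    | zero => simp
    | add u₁ u₂ h₁ h₂ => simp [mul_add, h₁, h₂, Finset.sum_add_distrib]
    | tmul f' g' =>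
      rw [Algebra.TensorProduct.tmul_mul_tmul, dualPairing_tmul,
        HopfDual.mul_apply, HopfDual.mul_apply, Finset.sum_mul_sum]
      simp_rw [dualPairing_tmul]
      refine Finset.sum_congr rfl fun i _ => Finset.sum_congr rfl fun j _ => ?_
      ring

theorem mul'_eq_dualPairing (u : HopfDual k H ⊗[k] HopfDual k H) (x : H) :
    (LinearMap.mul' k (HopfDual k H) u) x = dualPairing u (comul x) := by
  rw [← HopfDual.equiv_apply]
  induction u with
  | zero => simp
  | add u₁ u₂ h₁ h₂ => simp only [map_add, LinearMap.add_apply, h₁, h₂]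
  | tmul f g =>
    rw [LinearMap.mul'_apply, HopfDual.equiv_apply, HopfDual.mul_apply]
    conv_rhs => rw [← (ℛ k x).eq]
    simp [dualPairing_tmul]

noncomputable instance : Bialgebra k (HopfDual k H) :=
  Bialgebra.mk' k (HopfDual k H)
    (by
      change (1 : HopfDual k H) 1 = 1
      simp [HopfDual.one_apply])
    (by
      intro f g
      change (f * g) 1 = f 1 * g 1
      change LinearMap.mul' k k (TensorProduct.map _ _ (comul (1 : H))) = _
      rw [Bialgebra.comul_one, Algebra.TensorProduct.one_def]
      rfl)
    (by
      change dualComul (1 : HopfDual k H) = 1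
      apply dualPairing_ext
      intro x y
      rw [dualPairing_dualComul, dualPairing_one, HopfDual.one_apply]
      simp)
    (by
      intro f g
      change dualComul (f * g) = dualComul f * dualComul g
      apply dualPairing_ext
      intro x y
      rw [dualPairing_dualComul, dualPairing_mul, LinearMap.mul'_apply]
      simp only [dualPairing_dualComul, LinearMap.mul'_apply]
      change LinearMap.mul' k k (TensorProduct.map (HopfDual.equiv k H f) (HopfDual.equiv k H g)
        (comul (x * y))) = _
      rw [Bialgebra.comul_mul]
      conv_lhs => rw [← (ℛ k x).eq, ← (ℛ k y).eq]
      simp [Finset.sum_mul_sum, HopfDual.equiv_apply])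

/-- The dual of a finite-dimensional Hopf algebra is a Hopf algebra. -/
noncomputable instance : HopfAlgebra k (HopfDual k H) where
  antipode := dualAntipode
  mul_antipode_rTensor_comul := by
    apply LinearMap.ext
    intro f
    apply DFunLike.ext
    intro x
    change (LinearMap.mul' k (HopfDual k H) (dualAntipode.rTensor _ (dualComul f))) x =
      f 1 * counit (R := k) x
    have h : ∀ (u : HopfDual k H ⊗[k] HopfDual k H) (w : H ⊗[k] H),
        dualPairing (dualAntipode.rTensor _ u) w = dualPairing u ((antipode k).rTensor H w) := by
      intro u w
      induction u with
      | zero => simp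
      | add u₁ u₂ h₁ h₂ => simp [h₁, h₂]
      | tmul f g =>
        induction w with
        | zero => simp
        | add u₁ u₂ h₁ h₂ => simp only [map_add, h₁, h₂]
        | tmul y z => simp [dualPairing_tmul, dualAntipode_apply]
    rw [mul'_eq_dualPairing, h, dualPairing_dualComul, mul_antipode_rTensor_comul_apply,
      ← HopfDual.equiv_apply, Algebra.algebraMap_eq_smul_one, map_smul, smul_eq_mul, mul_comm,
      HopfDual.equiv_apply]
  mul_antipode_lTensor_comul := by
    apply LinearMap.ext
    intro f
    apply DFunLike.ext
    intro x
    change (LinearMap.mul' k (HopfDual k H) (dualAntipode.lTensor _ (dualComul f))) x =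
      f 1 * counit (R := k) x
    have h : ∀ (u : HopfDual k H ⊗[k] HopfDual k H) (w : H ⊗[k] H),
        dualPairing (dualAntipode.lTensor _ u) w = dualPairing u ((antipode k).lTensor H w) := by
      intro u w
      induction u with
      | zero => simp
      | add u₁ u₂ h₁ h₂ => simp [h₁, h₂]
      | tmul f g =>
        induction w with
        | zero => simp
        | add u₁ u₂ h₁ h₂ => simp only [map_add, h₁, h₂]
        | tmul y z => simp [dualPairing_tmul, dualAntipode_apply]
    rw [mul'_eq_dualPairing, h, dualPairing_dualComul, mul_antipode_lTensor_comul_apply,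
      ← HopfDual.equiv_apply, Algebra.algebraMap_eq_smul_one, map_smul, smul_eq_mul, mul_comm,
      HopfDual.equiv_apply]

end Dual

section Factorization

variable {G : Type*} [Group G] {G₁ G₂ : Subgroup G}

/-- `G = G₁ G₂` is an exact factorization: every element of `G` is a product of an element of
`G₁` and an element of `G₂`, and `G₁ ∩ G₂ = 1`. -/
structure IsExactFactorization (G₁ G₂ : Subgroup G) : Prop where
  exists_mul_eq : ∀ g : G, ∃ a ∈ G₁, ∃ x ∈ G₂, a * x = g
  inf_eq_bot : G₁ ⊓ G₂ = ⊥

namespace IsExactFactorization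

theorem symm (h : IsExactFactorization G₁ G₂) : IsExactFactorization G₂ G₁ where
  exists_mul_eq g := by
    obtain ⟨a, ha, x, hx, e⟩ := h.exists_mul_eq g⁻¹
    exact ⟨x⁻¹, inv_mem hx, a⁻¹, inv_mem ha, by rw [← mul_inv_rev, e, inv_inv]⟩
  inf_eq_bot := by rw [inf_comm, h.inf_eq_bot]

theorem exists_act (h : IsExactFactorization G₁ G₂) (a : G₁) (x : G₂) :
    ∃ x' : G₂, ∃ a' : G₁, (a * x : G) = x' * a' := by
  obtain ⟨x', hx, a', ha, e⟩ := h.symm.exists_mul_eq (a * x)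
  exact ⟨⟨x', hx⟩, ⟨a', ha⟩, e.symm⟩

variable (h : IsExactFactorization G₁ G₂)

/-- The action of `G₁` on `G₂ = G / G₁`: `a · x` is the element of `G₂` in the coset `a x G₁`. -/
noncomputable def act (a : G₁) (x : G₂) : G₂ := (h.exists_act a x).choose

theorem act_eq {a a' : G₁} {x x' : G₂} (e : (a * x : G) = x' * a') : h.act a x = x' := by
  obtain ⟨a'', e'⟩ := (h.exists_act a x).choose_spec
  change (a * x : G) = h.act a x * a'' at e'
  rw [e] at e'
  have h₁ : ((x'⁻¹ * h.act a x : G₂) : G) = ((a' * a''⁻¹ : G₁) : G) := by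
    push_cast
    rw [inv_mul_eq_iff_eq_mul, ← mul_assoc, e', mul_inv_cancel_right]
  have h₂ : ((x'⁻¹ * h.act a x : G₂) : G) ∈ G₁ ⊓ G₂ := ⟨by rw [h₁]; exact Subtype.property _,
    Subtype.property _⟩
  rw [h.inf_eq_bot, Subgroup.mem_bot] at h₂
  have h₃ : x'⁻¹ * h.act a x = 1 := Subtype.ext h₂
  exact (inv_mul_eq_one.1 h₃).symm

/-- `a x = (a · x) r` with `r ∈ G₁`, and the four mutual actions that this determines. -/
theorem act_spec (a : G₁) (x : G₂) : ∃ r : G₁, (a * x : G) = h.act a x * r ∧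
    h.symm.act (h.act a x)⁻¹ a = r ∧ h.act a⁻¹ (h.act a x) = x ∧ h.act r x⁻¹ = (h.act a x)⁻¹ ∧
    h.act r⁻¹ (h.act a x)⁻¹ = x⁻¹ ∧ h.symm.act x⁻¹ a⁻¹ = r⁻¹ := by
  obtain ⟨r, e⟩ := (h.exists_act a x).choose_spec
  change (a * x : G) = h.act a x * r at e
  refine ⟨r, e, h.symm.act_eq (a' := x⁻¹) ?_, h.act_eq (a' := r⁻¹) ?_, h.act_eq (a' := a) ?_,
    h.act_eq (a' := a⁻¹) ?_, h.symm.act_eq (a' := (h.act a x)⁻¹) ?_⟩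
  · push_cast
    rw [inv_mul_eq_iff_eq_mul, ← mul_assoc, ← e, mul_inv_cancel_right]
  · push_cast
    rw [inv_mul_eq_iff_eq_mul, ← mul_assoc, e, mul_inv_cancel_right]
  · push_cast
    rw [eq_inv_mul_iff_mul_eq, ← mul_assoc, ← e, mul_inv_cancel_right]
  · push_cast
    rw [← mul_inv_rev, ← e, mul_inv_rev]
  · push_cast
    rw [← mul_inv_rev, e, mul_inv_rev]

theorem one_act (x : G₂) : h.act 1 x = x := h.act_eq (a' := 1) (by simp)

theorem act_one (a : G₁) : h.act a 1 = 1 := h.act_eq (a' := a) (by simp)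

theorem mul_act (a b : G₁) (x : G₂) : h.act (a * b) x = h.act a (h.act b x) := by
  obtain ⟨r, e, -⟩ := h.act_spec b x
  obtain ⟨s, e', -⟩ := h.act_spec a (h.act b x)
  refine h.act_eq (a' := s * r) ?_
  push_cast
  rw [mul_assoc, e, ← mul_assoc, e', mul_assoc]

theorem act_inv_act (a : G₁) (x : G₂) : h.act a⁻¹ (h.act a x) = x := by
  rw [← h.mul_act, inv_mul_cancel, h.one_act]

theorem act_act_inv (a : G₁) (x : G₂) : h.act a (h.act a⁻¹ x) = x := by
  rw [← h.mul_act, mul_inv_cancel, h.one_act]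

theorem act_inj (a : G₁) (x y : G₂) : h.act a x = h.act a y ↔ x = y :=
  ⟨fun e => by rw [← h.act_inv_act a x, e, h.act_inv_act], fun e => by rw [e]⟩

theorem act_mul (a : G₁) (x y : G₂) :
    h.act a (x * y) = h.act a x * h.act (h.symm.act (h.act a x)⁻¹ a) y := by
  obtain ⟨r, e, e', -⟩ := h.act_spec a x
  rw [e']
  obtain ⟨s, f, -⟩ := h.act_spec r y
  refine h.act_eq (a' := s) ?_
  push_cast
  rw [← mul_assoc, e, mul_assoc, f, mul_assoc]

end IsExactFactorization
end Factorization

section Bicrossproduct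

open Coalgebra

variable {G : Type*} [Group G] {G₁ G₂ : Subgroup G}

/-- The underlying vector space `ℂ[G₂]^* ⊗ ℂ[G₁]` of the bicrossproduct `H(G, G₁, G₂)`, as the
space of coordinate vectors in the basis of the tensors `δ_x ⊗ a`, `x ∈ G₂`, `a ∈ G₁`. -/
def Bicrossproduct (_h : IsExactFactorization G₁ G₂) : Type _ := G₂ × G₁ →₀ ℂ

namespace Bicrossproduct

variable (h : IsExactFactorization G₁ G₂)

noncomputable instance : AddCommGroup (Bicrossproduct h) :=
  inferInstanceAs (AddCommGroup (G₂ × G₁ →₀ ℂ))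

noncomputable instance instModule : Module ℂ (Bicrossproduct h) :=
  inferInstanceAs (Module ℂ (G₂ × G₁ →₀ ℂ))

/-- The basis `δ_x ⊗ a`. -/
noncomputable def basis : Module.Basis (G₂ × G₁) ℂ (Bicrossproduct h) :=
  Module.Basis.ofRepr (LinearEquiv.refl ℂ (G₂ × G₁ →₀ ℂ))

open Classical in
/-- The product `(δ_x ⊗ a)(δ_y ⊗ b) = δ_x (a · δ_y) ⊗ ab`, where `a · δ_y = δ_{a · y}`. -/
noncomputable def mulMap : Bicrossproduct h →ₗ[ℂ] Bicrossproduct h →ₗ[ℂ] Bicrossproduct h :=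
  (basis h).constr ℂ fun p => (basis h).constr ℂ fun q =>
    if p.1 = h.act p.2 q.1 then basis h (p.1, p.2 * q.2) else 0

noncomputable instance : Mul (Bicrossproduct h) := ⟨fun u v => mulMap h u v⟩

open Classical in
theorem basis_mul (x y : G₂) (a b : G₁) : basis h (x, a) * basis h (y, b) =
    if x = h.act a y then basis h (x, a * b) else 0 := by
  change mulMap h _ _ = _
  rw [mulMap, Module.Basis.constr_basis, Module.Basis.constr_basis]

theorem induction {P : Bicrossproduct h → Prop} (u : Bicrossproduct h) (zero : P 0)
    (add : ∀ u v, P u → P v → P (u + v)) (smul : ∀ (c : ℂ) x a, P (c • basis h (x, a))) : P u := by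
  refine Finsupp.induction_linear (motive := P) u zero add ?_
  rintro ⟨x, a⟩ c
  have : (Finsupp.single (x, a) c : G₂ × G₁ →₀ ℂ) = c • basis h (x, a) := by
    rw [← Finsupp.smul_single_one]
    rfl
  rw [this]
  exact smul c x a

theorem aux_add_mul (u v w : Bicrossproduct h) : (u + v) * w = u * w + v * w := by
  change mulMap h _ _ = mulMap h _ _ + mulMap h _ _
  rw [map_add, LinearMap.add_apply]

theorem aux_mul_add (u v w : Bicrossproduct h) : u * (v + w) = u * v + u * w :=
  map_add (mulMap h u) v w

theorem aux_zero_mul (u : Bicrossproduct h) : 0 * u = 0 := by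
  change mulMap h _ _ = _
  rw [map_zero, LinearMap.zero_apply]

theorem aux_mul_zero (u : Bicrossproduct h) : u * 0 = 0 := map_zero (mulMap h u)

theorem aux_smul_mul (c : ℂ) (u v : Bicrossproduct h) : (c • u) * v = c • (u * v) := by
  change mulMap h _ _ = c • mulMap h _ _
  rw [map_smul, LinearMap.smul_apply]

theorem aux_mul_smul (c : ℂ) (u v : Bicrossproduct h) : u * (c • v) = c • (u * v) :=
  map_smul (mulMap h u) c v

attribute [local instance] Fintype.ofFinite

variable [Finite G]

noncomputable instance : One (Bicrossproduct h) := ⟨∑ x : G₂, basis h (x, 1)⟩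

theorem one_def : (1 : Bicrossproduct h) = ∑ x : G₂, basis h (x, 1) := rfl

noncomputable instance : Ring (Bicrossproduct h) where
  __ : AddCommGroup (Bicrossproduct h) := inferInstance
  left_distrib := aux_mul_add h
  right_distrib := aux_add_mul h
  zero_mul := aux_zero_mul h
  mul_zero := aux_mul_zero h
  mul_assoc u v w := by
    induction u using induction with
    | zero => simp only [aux_zero_mul]
    | add u₁ u₂ h₁ h₂ => simp only [aux_add_mul, h₁, h₂]
    | smul c x a =>
    induction v using induction with
    | zero => simp only [aux_zero_mul, aux_mul_zero]
    | add u₁ u₂ h₁ h₂ => simp only [aux_add_mul, aux_mul_add, h₁, h₂]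
    | smul d y b =>
    induction w using induction with
    | zero => simp only [aux_mul_zero]
    | add u₁ u₂ h₁ h₂ => simp only [aux_mul_add, h₁, h₂]
    | smul e z c' =>
    simp only [aux_smul_mul, aux_mul_smul]
    congr 3
    rw [basis_mul, basis_mul]
    by_cases h₁ : x = h.act a y <;> by_cases h₂ : y = h.act b z
    · rw [if_pos h₁, if_pos h₂, basis_mul, basis_mul, if_pos h₁, if_pos, mul_assoc]
      rw [h₁, h₂, h.mul_act]
    · rw [if_pos h₁, if_neg h₂, basis_mul, aux_mul_zero, if_neg]
      rw [h₁, h.mul_act]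
      intro h₃
      apply h₂
      rw [← h.act_inv_act a y, h₃, h.act_inv_act]
    · rw [if_neg h₁, if_pos h₂, basis_mul, aux_zero_mul, if_neg h₁]
    · rw [if_neg h₁, if_neg h₂, aux_zero_mul, aux_mul_zero]
  one_mul u := by
    induction u using induction with
    | zero => simp only [aux_mul_zero]
    | add u₁ u₂ h₁ h₂ => simp only [aux_mul_add, h₁, h₂]
    | smul c x a =>
    rw [aux_mul_smul, one_def]
    congr 1
    change mulMap h _ _ = _
    rw [map_sum, LinearMap.sum_apply]
    change ∑ y : G₂, basis h (y, 1) * basis h (x, a) = _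
    simp [basis_mul, h.one_act]
  mul_one u := by
    induction u using induction with
    | zero => simp only [aux_zero_mul]
    | add u₁ u₂ h₁ h₂ => simp only [aux_add_mul, h₁, h₂]
    | smul c x a =>
    rw [aux_smul_mul, one_def]
    congr 1
    change mulMap h _ _ = _
    rw [map_sum]
    change ∑ y : G₂, basis h (x, a) * basis h (y, 1) = _
    have : ∀ y, x = h.act a y ↔ y = h.act a⁻¹ x := fun y =>
      ⟨fun e => by rw [e, h.act_inv_act], fun e => by rw [e, h.act_act_inv]⟩
    simp only [basis_mul, mul_one]
    rw [Fintype.sum_eq_single (h.act a⁻¹ x) fun y hy => if_neg fun e => hy ((this y).1 e),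
      if_pos ((this _).2 rfl)]

noncomputable instance : Algebra ℂ (Bicrossproduct h) :=
  Algebra.ofModule (aux_smul_mul h) (fun c u v => aux_mul_smul h c u v)

/-- The coproduct `Δ(δ_x ⊗ a) = ∑_{bc = x} (δ_b ⊗ a) ⊗ (δ_c ⊗ b⁻¹ · a)`. -/
noncomputable def comulMap : Bicrossproduct h →ₗ[ℂ] Bicrossproduct h ⊗[ℂ] Bicrossproduct h :=
  (basis h).constr ℂ fun p =>
    ∑ b : G₂, basis h (b, p.2) ⊗ₜ[ℂ] basis h (b⁻¹ * p.1, h.symm.act b⁻¹ p.2)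

open Classical in
/-- The counit `ε(δ_x ⊗ a) = δ_x(1)`. -/
noncomputable def counitMap : Bicrossproduct h →ₗ[ℂ] ℂ :=
  (basis h).constr ℂ fun p => if p.1 = 1 then 1 else 0

/-- The antipode `S(δ_x ⊗ a) = δ_{(a⁻¹ · x)⁻¹} ⊗ (x⁻¹ · a)⁻¹`. -/
noncomputable def antipodeMap : Bicrossproduct h →ₗ[ℂ] Bicrossproduct h :=
  (basis h).constr ℂ fun p => basis h ((h.act p.2⁻¹ p.1)⁻¹, (h.symm.act p.1⁻¹ p.2)⁻¹)

theorem comulMap_basis (x : G₂) (a : G₁) : comulMap h (basis h (x, a)) =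
    ∑ b : G₂, basis h (b, a) ⊗ₜ[ℂ] basis h (b⁻¹ * x, h.symm.act b⁻¹ a) := by
  rw [comulMap, Module.Basis.constr_basis]

open Classical in
theorem counitMap_basis (x : G₂) (a : G₁) : counitMap h (basis h (x, a)) =
    if x = 1 then 1 else 0 := by
  rw [counitMap, Module.Basis.constr_basis]

theorem antipodeMap_basis (x : G₂) (a : G₁) : antipodeMap h (basis h (x, a)) =
    basis h ((h.act a⁻¹ x)⁻¹, (h.symm.act x⁻¹ a)⁻¹) := by
  rw [antipodeMap, Module.Basis.constr_basis]

noncomputable instance : Coalgebra ℂ (Bicrossproduct h) where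
  comul := comulMap h
  counit := counitMap h
  coassoc := by
    refine (basis h).ext ?_
    rintro ⟨x, a⟩
    simp only [LinearMap.comp_apply, LinearEquiv.coe_coe, comulMap_basis, map_sum,
      LinearMap.rTensor_tmul, LinearMap.lTensor_tmul, TensorProduct.tmul_sum,
      TensorProduct.sum_tmul, TensorProduct.assoc_tmul]
    rw [Finset.sum_comm]
    refine Finset.sum_congr rfl fun b _ => ?_
    refine Fintype.sum_equiv (Equiv.mulLeft b⁻¹) _ _ fun c => ?_
    simp only [Equiv.coe_mulLeft, ← h.symm.mul_act]
    congr 4 <;> simp [mul_assoc]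
  rTensor_counit_comp_comul := by
    refine (basis h).ext ?_
    rintro ⟨x, a⟩
    simp [comulMap_basis, counitMap_basis, TensorProduct.ite_tmul, h.symm.one_act]
  lTensor_counit_comp_comul := by
    refine (basis h).ext ?_
    rintro ⟨x, a⟩
    simp only [LinearMap.comp_apply, comulMap_basis, map_sum, LinearMap.lTensor_tmul,
      counitMap_basis]
    rw [Fintype.sum_eq_single x fun y hy => by
      rw [if_neg fun e => hy (inv_mul_eq_one.1 e), TensorProduct.tmul_zero],
      if_pos (inv_mul_cancel x)]
    rfl

theorem comulMap_mul (u v : Bicrossproduct h) :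
    comulMap h (u * v) = comulMap h u * comulMap h v := by
  classical
  induction u using induction with
  | zero => simp
  | add u₁ u₂ h₁ h₂ => simp only [add_mul, map_add, h₁, h₂]
  | smul c x a =>
  induction v using induction with
  | zero => simp
  | add u₁ u₂ h₁ h₂ => simp only [mul_add, map_add, h₁, h₂]
  | smul d y b =>
  rw [smul_mul_smul_comm, map_smul, map_smul, map_smul, smul_mul_smul_comm]
  congr 1
  rw [basis_mul, apply_ite (comulMap h), map_zero, comulMap_basis, comulMap_basis, comulMap_basis,
    Finset.sum_mul_sum, Finset.sum_comm]
  simp only [Algebra.TensorProduct.tmul_mul_tmul, basis_mul]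
  have key : ∀ z w : G₂, ((if z = h.act a w then basis h (z, a * b) else 0) ⊗ₜ[ℂ]
      (if z⁻¹ * x = h.act (h.symm.act z⁻¹ a) (w⁻¹ * y) then
        basis h (z⁻¹ * x, h.symm.act z⁻¹ a * h.symm.act w⁻¹ b) else 0) :
          Bicrossproduct h ⊗[ℂ] Bicrossproduct h) =
      if z = h.act a w then (if x = h.act a y then
        basis h (z, a * b) ⊗ₜ[ℂ] basis h (z⁻¹ * x, h.symm.act z⁻¹ (a * b)) else 0) else 0 := by
    intro z w
    by_cases hz : z = h.act a w
    · obtain ⟨r, e, e₁, e₂, e₃, e₄, e₅⟩ := h.act_spec a w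
      have h₁ : (z⁻¹ * x = h.act (h.symm.act z⁻¹ a) (w⁻¹ * y)) ↔ x = h.act a y := by
        have := h.act_mul a w (w⁻¹ * y)
        rw [mul_inv_cancel_left] at this
        rw [this, hz, inv_mul_eq_iff_eq_mul]
      have h₂ : h.symm.act z⁻¹ a * h.symm.act w⁻¹ b = h.symm.act z⁻¹ (a * b) := by
        rw [h.symm.act_mul, hz, e₁]
        congr 2
        rw [← e₄]
      rw [if_pos hz, if_pos hz, h₂]
      by_cases hx : x = h.act a y
      · rw [if_pos (h₁.2 hx), if_pos hx]
      · rw [if_neg (fun e => hx (h₁.1 e)), if_neg hx, TensorProduct.tmul_zero]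
    · rw [if_neg hz, if_neg hz, TensorProduct.zero_tmul]
  simp only [key]
  by_cases hx : x = h.act a y
  · simp only [if_pos hx]
    rw [Finset.sum_comm]
    refine Finset.sum_congr rfl fun z _ => ?_
    have : ∀ w, z = h.act a w ↔ w = h.act a⁻¹ z := fun y =>
      ⟨fun e => by rw [e, h.act_inv_act], fun e => by rw [e, h.act_act_inv]⟩
    simp [this]
  · simp [hx]

noncomputable instance : Bialgebra ℂ (Bicrossproduct h) :=
  Bialgebra.mk' ℂ (Bicrossproduct h)
    (by
      change counitMap h 1 = 1
      simp [one_def, counitMap_basis])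
    (by
      intro u v
      change counitMap h (u * v) = counitMap h u * counitMap h v
      induction u using induction with
      | zero => simp
      | add u₁ u₂ h₁ h₂ => simp only [add_mul, map_add, h₁, h₂]
      | smul c x a =>
      induction v using induction with
      | zero => simp
      | add u₁ u₂ h₁ h₂ => simp only [mul_add, map_add, h₁, h₂]
      | smul d y b =>
      classical
      rw [smul_mul_smul_comm, map_smul, map_smul, map_smul, smul_mul_smul_comm, basis_mul,
        apply_ite (counitMap h), map_zero, counitMap_basis, counitMap_basis, counitMap_basis]
      congr 1
      by_cases hy : y = 1
      · subst hy
        simp [h.act_one]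
      · have : ∀ z, z = h.act a y → z ≠ 1 := by
          rintro z e rfl
          apply hy
          rw [← h.act_inv_act a y, ← e, h.act_one]
        by_cases hx : x = h.act a y
        · simp [hx, this _ rfl, hy]
        · simp [hx, hy])
    (by
      change comulMap h 1 = 1
      simp only [one_def, map_sum, comulMap_basis, h.symm.act_one, Algebra.TensorProduct.one_def,
        TensorProduct.sum_tmul, TensorProduct.tmul_sum]
      rw [Finset.sum_comm]
      conv_rhs => rw [Finset.sum_comm]
      refine Finset.sum_congr rfl fun b _ => ?_
      exact Fintype.sum_equiv (Equiv.mulLeft b⁻¹) _ _ fun c => rfl)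
    (by
      intro u v
      exact comulMap_mul h u v)

/-- The bicrossproduct Hopf algebra `H(G, G₁, G₂)`. -/
noncomputable instance : HopfAlgebra ℂ (Bicrossproduct h) where
  antipode := antipodeMap h
  mul_antipode_rTensor_comul := by
    refine (basis h).ext ?_
    rintro ⟨x, a⟩
    change LinearMap.mul' ℂ _ ((antipodeMap h).rTensor _ (comulMap h _)) =
      algebraMap ℂ _ (counitMap h _)
    simp only [comulMap_basis, counitMap_basis, map_sum, LinearMap.rTensor_tmul,
      LinearMap.mul'_apply, antipodeMap_basis, basis_mul]
    have key : ∀ b : G₂, ((h.act a⁻¹ b)⁻¹ = h.act (h.symm.act b⁻¹ a)⁻¹ (b⁻¹ * x)) ↔ x = 1 := by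
      intro b
      obtain ⟨r, -, e₁, -, -, e₄, -⟩ := h.act_spec a (h.act a⁻¹ b)
      rw [h.act_act_inv] at e₁ e₄
      rw [e₁, ← e₄, h.act_inj, left_eq_mul]
    by_cases hx : x = 1
    · rw [if_pos hx, map_one, one_def]
      refine Fintype.sum_bijective (fun b : G₂ => (h.act a⁻¹ b)⁻¹) ⟨?_, ?_⟩
        _ (fun y : G₂ => basis h (y, 1)) fun b => ?_
      · intro b c e
        exact (h.act_inj _ _ _).1 (inv_injective e)
      · intro b
        exact ⟨h.act a b⁻¹, by simp only [h.act_inv_act, inv_inv]⟩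
      · rw [if_pos ((key b).2 hx), inv_mul_cancel]
    · rw [if_neg hx, map_zero]
      exact Finset.sum_eq_zero fun b _ => if_neg fun e => hx ((key b).1 e)
  mul_antipode_lTensor_comul := by
    refine (basis h).ext ?_
    rintro ⟨x, a⟩
    change LinearMap.mul' ℂ _ ((antipodeMap h).lTensor _ (comulMap h _)) =
      algebraMap ℂ _ (counitMap h _)
    simp only [comulMap_basis, counitMap_basis, map_sum, LinearMap.lTensor_tmul,
      LinearMap.mul'_apply, antipodeMap_basis, basis_mul]
    have key : ∀ b : G₂, (b = h.act a (h.act (h.symm.act b⁻¹ a)⁻¹ (b⁻¹ * x))⁻¹) ↔ x = 1 := by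
      intro b
      obtain ⟨r, -, e₁, -, -, e₄, -⟩ := h.act_spec a (h.act a⁻¹ b)
      rw [h.act_act_inv] at e₁ e₄
      rw [e₁, ← h.act_inj a⁻¹, h.act_inv_act, eq_comm, inv_eq_iff_eq_inv, ← e₄, h.act_inj,
        mul_eq_left]
    by_cases hx : x = 1
    · rw [if_pos hx, map_one, one_def]
      refine Finset.sum_congr rfl fun b _ => ?_
      rw [if_pos ((key b).2 hx), ← h.symm.mul_act, hx]
      simp [h.symm.one_act]
    · rw [if_neg hx, map_zero]
      exact Finset.sum_eq_zero fun b _ => if_neg fun e => hx ((key b).1 e)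

instance : FiniteDimensional ℂ (Bicrossproduct h) := Module.Finite.of_basis (basis h)

/-- The element `φ ⊗ a` of `ℂ[G₂]^* ⊗ ℂ[G₁]`. -/
noncomputable def tmul (φ : G₂ → ℂ) (a : G₁) : Bicrossproduct h := ∑ x : G₂, φ x • basis h (x, a)

/-- The defining product `(φ ⊗ a)(ψ ⊗ b) = φ (a · ψ) ⊗ ab`, with `(a · ψ)(x) = ψ(a⁻¹ · x)`. -/
theorem tmul_mul_tmul (φ ψ : G₂ → ℂ) (a b : G₁) : tmul h φ a * tmul h ψ b =
    tmul h (fun x => φ x * ψ (h.act a⁻¹ x)) (a * b) := by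
  have key : ∀ x y : G₂, x = h.act a y ↔ y = h.act a⁻¹ x := fun x y =>
    ⟨fun e => by rw [e, h.act_inv_act], fun e => by rw [e, h.act_act_inv]⟩
  simp only [tmul, Finset.sum_mul_sum, smul_mul_smul_comm, basis_mul]
  refine Finset.sum_congr rfl fun x _ => ?_
  rw [Fintype.sum_eq_single (h.act a⁻¹ x) fun y hy => by
    rw [if_neg fun e => hy ((key _ _).1 e), smul_zero], if_pos ((key _ _).2 rfl)]

/-- The defining coproduct: `Δ(φ ⊗ a)` takes the value `φ(bc) a ⊗ b⁻¹ · a` at `b ⊗ c`. -/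
theorem comul_tmul (φ : G₂ → ℂ) (a : G₁) : comul (R := ℂ) (tmul h φ a) =
    ∑ b : G₂, ∑ c : G₂,
      φ (b * c) • (basis h (b, a) ⊗ₜ[ℂ] basis h (c, h.symm.act b⁻¹ a)) := by
  change comulMap h _ = _
  simp only [tmul, map_sum, map_smul, comulMap_basis, Finset.smul_sum]
  rw [Finset.sum_comm]
  refine Finset.sum_congr rfl fun b _ => ?_
  exact Fintype.sum_equiv (Equiv.mulLeft b⁻¹) _ _ fun x => by simp

end Bicrossproduct
end Bicrossproduct

section Perfect

open Coalgebra

/-- A Hopf algebra over `ℂ` is perfect if every one-dimensional module over it is trivial, that is,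
the algebra acts through the counit. -/
def IsPerfectHopf (A : Type*) [Ring A] [HopfAlgebra ℂ A] : Prop :=
  ∀ (V : Type) [AddCommGroup V] [Module ℂ V] [Module A V] [IsScalarTower ℂ A V],
    Module.finrank ℂ V = 1 → ∀ (a : A) (v : V), a • v = counit (R := ℂ) a • v

/-- A finite-dimensional Hopf algebra `H` is biperfect if both `H` and `H^*` are perfect. -/
def IsBiperfect (H : Type*) [Ring H] [HopfAlgebra ℂ H] [FiniteDimensional ℂ H] : Prop :=
  IsPerfectHopf H ∧ IsPerfectHopf (HopfDual ℂ H)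

end Perfect

section QuantumDouble

open Coalgebra HopfAlgebra

/-- The functional `a ⇀ f ↼ b`, given by `x ↦ f (b x a)`. -/
noncomputable def HopfDual.hit {H : Type*} [Ring H] [HopfAlgebra ℂ H] (a b : H)
    (f : HopfDual ℂ H) : HopfDual ℂ H :=
  (HopfDual.equiv ℂ H).symm
    (HopfDual.equiv ℂ H f ∘ₗ LinearMap.mulLeft ℂ b ∘ₗ LinearMap.mulRight ℂ a)

/-- `D` is the quantum double `D(H)` of the finite-dimensional Hopf algebra `H`: as a coalgebra it
is `H^{*cop} ⊗ H`, and its product is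
`(f ⊗ u)(g ⊗ v) = ∑ f (u₁ ⇀ g ↼ S⁻¹(u₃)) ⊗ u₂ v`.
Here `S` is the antipode of `H` (which has to be bijective), `E` is the identification of
`H^* ⊗ H` with `D`, and `∑ u₁ ⊗ u₂ ⊗ u₃` is any expression of the iterated coproduct of `u` as a
finite sum of pure tensors. -/
def IsQuantumDouble (H D : Type*) [Ring H] [HopfAlgebra ℂ H] [FiniteDimensional ℂ H]
    [Ring D] [HopfAlgebra ℂ D] : Prop :=
  ∃ (S : H ≃ₗ[ℂ] H) (E : HopfDual ℂ H ⊗[ℂ] H ≃ₗ[ℂ] D),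
    (∀ u : H, S u = antipode ℂ u) ∧
    (∀ (f g : HopfDual ℂ H) (u v : H) (n : ℕ) (u₁ u₂ u₃ : Fin n → H),
      (comul (R := ℂ) (A := H)).lTensor H (comul u) = ∑ i, u₁ i ⊗ₜ[ℂ] (u₂ i ⊗ₜ[ℂ] u₃ i) →
      E (f ⊗ₜ[ℂ] u) * E (g ⊗ₜ[ℂ] v) =
        ∑ i, E ((f * HopfDual.hit (u₁ i) (S.symm (u₃ i)) g) ⊗ₜ[ℂ] (u₂ i * v))) ∧
    (∀ (f : HopfDual ℂ H) (u : H),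
      comul (E (f ⊗ₜ[ℂ] u)) = TensorProduct.map E.toLinearMap E.toLinearMap
        (TensorProduct.tensorTensorTensorComm ℂ (HopfDual ℂ H) (HopfDual ℂ H) H H
          (TensorProduct.comm ℂ (HopfDual ℂ H) (HopfDual ℂ H) (comul f) ⊗ₜ[ℂ] comul u)))

/-- `R` is a universal R-matrix of the Hopf algebra `A`: it is invertible, `Δ^op(a) R = R Δ(a)`,
`(Δ ⊗ id)(R) = R₁₃ R₂₃` and `(id ⊗ Δ)(R) = R₁₃ R₁₂`. -/
structure IsUniversalRMatrix {A : Type*} [Ring A] [HopfAlgebra ℂ A] (R : A ⊗[ℂ] A) : Prop where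
  isUnit : IsUnit R
  comm_comul_mul : ∀ a : A, TensorProduct.comm ℂ A A (comul a) * R = R * comul a
  comul_rTensor : TensorProduct.assoc ℂ A A A ((comul (R := ℂ) (A := A)).rTensor A R) =
    (TensorProduct.mk ℂ A A 1).lTensor A R * ((1 : A) ⊗ₜ[ℂ] R)
  comul_lTensor : (comul (R := ℂ) (A := A)).lTensor A R =
    (TensorProduct.mk ℂ A A 1).lTensor A R * TensorProduct.assoc ℂ A A A (R ⊗ₜ[ℂ] (1 : A))

/-- A quasitriangular Hopf algebra: one that admits a universal R-matrix. -/
def IsQuasitriangular (A : Type*) [Ring A] [HopfAlgebra ℂ A] : Prop :=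
  ∃ R : A ⊗[ℂ] A, IsUniversalRMatrix R

end QuantumDouble

section Groups

/-- For `i ∈ 𝔽₂₃`, the word of length `24` over `𝔽₂`, with coordinates indexed by the projective
line `𝔽₂₃ ∪ {∞}` (where `∞ = none`), that is the indicator function of the set of all `x ≠ ∞` such
that `x + i` is zero or a quadratic nonresidue modulo `23`. -/
def golayWord (i : ZMod 23) : Option (ZMod 23) → ZMod 2
  | none => 0
  | some x => if x + i ≠ 0 ∧ IsSquare (x + i) then 0 else 1

/-- The extended binary Golay code, as the extended quadratic residue code of length `24`. -/
def golayCode : Submodule (ZMod 2) (Option (ZMod 23) → ZMod 2) :=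
  Submodule.span (ZMod 2) (insert 1 (Set.range golayWord))

/-- The Mathieu group `M₂₄` in its action on `24` points: the group of all permutations of the
coordinates that preserve the extended binary Golay code. -/
def M24 : Subgroup (Equiv.Perm (Option (ZMod 23))) where
  carrier := {σ | ∀ v : Option (ZMod 23) → ZMod 2, v ∘ σ ∈ golayCode ↔ v ∈ golayCode}
  mul_mem' {σ τ} hσ hτ v := by
    rw [Equiv.Perm.coe_mul, ← Function.comp_assoc, hτ, hσ]
  one_mem' v := by simp
  inv_mem' {σ} hσ v := by
    rw [← hσ, Function.comp_assoc, ← Equiv.Perm.coe_mul, inv_mul_cancel, Equiv.Perm.coe_one,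
      Function.comp_id]

open scoped MatrixGroups

/-- The natural action of `SL(4, 2)` on `(ℤ/2)⁴`, written multiplicatively. -/
def slAction : SL(4, ZMod 2) →* MulAut (Multiplicative (Fin 4 → ZMod 2)) where
  toFun g := AddEquiv.toMultiplicative (Matrix.SpecialLinearGroup.toLin' g).toAddEquiv
  map_one' := by
    ext v : 1
    simp
  map_mul' g g' := by
    ext v : 1
    simp

/-- The inclusion of `A₇` in `A₈` as the stabilizer of the last point. -/
def alternatingInclusion : alternatingGroup (Fin 7) →* alternatingGroup (Fin 8) :=
  ((Equiv.Perm.extendDomainHom (finSuccAboveEquiv (Fin.last 7))).comp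
    (alternatingGroup (Fin 7)).subtype).codRestrict _ fun σ => by
      have hσ : Equiv.Perm.sign (σ : Equiv.Perm (Fin 7)) = 1 :=
        Equiv.Perm.mem_alternatingGroup.1 σ.2
      simp [Equiv.Perm.mem_alternatingGroup, Equiv.Perm.sign_extendDomain, hσ]

/-- The action of `A₇` on `(ℤ/2)⁴` through the inclusion of `A₇` in `A₈` and an identification
`e` of `A₈` with `SL(4, 2)`. -/
def a7Action (e : alternatingGroup (Fin 8) ≃* SL(4, ZMod 2)) :
    alternatingGroup (Fin 7) →* MulAut (Multiplicative (Fin 4 → ZMod 2)) :=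
  slAction.comp (e.toMonoidHom.comp alternatingInclusion)

end Groups

end BiHopf

open scoped MatrixGroups

/-!
The second subgroup of `M₂₄` is the stabilizer of a flag formed by a point, `∞`, and an octad (a
codeword of weight `8`) through it. The first one is the group `PSL(2, 23)` of Möbius
transformations of the projective line over `𝔽₂₃`. It acts simply transitively on these flags, so
the two subgroups form an exact factorization (`isExactFactorization_psl_flagStabilizer`); the
needed facts on octads come from an enumeration of the `2¹²` codewords (`exists_enumerationTest`).
An element of `M₂₄` that preserves the octad acts on the complement by affine maps, for the affine
structure whose affine functions are the codewords supported on the complement. Comparing the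
actions on the octad and on its complement gives an isomorphism `A₈ ≅ SL(4, 2)`
(`exists_mulEquiv_alternatingGroup_specialLinearGroup`) and identifies the flag stabilizer with
`(ℤ/2)⁴ ⋊ A₇` (`nonempty_flagStabilizer_mulEquiv`). The subgroups are self-normalizing: a normalizer
of `PSL(2, 23)` that fixes `∞` and `0` normalizes the translations, hence is a multiplication, by a
square (`normalizer_pslSubgroup`); a normalizer of the flag stabilizer permutes its orbits, which
have sizes `1`, `7` and `16` (`normalizer_flagStabilizer`).

The statements on Hopf algebras hold for every exact factorization `G = G₁ G₂` of a finite group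
into perfect self-normalizing subgroups. The bicrossproduct `H`, its dual and its quantum double all
have a basis of arrows of an action groupoid (`IsActionBasis`). Such an algebra is semisimple, since
averaging over the arrows gives a separability idempotent (`IsActionBasis.isSemisimpleRing`), and
its characters correspond to characters of the group at fixed points of the action
(`IsActionBasis.algHom_apply`). For `H` and its dual the groups are `G₁` and `G₂`; being perfect they
have no nontrivial characters, and being self-normalizing they have only one fixed point on
`G₂ = G / G₁` and `G₁ = G / G₂`. So `H` is biperfect (`Bicrossproduct.isBiperfect`).

The groupoid for the quantum double is that of `G` acting on itself by conjugation, so that its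
algebra is that of the quantum double of `ℂ[G]`, while the coproduct `Double.comulMap` depends on
the factorization. The inclusions `Double.ofBicrossproduct` of `H` and `Double.ofDual` of `H^*` are
multiplicative and compatible with the coproducts, the first one preserving and the second one
reversing it, and satisfy the cross relation of the quantum double
(`Double.ofBicrossproduct_mul_ofDual`); therefore `f ⊗ u ↦ ofDual f * ofBicrossproduct u` identifies
`Double` with the quantum double of `H` (`Double.isQuantumDouble`). The universal R-matrix is the
canonical element `∑ eᵢ ⊗ eⁱ` (`Double.isQuasitriangular`). A group-like element of the quantum
double of `H` is a tensor product of group-like elements of `H^*` and `H`, that is, of characters of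
`H` and `H^*`, which are trivial if `H` is biperfect
(`IsQuantumDouble.eq_one_of_isGroupLikeElem`).
-/

namespace BiHopf

/-! ### The extended Golay code as a list of words -/

/-- The position of a coordinate in a `24`-bit mask: `x ∈ 𝔽₂₃` sits at bit `x`, and `∞` at
bit `23`. -/
def bitPosition : Option (ZMod 23) → ℕ
  | none => 23
  | some x => x.val

/-- The binary word of length `24` whose coordinates are the bits of `m`. -/
def ofMask (m : ℕ) (x : Option (ZMod 23)) : ZMod 2 := if m.testBit (bitPosition x) then 1 else 0

theorem ofMask_xor (m n : ℕ) : ofMask (m ^^^ n) = ofMask m + ofMask n := by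
  funext x
  simp only [ofMask, Nat.testBit_xor, Pi.add_apply]
  cases m.testBit (bitPosition x) <;> cases n.testBit (bitPosition x) <;> decide

theorem ofMask_zero : ofMask 0 = 0 := by
  funext x
  simp [ofMask]

/-- An information set of the Golay code: the first seven points are the points of `octad` other
than `∞`, the other five are the origin and the standard basis vectors of its complement (see
`label`). -/
def golayPivot : Fin 12 → Option (ZMod 23) :=
  ![some 10, some 7, some 2, some 1, some 8, some 6, some 12,
    some 0, some 18, some 20, some 21, some 22]

/-- The basis of the Golay code dual to the information set `golayPivot`. -/
def golayMask : Fin 12 → ℕ :=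
  ![8433200, 8604304, 9011740, 8479274, 9102080, 9169016, 9050664,
    641569, 442936, 1288712, 2826800, 4745752]

/-- The words `golayWord i` as masks. -/
def golayWordMask : Fin 23 → ℕ :=
  ![8047777, 8218192, 4109096, 2054548, 1027274, 513637, 4451122, 2225561, 5307084, 2653542,
    1326771, 4857689, 6623148, 3311574, 1655787, 5022197, 6705402, 3352701, 5870654, 2935327,
    5661967, 7025287, 7706947]

theorem golayWord_eq : ∀ i : ZMod 23, golayWord i = ofMask (golayWordMask i) := by
  -- `340830` is the mask of the nonzero squares of `𝔽₂₃`
  have h : ∀ y : ZMod 23, (y ≠ 0 ∧ IsSquare y) ↔ Nat.testBit 340830 y.val = true := by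
    decide +kernel
  have h' : ∀ (i x : ZMod 23), (if Nat.testBit 340830 (x + i).val = true then (0 : ZMod 2) else 1) =
      ofMask (golayWordMask i) (some x) := by
    decide +kernel
  intro i
  funext x
  cases x with
  | none => revert i; decide +kernel
  | some x => rw [← h', golayWord]; simp only [h]

/-- The sum of `1` (if `b`) and of the words `golayWord i` for `i` in a list. -/
def combination (l : List (Fin 23)) (b : ℕ) : ℕ := l.foldr (fun i m => golayWordMask i ^^^ m) b

theorem combination_mem (l : List (Fin 23)) {b : ℕ} (hb : ofMask b ∈ golayCode) :
    ofMask (combination l b) ∈ golayCode := by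
  induction l with
  | nil => exact hb
  | cons i l ih =>
    change ofMask (golayWordMask i ^^^ combination l b) ∈ golayCode
    rw [ofMask_xor, ← golayWord_eq i]
    exact add_mem (Submodule.subset_span (Set.mem_insert_of_mem _ ⟨i, rfl⟩)) ih

theorem ofMask_golayMask_mem (j : Fin 12) : ofMask (golayMask j) ∈ golayCode := by
  have h0 : ofMask 0 ∈ golayCode := by rw [ofMask_zero]; exact zero_mem _
  have h1 : ofMask (2 ^ 24 - 1) ∈ golayCode := by
    have : ofMask (2 ^ 24 - 1) = 1 := by decide +kernel
    rw [this]
    exact Submodule.subset_span (Set.mem_insert _ _)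
  -- `2 ^ 24 - 1` is the mask of the all-one word
  have key : golayMask = ![combination [5, 8, 9] (2 ^ 24 - 1),
      combination [3, 4, 5, 6, 9] (2 ^ 24 - 1), combination [0, 3, 5, 10] (2 ^ 24 - 1),
      combination [1, 2, 4, 6, 7, 8] (2 ^ 24 - 1), combination [1, 4, 5] (2 ^ 24 - 1),
      combination [1, 5, 6, 7, 8, 9, 10] (2 ^ 24 - 1), combination [1, 4, 6, 8, 10] (2 ^ 24 - 1),
      combination [0, 2, 5, 6, 7, 9] 0, combination [2, 3, 4, 5, 6, 8, 9, 10] 0,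
      combination [0, 2, 6, 10] 0, combination [0, 2, 3, 4, 6, 9, 10] 0,
      combination [2, 5, 7, 8] 0] := by decide +kernel
  rw [key]
  fin_cases j
  all_goals first
    | exact combination_mem _ h0
    | exact combination_mem _ h1

/-- A word lies in the Golay code if and only if it is recovered from its values on the information
set `golayPivot`. -/
theorem mem_golayCode_iff {v : Option (ZMod 23) → ZMod 2} :
    v ∈ golayCode ↔ ∀ x, v x = ∑ j, v (golayPivot j) * ofMask (golayMask j) x := by
  constructor
  · intro hv
    induction hv using Submodule.span_induction with
    | mem v hv =>
      rcases hv with rfl | ⟨i, rfl⟩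
      · decide +kernel
      · rw [golayWord_eq]
        revert i
        have : ∀ i : Fin 23, ∀ x, ofMask (golayWordMask i) x =
          ∑ j, ofMask (golayWordMask i) (golayPivot j) * ofMask (golayMask j) x := by decide +kernel
        exact this
    | zero => simp
    | add v w _ _ hv hw =>
      intro x
      simp only [Pi.add_apply, hv x, hw x, add_mul, Finset.sum_add_distrib]
    | smul c v _ hv =>
      intro x
      simp only [Pi.smul_apply, smul_eq_mul]
      rw [hv x, Finset.mul_sum]
      simp only [mul_assoc]
  · intro h
    have : v = ∑ j, v (golayPivot j) • ofMask (golayMask j) := by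
      funext x
      rw [h x]
      simp [Finset.sum_apply]
    rw [this]
    exact sum_mem fun j _ => Submodule.smul_mem _ _ (ofMask_golayMask_mem j)

/-! ### Permutations preserving the Golay code -/

/-- To preserve the code it is enough to map it into itself, by finiteness. -/
theorem mem_M24_of_comp_mem {σ : Equiv.Perm (Option (ZMod 23))}
    (h : ∀ v ∈ golayCode, v ∘ σ ∈ golayCode) : σ ∈ M24 := by
  let L := LinearEquiv.funCongrLeft (ZMod 2) (ZMod 2) σ
  have hle : golayCode.map L.toLinearMap ≤ golayCode := by
    rintro _ ⟨v, hv, rfl⟩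
    exact h v hv
  have heq := Submodule.eq_of_le_of_finrank_eq hle (LinearEquiv.finrank_map_eq L golayCode)
  intro v
  refine ⟨fun hv => ?_, h v⟩
  rw [← heq] at hv
  obtain ⟨w, hw, e⟩ := hv
  rwa [← L.injective (show L w = L v from e)]

theorem mem_M24_of_golayMask {σ : Equiv.Perm (Option (ZMod 23))}
    (h : ∀ j, ofMask (golayMask j) ∘ σ ∈ golayCode) : σ ∈ M24 := by
  refine mem_M24_of_comp_mem fun v hv => ?_
  have : v ∘ σ = ∑ j, v (golayPivot j) • (ofMask (golayMask j) ∘ σ) := by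
    funext x
    rw [Function.comp_apply, mem_golayCode_iff.1 hv (σ x)]
    simp [Finset.sum_apply]
  rw [this]
  exact sum_mem fun j _ => Submodule.smul_mem _ _ (h j)

theorem comp_mem_of_mem_M24 {σ : Equiv.Perm (Option (ZMod 23))} (hσ : σ ∈ M24)
    {v : Option (ZMod 23) → ZMod 2} (hv : v ∈ golayCode) : v ∘ σ ∈ golayCode :=
  (hσ v).2 hv

/-- The support of a word. -/
def wordSupport (v : Option (ZMod 23) → ZMod 2) : Finset (Option (ZMod 23)) :=
  Finset.univ.filter fun x => v x = 1

theorem mem_wordSupport {v : Option (ZMod 23) → ZMod 2} {x : Option (ZMod 23)} :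
    x ∈ wordSupport v ↔ v x = 1 := by
  simp [wordSupport]

/-- The number of nonzero bits among the last `n` bits of a mask. -/
def bitCount : ℕ → ℕ → ℕ
  | 0, _ => 0
  | n + 1, m => m % 2 + bitCount n (m / 2)

theorem bitCount_eq (n m : ℕ) :
    bitCount n m = ((Finset.range n).filter fun i => m.testBit i = true).card := by
  induction n generalizing m with
  | zero => rfl
  | succ n ih =>
    rw [bitCount, ih, Finset.card_filter, Finset.card_filter, Finset.sum_range_succ', add_comm]
    simp only [Nat.testBit_succ, Nat.testBit_zero, decide_eq_true_eq]
    congr 1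
    split_ifs <;> omega

theorem card_wordSupport_ofMask (m : ℕ) : (wordSupport (ofMask m)).card = bitCount 24 m := by
  have hpos : ∀ x, bitPosition x < 24 := by decide +kernel
  have hinj : ∀ x y, bitPosition x = bitPosition y → x = y := by decide +kernel
  have hsurj : ∀ i < 24, ∃ x, bitPosition x = i := by decide +kernel
  rw [bitCount_eq]
  refine Finset.card_bij (fun x _ => bitPosition x) ?_ (fun x _ y _ => hinj x y) ?_
  · intro x hx
    rw [mem_wordSupport, ofMask] at hx
    rw [Finset.mem_filter, Finset.mem_range]
    refine ⟨hpos x, ?_⟩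
    by_contra hx'
    rw [if_neg hx'] at hx
    exact absurd hx (by decide)
  · intro i hi
    rw [Finset.mem_filter, Finset.mem_range] at hi
    obtain ⟨x, rfl⟩ := hsurj i hi.1
    exact ⟨x, by rw [mem_wordSupport, ofMask, if_pos hi.2], rfl⟩

/-- Whether a property of masks holds on all of the coset `w + ⟨bs⟩`, where the sums are bitwise. -/
def forallCoset (P : ℕ → Bool) : List ℕ → ℕ → Bool
  | [], w => P w
  | b :: bs, w => forallCoset P bs w && forallCoset P bs (w ^^^ b)

theorem exists_of_forallCoset {P : ℕ → Bool} {bs : List ℕ} {w : ℕ}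
    (h : forallCoset P bs w = true) {v : Option (ZMod 23) → ZMod 2}
    (hv : v ∈ Submodule.span (ZMod 2) {u | ∃ b ∈ bs, ofMask b = u}) :
    ∃ m, P m = true ∧ ofMask m = ofMask w + v := by
  induction bs generalizing w v with
  | nil =>
    have : v = 0 := by simpa using hv
    exact ⟨w, h, by rw [this, add_zero]⟩
  | cons b bs ih =>
    rw [forallCoset, Bool.and_eq_true] at h
    have hset : {u | ∃ c ∈ b :: bs, ofMask c = u} =
        insert (ofMask b) {u | ∃ c ∈ bs, ofMask c = u} := by
      ext u
      simp [eq_comm]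
    rw [hset, Submodule.mem_span_insert] at hv
    obtain ⟨a, z, hz, rfl⟩ := hv
    have ha : a = 0 ∨ a = 1 := by revert a; decide
    rcases ha with rfl | rfl
    · obtain ⟨m, hm, e⟩ := ih h.1 hz
      exact ⟨m, hm, by rw [e, zero_smul, zero_add]⟩
    · obtain ⟨m, hm, e⟩ := ih h.2 hz
      exact ⟨m, hm, by rw [e, one_smul, ofMask_xor, add_assoc]⟩

/-- The octad that contains `∞` and is stabilized by the second factor. -/
def octad : Finset (Option (ZMod 23)) :=
  {some 1, some 2, some 6, some 7, some 8, some 10, some 12, none}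

/-- The property of codewords that the enumeration of the Golay code has to establish: the weight
of a nonzero word is at least `8`, and a word of weight `8` through `∞` contains an image of
`octad` under a map `x ↦ s x + b` with `s` a nonzero square. -/
def enumerationTest (m : ℕ) : Bool :=
  (m == 0 || Nat.ble 8 (bitCount 24 m)) &&
  (!m.testBit 23 || !(bitCount 24 m == 8) ||
    [1, 2, 3, 4, 6, 8, 9, 12, 13, 16, 18].any fun s => (List.range 23).any fun b =>
      [1, 2, 6, 7, 8, 10, 12].all fun x => m.testBit ((s * x + b) % 23))

set_option maxRecDepth 10000 in
/-- The enumeration of the `2¹²` codewords, as the span of the words `golayMask j`. -/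
theorem exists_enumerationTest {v : Option (ZMod 23) → ZMod 2} (hv : v ∈ golayCode) :
    ∃ m, enumerationTest m = true ∧ ofMask m = v := by
  have key : forallCoset enumerationTest [8433200, 8604304, 9011740, 8479274, 9102080, 9169016,
      9050664, 641569, 442936, 1288712, 2826800, 4745752] 0 = true := by decide +kernel
  have hmem : ∀ j, golayMask j ∈ [8433200, 8604304, 9011740, 8479274, 9102080, 9169016,
      9050664, 641569, 442936, 1288712, 2826800, 4745752] := by decide +kernel
  obtain ⟨m, hm, e⟩ := exists_of_forallCoset key (v := v) (by
    have : v = ∑ j, v (golayPivot j) • ofMask (golayMask j) := by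
      funext x
      rw [mem_golayCode_iff.1 hv x]
      simp [Finset.sum_apply]
    rw [this]
    exact sum_mem fun j _ => Submodule.smul_mem _ _
      (Submodule.subset_span ⟨golayMask j, hmem j, rfl⟩))
  exact ⟨m, hm, by rw [e, ofMask_zero, zero_add]⟩

/-- The minimal distance of the Golay code is at least `8`. -/
theorem eight_le_card_wordSupport {v : Option (ZMod 23) → ZMod 2} (hv : v ∈ golayCode)
    (h0 : v ≠ 0) : 8 ≤ (wordSupport v).card := by
  obtain ⟨m, hm, rfl⟩ := exists_enumerationTest hv
  rw [card_wordSupport_ofMask]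
  rw [enumerationTest, Bool.and_eq_true, Bool.or_eq_true] at hm
  rcases hm.1 with h | h
  · rw [beq_iff_eq] at h
    subst h
    exact absurd ofMask_zero h0
  · exact Nat.le_of_ble_eq_true h

/-- Every octad through `∞` is an image of `octad` under an affine map with square multiplier. -/
theorem exists_affine_image_of_octad {v : Option (ZMod 23) → ZMod 2} (hv : v ∈ golayCode)
    (hinf : v none = 1) (h8 : (wordSupport v).card = 8) :
    ∃ s b : ZMod 23, s ≠ 0 ∧ IsSquare s ∧ ∀ x : ZMod 23, some x ∈ octad →
      v (some (s * x + b)) = 1 := by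
  obtain ⟨m, hm, rfl⟩ := exists_enumerationTest hv
  rw [card_wordSupport_ofMask] at h8
  have hbit : m.testBit 23 = true := by
    by_contra h
    rw [ofMask, bitPosition, if_neg h] at hinf
    exact absurd hinf (by decide)
  simp only [enumerationTest, hbit, h8, Bool.and_eq_true, Bool.or_eq_true, List.any_eq_true,
    List.all_eq_true, Bool.not_true, BEq.rfl, Bool.false_eq_true, false_or] at hm
  obtain ⟨-, s, hs, b, hb, h⟩ := hm
  rw [List.mem_range] at hb
  have hs' : ∀ s ∈ [(1 : ℕ), 2, 3, 4, 6, 8, 9, 12, 13, 16, 18], (s : ZMod 23) ≠ 0 ∧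
      IsSquare (s : ZMod 23) := by decide +kernel
  have hx' : ∀ x : ZMod 23, some x ∈ octad → x.val ∈ [1, 2, 6, 7, 8, 10, 12] := by decide +kernel
  refine ⟨s, b, (hs' s hs).1, (hs' s hs).2, fun x hx => ?_⟩
  have : bitPosition (some ((s : ZMod 23) * x + b)) = (s * x.val + b) % 23 := by
    rw [bitPosition, ← ZMod.val_natCast]
    push_cast
    rw [ZMod.natCast_val, ZMod.cast_id]
  rw [ofMask, this, h _ (hx' x hx), if_pos rfl]

/-! ### Möbius transformations preserve the Golay code -/

instance : Fact (Nat.Prime 23) := ⟨by norm_num⟩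

/-- The action of `SL(2, 23)` on the projective line by Möbius transformations. -/
noncomputable def moebius : SL(2, ZMod 23) →* Equiv.Perm (Option (ZMod 23)) :=
  (MulAction.toPermHom (GL (Fin 2) (ZMod 23)) (OnePoint (ZMod 23))).comp
    Matrix.SpecialLinearGroup.toGL

theorem moebius_none (g : SL(2, ZMod 23)) :
    moebius g none = if g 1 0 = 0 then none else some (g 0 0 / g 1 0) :=
  OnePoint.smul_infty_eq_ite (Matrix.SpecialLinearGroup.toGL g)

theorem moebius_some (g : SL(2, ZMod 23)) (x : ZMod 23) :
    moebius g (some x) = if g 1 0 * x + g 1 1 = 0 then none else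
      some ((g 0 0 * x + g 0 1) / (g 1 0 * x + g 1 1)) :=
  OnePoint.smul_some_eq_ite (g := Matrix.SpecialLinearGroup.toGL g) (k := x)

/-- The matrix of the affine map `x ↦ r² x + b`. -/
def affineMatrix (r b : ZMod 23) (hr : r ≠ 0) : SL(2, ZMod 23) :=
  ⟨!![r, b * r⁻¹; 0, r⁻¹], by simp [Matrix.det_fin_two, hr]⟩

theorem coe_affineMatrix (r b : ZMod 23) (hr : r ≠ 0) :
    (affineMatrix r b hr : Matrix (Fin 2) (Fin 2) (ZMod 23)) = !![r, b * r⁻¹; 0, r⁻¹] := rfl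

theorem moebius_affineMatrix_none (r b : ZMod 23) (hr : r ≠ 0) :
    moebius (affineMatrix r b hr) none = none := by
  rw [moebius_none]
  simp [coe_affineMatrix]

theorem moebius_affineMatrix_some (r b : ZMod 23) (hr : r ≠ 0) (x : ZMod 23) :
    moebius (affineMatrix r b hr) (some x) = some (r * r * x + b) := by
  rw [moebius_some]
  simp [coe_affineMatrix, hr]
  field_simp

/-- A matrix of determinant one that maps `∞` to `t`. -/
def inversionMatrix (t : ZMod 23) : SL(2, ZMod 23) :=
  ⟨!![t, -1; 1, 0], by simp [Matrix.det_fin_two]⟩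

theorem coe_inversionMatrix (t : ZMod 23) :
    (inversionMatrix t : Matrix (Fin 2) (Fin 2) (ZMod 23)) = !![t, -1; 1, 0] := rfl

theorem exists_moebius_none_eq (p : Option (ZMod 23)) : ∃ g, moebius g none = p := by
  cases p with
  | none => exact ⟨1, by simp⟩
  | some t => exact ⟨inversionMatrix t, by rw [moebius_none]; simp [coe_inversionMatrix]⟩

theorem eq_affineMatrix_of_eq_zero (g : SL(2, ZMod 23)) (h : g 1 0 = 0) :
    ∃ (r b : ZMod 23) (hr : r ≠ 0), g = affineMatrix r b hr := by
  have hdet := g.det_coe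
  rw [Matrix.det_fin_two, h, mul_zero, sub_zero] at hdet
  have hr : g 0 0 ≠ 0 := left_ne_zero_of_mul_eq_one hdet
  refine ⟨g 0 0, g 0 1 * g 0 0, hr, ?_⟩
  ext i j
  fin_cases i <;> fin_cases j
  · rfl
  · simp [coe_affineMatrix, hr]
  · exact h
  · exact eq_inv_of_mul_eq_one_right hdet

/-- Affine maps with square multiplier permute the generators `golayWord i`. -/
theorem moebius_mem_M24_of_affine {σ : Equiv.Perm (Option (ZMod 23))} {s b : ZMod 23} (hs : s ≠ 0)
    (hsq : IsSquare s) (h0 : σ none = none) (h : ∀ x, σ (some x) = some (s * x + b)) :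
    σ ∈ M24 := by
  refine mem_M24_of_comp_mem fun v hv => ?_
  induction hv using Submodule.span_induction with
  | mem v hv =>
    rcases hv with rfl | ⟨i, rfl⟩
    · exact Submodule.subset_span (Set.mem_insert _ _)
    · have : golayWord i ∘ σ = golayWord ((b + i) / s) := by
        funext x
        cases x with
        | none => simp [h0, golayWord]
        | some x =>
          have e : s * x + b + i = s * (x + (b + i) / s) := by field_simp; ring
          have e' : IsSquare (s * (x + (b + i) / s)) ↔ IsSquare (x + (b + i) / s) := by
            refine ⟨fun h' => ?_, hsq.mul⟩
            have := h'.div hsq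
            rwa [mul_div_cancel_left₀ _ hs] at this
          simp only [Function.comp_apply, h, golayWord, e, e', ne_eq, mul_eq_zero, hs, false_or]
      rw [this]
      exact Submodule.subset_span (Set.mem_insert_of_mem _ ⟨_, rfl⟩)
  | zero => exact zero_mem _
  | add v w _ _ hv hw => exact add_mem hv hw
  | smul c v _ hv => exact Submodule.smul_mem _ c hv

/-- The map `x ↦ -1/x` of the projective line, with `1/x` computed as `x²¹`. -/
def negInv : Option (ZMod 23) → Option (ZMod 23)
  | none => some 0
  | some x => if x = 0 then none else some (-x ^ 21)

theorem moebius_inversionMatrix_zero : ⇑(moebius (inversionMatrix 0)) = negInv := by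
  funext x
  cases x with
  | none => rw [moebius_none]; simp [coe_inversionMatrix, negInv]
  | some x =>
    by_cases hx : x = 0
    · rw [moebius_some]; simp [coe_inversionMatrix, negInv, hx]
    · have h : x ^ 21 * x = 1 := by
        have := ZMod.pow_card_sub_one_eq_one hx
        rw [← this, ← pow_succ]
      have : -x ^ 21 = -1 / x := by rw [eq_div_iff hx, neg_mul, h]
      rw [moebius_some]; simp [coe_inversionMatrix, negInv, hx, this]

theorem moebius_inversionMatrix_zero_mem : moebius (inversionMatrix 0) ∈ M24 := by
  refine mem_M24_of_golayMask fun j => ?_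
  rw [moebius_inversionMatrix_zero, mem_golayCode_iff]
  revert j
  decide +kernel

theorem moebius_mem_M24 (g : SL(2, ZMod 23)) : moebius g ∈ M24 := by
  have haff : ∀ (r b : ZMod 23) (hr : r ≠ 0), moebius (affineMatrix r b hr) ∈ M24 :=
    fun r b hr => moebius_mem_M24_of_affine (mul_ne_zero hr hr) ⟨r, rfl⟩
      (moebius_affineMatrix_none r b hr) (moebius_affineMatrix_some r b hr)
  by_cases hc : g 1 0 = 0
  · obtain ⟨r, b, hr, rfl⟩ := eq_affineMatrix_of_eq_zero g hc
    exact haff r b hr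
  · -- the Bruhat decomposition of `g`
    have hdet := g.det_coe
    rw [Matrix.det_fin_two] at hdet
    have : g = affineMatrix 1 (g 0 0 / g 1 0) one_ne_zero * inversionMatrix 0 *
        affineMatrix (g 1 0) (g 1 1 * g 1 0) hc := by
      ext i j
      fin_cases i <;> fin_cases j <;>
        simp [coe_affineMatrix, coe_inversionMatrix, hc]
      field_simp
      linear_combination -hdet
    rw [this, map_mul, map_mul]
    exact mul_mem (mul_mem (haff _ _ _) moebius_inversionMatrix_zero_mem) (haff _ _ _)

/-- The Möbius action as a homomorphism to `M₂₄`. -/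
noncomputable def moebiusM24 : SL(2, ZMod 23) →* M24 := moebius.codRestrict M24 moebius_mem_M24

/-- The copy of `PSL(2, 23)` in `M₂₄`. -/
noncomputable def pslSubgroup : Subgroup M24 := moebiusM24.range

theorem ker_moebiusM24 : moebiusM24.ker = Subgroup.center SL(2, ZMod 23) := by
  ext g
  have hker : g ∈ moebiusM24.ker ↔ moebius g = 1 := by
    rw [MonoidHom.mem_ker, Subtype.ext_iff]
    rfl
  rw [hker, Matrix.SpecialLinearGroup.mem_center_iff]
  constructor
  · intro h
    have h1 : moebius g none = none := by rw [h]; rfl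
    have h2 : g 1 0 = 0 := by
      by_contra hc
      rw [moebius_none, if_neg hc] at h1
      exact Option.some_ne_none _ h1
    obtain ⟨r, b, hr, rfl⟩ := eq_affineMatrix_of_eq_zero g h2
    have h3 := moebius_affineMatrix_some r b hr 0
    have h4 := moebius_affineMatrix_some r b hr 1
    rw [h, Equiv.Perm.one_apply, Option.some_inj] at h3 h4
    have hb : b = 0 := by simpa using h3.symm
    have hr2 : r * r = 1 := by simpa [hb] using h4.symm
    refine ⟨r, by rw [Fintype.card_fin, pow_two, hr2], ?_⟩
    have hri : r⁻¹ = r := inv_eq_of_mul_eq_one_left hr2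
    ext i j
    fin_cases i <;> fin_cases j <;> simp [coe_affineMatrix, hb, hri]
  · rintro ⟨r, hr, e⟩
    have hr0 : r ≠ 0 := by
      rintro rfl
      simp at hr
    have e00 : g 0 0 = r := by rw [← e]; simp
    have e01 : g 0 1 = 0 := by rw [← e]; simp
    have e10 : g 1 0 = 0 := by rw [← e]; simp
    have e11 : g 1 1 = r := by rw [← e]; simp
    ext1 x
    cases x with
    | none => rw [moebius_none]; simp [e10]
    | some x => rw [moebius_some]; simp [e00, e01, e10, e11, hr0]

theorem nonempty_pslSubgroup_mulEquiv : Nonempty (pslSubgroup ≃* PSL(2, ZMod 23)) :=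
  ⟨((QuotientGroup.quotientMulEquivOfEq ker_moebiusM24.symm).trans
    (QuotientGroup.quotientKerEquivRange moebiusM24)).symm⟩

theorem isPerfect_pslSubgroup : Group.IsPerfect pslSubgroup := by
  obtain ⟨e⟩ := nonempty_pslSubgroup_mulEquiv
  have : Group.IsPerfect PSL(2, ZMod 23) :=
    ⟨SL2Simple.PSL_commutator_eq_top ⟨2, by decide +kernel, by decide +kernel⟩⟩
  exact Group.IsPerfect.ofSurjective (f := e.symm.toMonoidHom) e.symm.surjective

theorem mem_pslSubgroup {σ : M24} : σ ∈ pslSubgroup ↔ ∃ g, moebius g = σ := by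
  constructor
  · rintro ⟨g, rfl⟩
    exact ⟨g, rfl⟩
  · rintro ⟨g, e⟩
    exact ⟨g, Subtype.ext e⟩

theorem exists_affine_of_mem_pslSubgroup {σ : M24} (hσ : σ ∈ pslSubgroup)
    (h0 : (σ : Equiv.Perm (Option (ZMod 23))) none = none) : ∃ r b : ZMod 23, r ≠ 0 ∧
      ∀ x, (σ : Equiv.Perm (Option (ZMod 23))) (some x) = some (r * r * x + b) := by
  obtain ⟨g, e⟩ := mem_pslSubgroup.1 hσ
  rw [← e] at h0 ⊢
  have h2 : g 1 0 = 0 := by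
    by_contra hc
    rw [moebius_none, if_neg hc] at h0
    exact Option.some_ne_none _ h0
  obtain ⟨r, b, hr, rfl⟩ := eq_affineMatrix_of_eq_zero g h2
  exact ⟨r, b, hr, moebius_affineMatrix_some r b hr⟩

/-- A nonsquare multiplier maps `golayWord 0` to its image under `x ↦ -x`, which belongs to the
other quadratic residue code and not to the Golay code. -/
theorem isSquare_of_mul_mem_M24 {σ : Equiv.Perm (Option (ZMod 23))} (hσ : σ ∈ M24) {c : ZMod 23}
    (hc : c ≠ 0) (h0 : σ none = none) (h : ∀ x, σ (some x) = some (c * x)) : IsSquare c := by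
  by_contra hns
  have hns' : ∀ c : ZMod 23, c ≠ 0 → ¬ IsSquare c → ∀ x : ZMod 23,
      (if c * x + 0 ≠ 0 ∧ IsSquare (c * x + 0) then (0 : ZMod 2) else 1) =
        golayWord 0 (some (-x)) := by
    decide +kernel
  have key : golayWord 0 ∘ σ = fun x => golayWord 0 (x.map fun y => -y) := by
    funext x
    cases x with
    | none => simp [h0]
    | some x =>
      rw [Function.comp_apply, h, golayWord, hns' c hc hns]
      rfl
  have hmem : golayWord 0 ∘ σ ∈ golayCode :=
    comp_mem_of_mem_M24 hσ (Submodule.subset_span (Set.mem_insert_of_mem _ ⟨0, rfl⟩))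
  rw [key, golayWord_eq, mem_golayCode_iff] at hmem
  revert hmem
  decide +kernel

/-! ### The stabilizer of a flag of a point and an octad, and the factorization -/

/-- The stabilizer in `M₂₄` of the flag formed by `∞` and the octad `octad`. -/
def flagStabilizer : Subgroup M24 where
  carrier := {σ | (σ : Equiv.Perm (Option (ZMod 23))) none = none ∧
    ∀ x, (σ : Equiv.Perm (Option (ZMod 23))) x ∈ octad ↔ x ∈ octad}
  mul_mem' {σ τ} hσ hτ := ⟨by simp [hσ.1, hτ.1], fun x => by simp [hσ.2, hτ.2]⟩
  one_mem' := ⟨rfl, fun x => Iff.rfl⟩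
  inv_mem' {σ} hσ := by
    refine ⟨?_, fun x => ?_⟩
    · rw [Subgroup.coe_inv, Equiv.Perm.inv_eq_iff_eq, hσ.1]
    · rw [← hσ.2, ← Equiv.Perm.mul_apply, ← Subgroup.coe_mul, mul_inv_cancel]
      rfl

theorem mem_flagStabilizer_of_forall_mem {σ : M24}
    (h0 : (σ : Equiv.Perm (Option (ZMod 23))) none = none)
    (h : ∀ x ∈ octad, (σ : Equiv.Perm (Option (ZMod 23))) x ∈ octad) : σ ∈ flagStabilizer := by
  refine ⟨h0, fun x => ⟨fun hx => ?_, h x⟩⟩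
  have heq : octad.map (σ : Equiv.Perm (Option (ZMod 23))).toEmbedding = octad := by
    refine Finset.eq_of_subset_of_card_le ?_ (by rw [Finset.card_map])
    intro y hy
    obtain ⟨z, hz, rfl⟩ := Finset.mem_map.1 hy
    exact h z hz
  rw [← heq, Finset.mem_map] at hx
  obtain ⟨z, hz, e⟩ := hx
  rwa [← (σ : Equiv.Perm (Option (ZMod 23))).injective e]

/-- The indicator function of the octad. -/
def octadWord (x : Option (ZMod 23)) : ZMod 2 := if x ∈ octad then 1 else 0

theorem octadWord_eq_one {x : Option (ZMod 23)} : octadWord x = 1 ↔ x ∈ octad := by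
  rw [octadWord]
  split_ifs with h <;> simp [h]

theorem octadWord_mem : octadWord ∈ golayCode := by
  rw [mem_golayCode_iff]
  decide +kernel

theorem card_wordSupport_comp (v : Option (ZMod 23) → ZMod 2)
    (σ : Equiv.Perm (Option (ZMod 23))) : (wordSupport (v ∘ σ)).card = (wordSupport v).card := by
  refine Finset.card_bij (fun x _ => σ x) (fun x hx => ?_) (fun x _ y _ e => σ.injective e)
    fun y hy => ?_
  · rw [mem_wordSupport] at hx ⊢
    exact hx
  · refine ⟨σ.symm y, ?_, σ.apply_symm_apply y⟩
    rw [mem_wordSupport] at hy ⊢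
    rw [Function.comp_apply, σ.apply_symm_apply, hy]

/-- `PSL(2, 23)` is simply transitive on the flags formed by a point and an octad through it: it is
transitive on the points, its affine maps are transitive on the octads through `∞`, and only the
identity among them preserves `octad`. -/
theorem isExactFactorization_psl_flagStabilizer :
    IsExactFactorization pslSubgroup flagStabilizer where
  exists_mul_eq σ := by
    obtain ⟨g, hg⟩ := exists_moebius_none_eq ((σ : Equiv.Perm (Option (ZMod 23))) none)
    set τ : M24 := (moebiusM24 g)⁻¹ * σ with hτ
    have hτ0 : (τ : Equiv.Perm (Option (ZMod 23))) none = none := by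
      rw [hτ, Subgroup.coe_mul, Equiv.Perm.mul_apply, Subgroup.coe_inv, Equiv.Perm.inv_eq_iff_eq]
      exact hg.symm
    have hτ0' : ((τ⁻¹ : M24) : Equiv.Perm (Option (ZMod 23))) none = none := by
      rw [Subgroup.coe_inv, Equiv.Perm.inv_eq_iff_eq, hτ0]
    have hv := comp_mem_of_mem_M24 (τ⁻¹ : M24).2 octadWord_mem
    obtain ⟨s, b, hs, ⟨r, rfl⟩, h⟩ := exists_affine_image_of_octad hv
      (by rw [Function.comp_apply, hτ0']; decide +kernel)
      (by rw [card_wordSupport_comp]; decide +kernel)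
    have hr : r ≠ 0 := left_ne_zero_of_mul hs
    set α : M24 := moebiusM24 (affineMatrix r b hr) with hα
    have hα0 : (α : Equiv.Perm (Option (ZMod 23))) none = none := moebius_affineMatrix_none r b hr
    have hx : τ⁻¹ * α ∈ flagStabilizer := by
      refine mem_flagStabilizer_of_forall_mem ?_ fun x hx => ?_
      · rw [Subgroup.coe_mul, Equiv.Perm.mul_apply, hα0, hτ0']
      · rw [Subgroup.coe_mul, Equiv.Perm.mul_apply]
        cases x with
        | none => rwa [hα0, hτ0']
        | some x =>
          rw [← octadWord_eq_one]
          have : (α : Equiv.Perm (Option (ZMod 23))) (some x) = some (r * r * x + b) :=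
            moebius_affineMatrix_some r b hr x
          rw [this]
          exact h x hx
    refine ⟨moebiusM24 g * α, mul_mem ⟨g, rfl⟩ ⟨_, rfl⟩, (τ⁻¹ * α)⁻¹, inv_mem hx, ?_⟩
    rw [hτ]
    group
  inf_eq_bot := by
    rw [eq_bot_iff]
    rintro σ ⟨h1, h0, h2⟩
    obtain ⟨r, b, hr, h⟩ := exists_affine_of_mem_pslSubgroup h1 h0
    have key : ∀ s b : ZMod 23, s ≠ 0 →
        (∀ x ∈ ([1, 2, 6, 7, 8, 10, 12] : List (ZMod 23)), some (s * x + b) ∈ octad) →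
          s = 1 ∧ b = 0 := by
      decide +kernel
    have hmem : ∀ x ∈ ([1, 2, 6, 7, 8, 10, 12] : List (ZMod 23)), some x ∈ octad := by
      decide +kernel
    obtain ⟨hs, rfl⟩ := key (r * r) b (mul_ne_zero hr hr) fun x hx => by
      rw [← h, h2]
      exact hmem x hx
    rw [Subgroup.mem_bot]
    refine Subtype.ext (Equiv.ext fun x => ?_)
    cases x with
    | none => exact h0
    | some x => rw [h, hs]; simp

/-- An element of the normalizer can be corrected by `PSL(2, 23)` to fix `∞` and `0`. Since the
translations are the only elements of `PSL(2, 23)` whose unique fixed point is `∞`, it then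
normalizes the group of translations, hence is multiplication by a scalar, which has to be a square
because the nonsquares do not preserve the code. -/
theorem normalizer_pslSubgroup :
    Subgroup.normalizer (pslSubgroup : Set M24) = pslSubgroup := by
  refine le_antisymm (fun n hn => ?_) Subgroup.le_normalizer
  obtain ⟨g, hg⟩ := exists_moebius_none_eq ((n : Equiv.Perm (Option (ZMod 23))) none)
  -- the case of an element that fixes `∞` and `0`
  have main : ∀ n ∈ Subgroup.normalizer (pslSubgroup : Set M24),
      (n : Equiv.Perm (Option (ZMod 23))) none = none →
      (n : Equiv.Perm (Option (ZMod 23))) (some 0) = some 0 → n ∈ pslSubgroup := by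
    intro n hn h0 hz
    have hfin : ∀ x : ZMod 23, ∃ y : ZMod 23,
        (n : Equiv.Perm (Option (ZMod 23))) (some x) = some y := by
      intro x
      rcases h : (n : Equiv.Perm (Option (ZMod 23))) (some x) with _ | y
      · rw [← h0] at h
        exact absurd ((n : Equiv.Perm (Option (ZMod 23))).injective h) (Option.some_ne_none x)
      · exact ⟨y, rfl⟩
    choose f hf using hfin
    set t : M24 := moebiusM24 (affineMatrix 1 1 one_ne_zero) with ht
    have ht0 : (t : Equiv.Perm (Option (ZMod 23))) none = none := moebius_affineMatrix_none _ _ _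
    have ht1 : ∀ x, (t : Equiv.Perm (Option (ZMod 23))) (some x) = some (x + 1) := by
      intro x
      have := moebius_affineMatrix_some 1 1 one_ne_zero x
      rw [one_mul, one_mul] at this
      exact this
    have hconj : n * t * n⁻¹ ∈ pslSubgroup :=
      (Subgroup.mem_normalizer_iff.1 hn t).1 ⟨_, rfl⟩
    have hninv : ((n⁻¹ : M24) : Equiv.Perm (Option (ZMod 23))) none = none := by
      rw [Subgroup.coe_inv, Equiv.Perm.inv_eq_iff_eq, h0]
    obtain ⟨r, b, hr, h⟩ := exists_affine_of_mem_pslSubgroup hconj (by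
      rw [Subgroup.coe_mul, Subgroup.coe_mul, Equiv.Perm.mul_apply, Equiv.Perm.mul_apply, hninv,
        ht0, h0])
    have hstep : ∀ x, f (x + 1) = r * r * f x + b := by
      intro x
      have := h (f x)
      rw [← hf x, Subgroup.coe_mul, Subgroup.coe_mul, Equiv.Perm.mul_apply, Equiv.Perm.mul_apply,
        Subgroup.coe_inv, Equiv.Perm.inv_def, Equiv.symm_apply_apply, ht1, hf,
        Option.some_inj] at this
      exact this
    have hinj : ∀ x y, f x = f y → x = y := fun x y e =>
      Option.some_injective _ ((n : Equiv.Perm (Option (ZMod 23))).injective (by rw [hf, hf, e]))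
    have hsurj : Function.Surjective f := Finite.injective_iff_surjective.1 hinj
    have hr1 : r * r = 1 := by
      by_contra hne
      obtain ⟨x, hx⟩ := hsurj (b / (1 - r * r))
      have hne' : 1 - r * r ≠ 0 := sub_ne_zero.2 (Ne.symm hne)
      have := hinj (x + 1) x (by
        rw [hstep, hx]
        linear_combination -div_mul_cancel₀ b hne')
      rw [add_eq_left] at this
      exact one_ne_zero this
    have hf0 : f 0 = 0 := by
      have := hf 0
      rw [hz, Option.some_inj] at this
      exact this.symm
    have hlin : ∀ x, f x = b * x := by
      have : ∀ k : ℕ, f k = b * k := by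
        intro k
        induction k with
        | zero => simp [hf0]
        | succ k ih =>
          push_cast
          rw [hstep, ih, hr1]
          ring
      intro x
      have h := this x.val
      rwa [ZMod.natCast_zmod_val] at h
    have hb : b ≠ 0 := by
      rintro rfl
      exact one_ne_zero (hinj 1 0 (by rw [hlin, hlin, zero_mul, zero_mul]))
    obtain ⟨c, rfl⟩ := isSquare_of_mul_mem_M24 n.2 hb h0 fun x => by rw [hf, hlin]
    have hc : c ≠ 0 := left_ne_zero_of_mul hb
    refine mem_pslSubgroup.2 ⟨affineMatrix c 0 hc, Equiv.ext fun x => ?_⟩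
    cases x with
    | none => rw [moebius_affineMatrix_none, h0]
    | some x => rw [moebius_affineMatrix_some, hf, hlin, add_zero]
  have hA : moebiusM24 g ∈ pslSubgroup := ⟨g, rfl⟩
  set m : M24 := (moebiusM24 g)⁻¹ * n with hm
  have hm0 : (m : Equiv.Perm (Option (ZMod 23))) none = none := by
    rw [hm, Subgroup.coe_mul, Equiv.Perm.mul_apply, Subgroup.coe_inv, Equiv.Perm.inv_eq_iff_eq]
    exact hg.symm
  obtain ⟨y, hy⟩ : ∃ y : ZMod 23, (m : Equiv.Perm (Option (ZMod 23))) (some 0) = some y := by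
    rcases h : (m : Equiv.Perm (Option (ZMod 23))) (some 0) with _ | y
    · rw [← hm0] at h
      exact absurd ((m : Equiv.Perm (Option (ZMod 23))).injective h) (Option.some_ne_none 0)
    · exact ⟨y, rfl⟩
  have hB : moebiusM24 (affineMatrix 1 (-y) one_ne_zero) ∈ pslSubgroup := ⟨_, rfl⟩
  have hfinal := main (moebiusM24 (affineMatrix 1 (-y) one_ne_zero) * m)
    (mul_mem (Subgroup.le_normalizer hB) (mul_mem (inv_mem (Subgroup.le_normalizer hA)) hn))
    (by
      rw [Subgroup.coe_mul, Equiv.Perm.mul_apply, hm0]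
      exact moebius_affineMatrix_none _ _ _)
    (by
      rw [Subgroup.coe_mul, Equiv.Perm.mul_apply, hy]
      exact (moebius_affineMatrix_some _ _ _ _).trans (by simp))
  rw [Subgroup.mul_mem_cancel_left _ hB, hm, Subgroup.mul_mem_cancel_left _ (inv_mem hA)] at hfinal
  exact hfinal

/-! ### Coordinates adapted to an octad -/

/-- The points of the octad. -/
def octadPoint : Fin 8 → Option (ZMod 23) :=
  ![some 10, some 7, some 2, some 1, some 8, some 6, some 12, none]

/-- Affine coordinates on the complement of the octad, for which the codewords that vanish on the
octad are the affine functions. The space is written multiplicatively, as the group of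
translations. -/
def affinePoint (v : Multiplicative (Fin 4 → ZMod 2)) : Option (ZMod 23) :=
  some ((![0, 18, 20, 15, 21, 5, 16, 17, 22, 14, 11, 3, 19, 4, 13, 9] : Fin 16 → ZMod 23)
    (Fin.ofNat 16 ((v.toAdd 0).val + 2 * (v.toAdd 1).val + 4 * (v.toAdd 2).val +
      8 * (v.toAdd 3).val)))

theorem bijective_elim_octadPoint_affinePoint :
    Function.Bijective (Sum.elim octadPoint affinePoint) := by
  rw [Fintype.bijective_iff_surjective_and_card]
  exact ⟨by decide +kernel, by decide +kernel⟩

/-- The points as the disjoint union of the octad and an affine space of dimension four. -/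
noncomputable def label : Fin 8 ⊕ Multiplicative (Fin 4 → ZMod 2) ≃ Option (ZMod 23) :=
  Equiv.ofBijective _ bijective_elim_octadPoint_affinePoint

theorem label_inl (i : Fin 8) : label (Sum.inl i) = octadPoint i := rfl

theorem label_inr (v : Multiplicative (Fin 4 → ZMod 2)) :
    label (Sum.inr v) = affinePoint v := rfl

theorem label_inl_mem (i : Fin 8) : label (Sum.inl i) ∈ octad := by
  rw [label_inl]; revert i; decide +kernel

theorem label_inr_notMem (v : Multiplicative (Fin 4 → ZMod 2)) : label (Sum.inr v) ∉ octad := by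
  rw [label_inr]; revert v; decide +kernel

/-- The permutation of the points given by a permutation of the octad and one of the affine
space. -/
noncomputable def splitHom :
    Equiv.Perm (Fin 8) × Equiv.Perm (Multiplicative (Fin 4 → ZMod 2)) →*
      Equiv.Perm (Option (ZMod 23)) :=
  label.permCongrHom.toMonoidHom.comp (Equiv.Perm.sumCongrHom _ _)

theorem splitHom_label (π : Equiv.Perm (Fin 8))
    (φ : Equiv.Perm (Multiplicative (Fin 4 → ZMod 2))) (y) :
    splitHom (π, φ) (label y) = label (Sum.map π φ y) := by
  change label (Equiv.sumCongr π φ (label.symm (label y))) = _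
  rw [Equiv.symm_apply_apply]
  rfl

/-- The labels of the information set `golayPivot`. -/
def pivotLabel : Fin 12 → Fin 8 ⊕ Multiplicative (Fin 4 → ZMod 2) :=
  ![.inl 0, .inl 1, .inl 2, .inl 3, .inl 4, .inl 5, .inl 6, .inr 1,
    .inr (.ofAdd (Pi.single 0 1)), .inr (.ofAdd (Pi.single 1 1)), .inr (.ofAdd (Pi.single 2 1)),
    .inr (.ofAdd (Pi.single 3 1))]

theorem label_pivotLabel (k : Fin 12) : label (pivotLabel k) = golayPivot k := by
  change Sum.elim octadPoint affinePoint (pivotLabel k) = _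
  revert k
  decide +kernel

/-- The basis words of the Golay code in the labelled coordinates. -/
def basisWord (j : Fin 12) (y : Fin 8 ⊕ Multiplicative (Fin 4 → ZMod 2)) : ZMod 2 :=
  ofMask (golayMask j) (Sum.elim octadPoint affinePoint y)

theorem basisWord_eq (j : Fin 12) (y) : ofMask (golayMask j) (label y) = basisWord j y := rfl

theorem splitHom_mem (π : Equiv.Perm (Fin 8))
    (φ : Equiv.Perm (Multiplicative (Fin 4 → ZMod 2)))
    (h : ∀ j y, basisWord j (Sum.map π φ y) =
      ∑ k, basisWord j (Sum.map π φ (pivotLabel k)) * basisWord k y) :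
    splitHom (π, φ) ∈ M24 := by
  refine mem_M24_of_golayMask fun j => mem_golayCode_iff.2 fun x => ?_
  obtain ⟨y, rfl⟩ := label.surjective x
  simp only [Function.comp_apply, ← label_pivotLabel, splitHom_label, basisWord_eq]
  exact h j y

/-- The translations of the affine space extend by the identity of the octad. -/
theorem splitHom_one_mulLeft_mem (w : Multiplicative (Fin 4 → ZMod 2)) :
    splitHom (1, MulAction.toPermHom _ _ w) ∈ M24 := by
  have hgen : ∀ i : Fin 4, splitHom (1, MulAction.toPermHom _ _
      (Multiplicative.ofAdd (Pi.single i 1 : Fin 4 → ZMod 2))) ∈ M24 := by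
    intro i
    apply splitHom_mem
    revert i
    decide +kernel
  have hprod : ∀ w : Multiplicative (Fin 4 → ZMod 2),
      w = ∏ i, (Multiplicative.ofAdd (Pi.single i 1 : Fin 4 → ZMod 2)) ^ (w.toAdd i).val := by
    decide +kernel
  let f : Multiplicative (Fin 4 → ZMod 2) →* Equiv.Perm (Option (ZMod 23)) :=
    splitHom.comp ((1 : _ →* Equiv.Perm (Fin 8)).prod (MulAction.toPermHom _ _))
  change w ∈ M24.comap f
  rw [hprod w]
  exact prod_mem fun i _ => pow_mem (show _ ∈ M24.comap f from hgen i) _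

/-- A seven-cycle. -/
def sevenCycle : Equiv.Perm (Fin 8) :=
  ⟨![0, 2, 3, 4, 5, 6, 7, 1], ![0, 7, 1, 2, 3, 4, 5, 6], by decide, by decide⟩

/-- A three-cycle. -/
def threeCycle : Equiv.Perm (Fin 8) := Equiv.swap 0 6 * Equiv.swap 0 5

/-- The linear map that extends `sevenCycle` to an element of `M₂₄`. -/
def sevenMatrix : SL(4, ZMod 2) :=
  ⟨!![0, 1, 0, 0; 0, 0, 1, 0; 1, 0, 1, 0; 0, 0, 0, 1], by decide +kernel⟩

/-- The linear map that extends `threeCycle` to an element of `M₂₄`. -/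
def threeMatrix : SL(4, ZMod 2) :=
  ⟨!![0, 0, 1, 0; 0, 0, 0, 1; 1, 0, 1, 0; 0, 1, 0, 1], by decide +kernel⟩

/-- A permutation of the octad and a linear map of the affine space, combined to a permutation of
the points. -/
noncomputable def linearSplitHom :
    Equiv.Perm (Fin 8) × SL(4, ZMod 2) →* Equiv.Perm (Option (ZMod 23)) :=
  splitHom.comp ((MonoidHom.id _).prodMap
    ((MulAut.toPerm (Multiplicative (Fin 4 → ZMod 2))).comp slAction))

theorem linearSplitHom_apply (π : Equiv.Perm (Fin 8)) (A : SL(4, ZMod 2)) :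
    linearSplitHom (π, A) = splitHom (π, MulAut.toPerm _ (slAction A)) := rfl

theorem sevenCycle_mem : linearSplitHom (sevenCycle, sevenMatrix) ∈ M24 := by
  rw [linearSplitHom_apply]
  apply splitHom_mem
  decide +kernel

theorem threeCycle_mem : linearSplitHom (threeCycle, threeMatrix) ∈ M24 := by
  rw [linearSplitHom_apply]
  apply splitHom_mem
  decide +kernel

/-! ### The isomorphism of `A₈` with `SL(4, 2)` -/

/-- The last four basis words are the coordinate functions of the affine space. -/
theorem basisWord_inl_coord (i : Fin 4) (k : Fin 8) :
    basisWord (Fin.natAdd 8 i) (Sum.inl k) = 0 := by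
  revert i k; decide +kernel

theorem basisWord_inr_coord (i : Fin 4) (v : Multiplicative (Fin 4 → ZMod 2)) :
    basisWord (Fin.natAdd 8 i) (Sum.inr v) = v.toAdd i := by
  revert i v; decide +kernel

theorem basisWord_seven_inr (v : Multiplicative (Fin 4 → ZMod 2)) :
    basisWord 7 (Sum.inr v) = 1 + ∑ m, v.toAdd m := by
  revert v; decide +kernel

theorem linearSplitHom_label_inr (π : Equiv.Perm (Fin 8)) (A : SL(4, ZMod 2))
    (v : Multiplicative (Fin 4 → ZMod 2)) : linearSplitHom (π, A) (label (Sum.inr v)) =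
      label (Sum.inr (Multiplicative.ofAdd (A.1.mulVec v.toAdd))) := by
  rw [linearSplitHom_apply, splitHom_label]
  rfl

theorem linearSplitHom_label_inl (π : Equiv.Perm (Fin 8)) (A : SL(4, ZMod 2)) (k : Fin 8) :
    linearSplitHom (π, A) (label (Sum.inl k)) = label (Sum.inl (π k)) := by
  rw [linearSplitHom_apply, splitHom_label]
  rfl

theorem exists_label_inl {x : Option (ZMod 23)} (hx : x ∈ octad) :
    ∃ k, x = label (Sum.inl k) := by
  obtain ⟨k | v, rfl⟩ := label.surjective x
  · exact ⟨k, rfl⟩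
  · exact absurd hx (label_inr_notMem v)

theorem exists_label_inr {x : Option (ZMod 23)} (hx : x ∉ octad) :
    ∃ v, x = label (Sum.inr v) := by
  obtain ⟨k | v, rfl⟩ := label.surjective x
  · exact absurd (label_inl_mem k) hx
  · exact ⟨v, rfl⟩

/-- An element of `M₂₄` that preserves the octad acts on its complement by an affine map, because it
permutes the codewords that vanish on the octad, which are the affine functions. -/
theorem exists_eq_translation_mul_linear {σ : Equiv.Perm (Option (ZMod 23))} (hσ : σ ∈ M24)
    (h : ∀ x, σ x ∈ octad ↔ x ∈ octad) : ∃ (w : Multiplicative (Fin 4 → ZMod 2))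
      (π : Equiv.Perm (Fin 8)) (A : SL(4, ZMod 2)),
      σ = splitHom (1, MulAction.toPermHom _ _ w) * linearSplitHom (π, A) := by
  have hl : ∀ k, ∃ k', σ (label (Sum.inl k)) = label (Sum.inl k') := fun k =>
    exists_label_inl ((h _).2 (label_inl_mem k))
  have hr : ∀ v, ∃ v', σ (label (Sum.inr v)) = label (Sum.inr v') := fun v =>
    exists_label_inr fun h' => label_inr_notMem v ((h _).1 h')
  choose π hπ using hl
  choose φ hφ using hr
  have hπi : Function.Injective π := fun a b e => by
    have := σ.injective ((hπ a).trans ((congrArg _ (congrArg _ e)).trans (hπ b).symm))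
    exact Sum.inl_injective (label.injective this)
  have hφi : Function.Injective φ := fun a b e => by
    have := σ.injective ((hφ a).trans ((congrArg _ (congrArg _ e)).trans (hφ b).symm))
    exact Sum.inr_injective (label.injective this)
  set e : Fin 4 → Multiplicative (Fin 4 → ZMod 2) := fun m => Multiplicative.ofAdd (Pi.single m 1)
    with he
  set A : Matrix (Fin 4) (Fin 4) (ZMod 2) := Matrix.of fun i m =>
    (φ (e m)).toAdd i + (φ 1).toAdd i with hA
  have haff : ∀ v, (φ v).toAdd = (φ 1).toAdd + A.mulVec v.toAdd := by
    intro v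
    funext i
    have hmem := mem_golayCode_iff.1
      (comp_mem_of_mem_M24 hσ (ofMask_golayMask_mem (Fin.natAdd 8 i))) (label (Sum.inr v))
    have h0 : ∀ k : Fin 7, pivotLabel (Fin.castAdd 4 k.castSucc) = Sum.inl k.castSucc := by
      decide +kernel
    have h1 : pivotLabel (Fin.castAdd 4 (Fin.last 7)) = Sum.inr 1 := by decide +kernel
    have h2 : ∀ m, pivotLabel (Fin.natAdd 8 m) = Sum.inr (e m) := by decide +kernel
    have h7 : Fin.castAdd 4 (Fin.last 7) = 7 := rfl
    rw [Fin.sum_univ_add (a := 8) (b := 4), Fin.sum_univ_castSucc] at hmem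
    simp only [Function.comp_apply, ← label_pivotLabel, h0, h1, h2, hφ, hπ, basisWord_eq,
      basisWord_inr_coord, basisWord_inl_coord, zero_mul, Finset.sum_const_zero, zero_add] at hmem
    rw [h7, basisWord_seven_inr] at hmem
    rw [hmem, Pi.add_apply, Matrix.mulVec, dotProduct, mul_add, mul_one, Finset.mul_sum, add_assoc,
      ← Finset.sum_add_distrib]
    congr 1
    refine Finset.sum_congr rfl fun m _ => ?_
    rw [hA, Matrix.of_apply]
    ring
  have hinj : Function.Injective A.mulVec := fun a b hab => by
    have := hφi (a₁ := Multiplicative.ofAdd a) (a₂ := Multiplicative.ofAdd b)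
      (Multiplicative.toAdd.injective (by
        rw [haff (.ofAdd a), haff (.ofAdd b), toAdd_ofAdd, toAdd_ofAdd, hab]))
    exact Multiplicative.ofAdd.injective this
  have hdet : A.det = 1 := by
    have h1 := (Matrix.isUnit_iff_isUnit_det A).1 (Matrix.mulVec_injective_iff_isUnit.1 hinj)
    have h2 : ∀ x : ZMod 2, x ≠ 0 → x = 1 := by decide
    exact h2 _ h1.ne_zero
  obtain ⟨B, hB⟩ : ∃ B : SL(4, ZMod 2), (B : Matrix (Fin 4) (Fin 4) (ZMod 2)) = A :=
    ⟨⟨A, hdet⟩, rfl⟩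
  refine ⟨φ 1, Equiv.ofBijective π (Finite.injective_iff_bijective.1 hπi), B,
    Equiv.ext fun x => ?_⟩
  obtain ⟨k | v, rfl⟩ := label.surjective x
  · rw [Equiv.Perm.mul_apply, linearSplitHom_label_inl, splitHom_label, hπ]
    rfl
  · rw [Equiv.Perm.mul_apply, linearSplitHom_label_inr, splitHom_label, hφ]
    refine congrArg _ (congrArg _ (Multiplicative.toAdd.injective ?_))
    rw [← hB] at haff
    exact haff v

/-- The pairs of a permutation of the octad and a linear map of its complement that combine to an
element of `M₂₄`. -/
noncomputable def linearGraph : Subgroup (Equiv.Perm (Fin 8) × SL(4, ZMod 2)) :=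
  M24.comap linearSplitHom

/-- An element of `M₂₄` that fixes the complement of the octad pointwise is trivial: a codeword
through two points of the octad differs from its image in at most four points. -/
theorem eq_one_of_mem_linearGraph {π : Equiv.Perm (Fin 8)} (h : (π, 1) ∈ linearGraph) : π = 1 := by
  set σ := linearSplitHom (π, 1) with hσ
  have hσM : σ ∈ M24 := h
  have hr : ∀ v, σ (label (Sum.inr v)) = label (Sum.inr v) := fun v => by
    rw [hσ, linearSplitHom_label_inr]
    simp
  have hpair : ∀ (j : Fin 7) (k : Fin 8), basisWord (Fin.castAdd 5 j) (Sum.inl k) =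
      if k = j.castSucc ∨ k = 7 then 1 else 0 := by
    decide +kernel
  have key : ∀ (j : Fin 7) (k : Fin 8),
      (π k = j.castSucc ∨ π k = 7) ↔ (k = j.castSucc ∨ k = 7) := by
    intro j
    have hw := ofMask_golayMask_mem (Fin.castAdd 5 j)
    set w := ofMask (golayMask (Fin.castAdd 5 j)) with hwdef
    have hdiff := sub_mem (comp_mem_of_mem_M24 hσM hw) hw
    have hval : ∀ k, (w ∘ σ - w) (label (Sum.inl k)) =
        (if π k = j.castSucc ∨ π k = 7 then 1 else 0) -
          if k = j.castSucc ∨ k = 7 then 1 else 0 := by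
      intro k
      rw [Pi.sub_apply, Function.comp_apply, hσ, linearSplitHom_label_inl, hwdef, basisWord_eq,
        basisWord_eq, hpair, hpair]
    have hz : w ∘ σ - w = 0 := by
      by_contra hne
      have h8 := eight_le_card_wordSupport hdiff hne
      have hsub : wordSupport (w ∘ σ - w) ⊆ Finset.image (fun k => label (Sum.inl k))
          {j.castSucc, 7, π.symm j.castSucc, π.symm 7} := by
        intro x hx
        rw [mem_wordSupport] at hx
        obtain ⟨k | v, rfl⟩ := label.surjective x
        · rw [hval] at hx
          refine Finset.mem_image_of_mem _ ?_
          by_contra hk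
          simp only [Finset.mem_insert, Finset.mem_singleton, not_or, Equiv.eq_symm_apply] at hk
          simp [hk] at hx
        · simp [hr] at hx
      have h4 := (Finset.card_le_card hsub).trans (Finset.card_image_le.trans Finset.card_le_four)
      omega
    intro k
    have := hval k
    rw [hz, Pi.zero_apply] at this
    split_ifs at this with h1 h2 h2
    · exact iff_of_true h1 h2
    · exact absurd this (by decide)
    · exact absurd this (by decide)
    · exact iff_of_false h1 h2
  have h7 : π 7 = 7 := by
    have h0 := (key 0 7).2 (Or.inr rfl)
    have h1 := (key 1 7).2 (Or.inr rfl)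
    rcases h0 with h0 | h0
    · rcases h1 with h1 | h1
      · rw [h0] at h1
        exact absurd h1 (by decide)
      · exact h1
    · exact h0
  ext1 k
  rw [Equiv.Perm.one_apply]
  induction k using Fin.lastCases with
  | last => exact h7
  | cast j =>
    rcases (key j j.castSucc).2 (Or.inl rfl) with h' | h'
    · exact h'
    · rw [← h7] at h'
      exact absurd (π.injective h') (Fin.castSucc_lt_last j).ne

/-- The two generating permutations of the octad generate a doubly transitive group, which contains
a three-cycle and therefore all even permutations by Jordan's theorem. -/
theorem alternatingGroup_le_map_linearGraph :
    alternatingGroup (Fin 8) ≤ linearGraph.map (MonoidHom.fst _ _) := by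
  set R := linearGraph.map (MonoidHom.fst _ _) with hR
  have hs : sevenCycle ∈ R := ⟨_, sevenCycle_mem, rfl⟩
  have ht : threeCycle ∈ R := ⟨_, threeCycle_mem, rfl⟩
  have key : ∀ a b : Fin 8, a ≠ b → ∃ (i k : Fin 7) (j : Fin 2),
      (sevenCycle ^ i.val * threeCycle ^ j.val * sevenCycle ^ k.val) 0 = a ∧
        (sevenCycle ^ i.val * threeCycle ^ j.val * sevenCycle ^ k.val) 1 = b := by
    decide +kernel
  have key' : ∀ a b : Fin 8, a ≠ b → ∃ r ∈ R, r 0 = a ∧ r 1 = b := by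
    intro a b hab
    obtain ⟨i, k, j, h⟩ := key a b hab
    exact ⟨_, mul_mem (mul_mem (pow_mem hs _) (pow_mem ht _)) (pow_mem hs _), h⟩
  refine Equiv.Perm.alternatingGroup_le_of_isPreprimitive_of_isThreeCycle_mem
    (MulAction.isPreprimitive_of_is_two_pretransitive
      (MulAction.is_two_pretransitive_iff.2 fun {a b c d} hab hcd => ?_))
    (g := threeCycle) (Equiv.Perm.isThreeCycle_swap_mul_swap_same (by decide) (by decide)
      (by decide)) ht
  obtain ⟨r, hr, rfl, rfl⟩ := key' a b hab
  obtain ⟨s, hs, rfl, rfl⟩ := key' c d hcd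
  refine ⟨⟨s * r⁻¹, mul_mem hs (inv_mem hr)⟩, ?_, ?_⟩
  · change (s * r⁻¹) (r 0) = s 0
    rw [← Equiv.Perm.mul_apply, inv_mul_cancel_right]
  · change (s * r⁻¹) (r 1) = s 1
    rw [← Equiv.Perm.mul_apply, inv_mul_cancel_right]

theorem card_specialLinearGroup_le : Nat.card SL(4, ZMod 2) ≤ 20160 := by
  have h := Nat.card_le_card_of_injective (Matrix.SpecialLinearGroup.toGL (n := Fin 4)
    (R := ZMod 2)) Matrix.SpecialLinearGroup.toGL_injective
  rw [Matrix.card_GL_field] at h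
  refine h.trans (le_of_eq ?_)
  rw [ZMod.card]
  decide

theorem card_alternatingGroup_eight : Nat.card (alternatingGroup (Fin 8)) = 20160 := by
  rw [nat_card_alternatingGroup, Nat.card_eq_fintype_card, Fintype.card_fin]
  decide

/-- The isomorphism `A₈ ≅ SL(4, 2)`: both projections of `linearGraph` are injective, the first one
has image `A₈`, and the orders agree. -/
theorem exists_mulEquiv_alternatingGroup_specialLinearGroup :
    ∃ e : alternatingGroup (Fin 8) ≃* SL(4, ZMod 2), ∀ (π : Equiv.Perm (Fin 8)) (A : SL(4, ZMod 2)),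
      (π, A) ∈ linearGraph ↔ ∃ h : π ∈ alternatingGroup (Fin 8), e ⟨π, h⟩ = A := by
  let p : linearGraph →* Equiv.Perm (Fin 8) := (MonoidHom.fst _ _).comp linearGraph.subtype
  let q : linearGraph →* SL(4, ZMod 2) := (MonoidHom.snd _ _).comp linearGraph.subtype
  have hq : Function.Injective q := by
    rw [injective_iff_map_eq_one]
    rintro ⟨⟨π, A⟩, h⟩ (rfl : A = 1)
    obtain rfl := eq_one_of_mem_linearGraph h
    rfl
  have hrange : alternatingGroup (Fin 8) ≤ p.range := by
    intro π hπ
    obtain ⟨x, hx, rfl⟩ := alternatingGroup_le_map_linearGraph hπ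
    exact ⟨⟨x, hx⟩, rfl⟩
  have h1 : Nat.card linearGraph ≤ Nat.card SL(4, ZMod 2) := Nat.card_le_card_of_injective q hq
  have h2 : Nat.card p.range ≤ Nat.card linearGraph :=
    Nat.card_le_card_of_surjective p.rangeRestrict p.rangeRestrict_surjective
  have h3 := Subgroup.card_le_of_le hrange
  have h4 := card_specialLinearGroup_le
  rw [card_alternatingGroup_eight] at h3
  have hrange' : alternatingGroup (Fin 8) = p.range :=
    Subgroup.eq_of_le_of_card_ge hrange (by rw [card_alternatingGroup_eight]; omega)
  have hp : Function.Bijective p.rangeRestrict :=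
    (Nat.bijective_iff_surjective_and_card _).2 ⟨p.rangeRestrict_surjective, by omega⟩
  have hq' : Function.Bijective q := (Nat.bijective_iff_injective_and_card _).2 ⟨hq, by omega⟩
  let e₁ : linearGraph ≃* p.range := MulEquiv.ofBijective _ hp
  let e₂ : linearGraph ≃* SL(4, ZMod 2) := MulEquiv.ofBijective _ hq'
  let e₀ : alternatingGroup (Fin 8) ≃* p.range := MulEquiv.subgroupCongr hrange'
  refine ⟨(e₀.trans e₁.symm).trans e₂, fun π A => ⟨fun h => ?_, ?_⟩⟩
  · have hπ : π ∈ alternatingGroup (Fin 8) := by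
      rw [hrange']
      exact ⟨⟨_, h⟩, rfl⟩
    refine ⟨hπ, ?_⟩
    have : e₁.symm (e₀ ⟨π, hπ⟩) = ⟨(π, A), h⟩ := by
      rw [MulEquiv.symm_apply_eq]
      rfl
    change e₂ (e₁.symm (e₀ ⟨π, hπ⟩)) = A
    rw [this]
    rfl
  · rintro ⟨hπ, rfl⟩
    have : (π, e₂ (e₁.symm (e₀ ⟨π, hπ⟩))) = (e₁.symm (e₀ ⟨π, hπ⟩) : linearGraph).1 := by
      refine Prod.ext ?_ rfl
      have := congrArg Subtype.val (e₁.apply_symm_apply (e₀ ⟨π, hπ⟩))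
      exact this.symm
    change (π, e₂ (e₁.symm (e₀ ⟨π, hπ⟩))) ∈ linearGraph
    rw [this]
    exact Subtype.property _

/-! ### The flag stabilizer as a semidirect product -/

theorem alternatingInclusion_last (τ : alternatingGroup (Fin 7)) :
    (alternatingInclusion τ : Equiv.Perm (Fin 8)) 7 = 7 :=
  Equiv.Perm.extendDomain_apply_not_subtype _ _ (by simp)

theorem alternatingInclusion_injective : Function.Injective alternatingInclusion := by
  intro a b h
  exact Subtype.ext (Equiv.Perm.extendDomainHom_injective _ (congrArg Subtype.val h))

theorem exists_alternatingInclusion_eq {π : Equiv.Perm (Fin 8)}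
    (hπ : π ∈ alternatingGroup (Fin 8)) (h7 : π 7 = 7) :
    ∃ τ, (alternatingInclusion τ : Equiv.Perm (Fin 8)) = π := by
  have hp : ∀ x : Fin 8, π x ≠ Fin.last 7 ↔ x ≠ Fin.last 7 := fun x => by
    rw [not_iff_not]
    exact ⟨fun h => π.injective (h.trans h7.symm), fun h => by rw [h]; exact h7⟩
  have key : ((finSuccAboveEquiv (Fin.last 7)).symm.permCongr
      (π.subtypePerm (p := fun x => x ≠ Fin.last 7) hp)).extendDomain
        (finSuccAboveEquiv (Fin.last 7)) = π := by
    ext1 x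
    by_cases hx : x = Fin.last 7
    · rw [Equiv.Perm.extendDomain_apply_not_subtype _ _ (by simpa using hx), hx]
      exact h7.symm
    · rw [Equiv.Perm.extendDomain_apply_subtype (p := fun x => x ≠ Fin.last 7) _ _ hx]
      simp
  refine ⟨⟨(finSuccAboveEquiv (Fin.last 7)).symm.permCongr
    (π.subtypePerm (p := fun x => x ≠ Fin.last 7) hp), ?_⟩, key⟩
  rw [Equiv.Perm.mem_alternatingGroup, ← Equiv.Perm.sign_extendDomain _
    (finSuccAboveEquiv (Fin.last 7)), key]
  exact Equiv.Perm.mem_alternatingGroup.1 hπ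

theorem splitHom_injective : Function.Injective splitHom := by
  rw [splitHom, MulEquiv.toMonoidHom_eq_coe]
  exact label.permCongrHom.injective.comp Equiv.Perm.sumCongrHom_injective

section Semidirect

variable {e : alternatingGroup (Fin 8) ≃* SL(4, ZMod 2)}

theorem a7Action_apply (τ : alternatingGroup (Fin 7)) :
    a7Action e τ = slAction (e (alternatingInclusion τ)) := rfl

variable (e) in
/-- The action of `(ℤ/2)⁴ ⋊ A₇` on the octad and on the affine space. -/
def semidirectHom : Multiplicative (Fin 4 → ZMod 2) ⋊[a7Action e] alternatingGroup (Fin 7) →*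
    Equiv.Perm (Fin 8) × Equiv.Perm (Multiplicative (Fin 4 → ZMod 2)) :=
  SemidirectProduct.lift ((1 : _ →* Equiv.Perm (Fin 8)).prod (MulAction.toPermHom _ _))
    (((alternatingGroup (Fin 8)).subtype.comp alternatingInclusion).prod
      ((MulAut.toPerm _).comp (a7Action e))) fun τ => by
      refine MonoidHom.ext fun w => Prod.ext ?_ (Equiv.ext fun v => ?_)
      · simp
      · change a7Action e τ w * v = a7Action e τ (w * (a7Action e τ)⁻¹ v)
        rw [map_mul, MulAut.apply_inv_self]

theorem semidirectHom_apply (w : Multiplicative (Fin 4 → ZMod 2)) (τ : alternatingGroup (Fin 7)) :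
    semidirectHom e ⟨w, τ⟩ = (1, MulAction.toPermHom _ _ w) *
      ((alternatingInclusion τ : Equiv.Perm (Fin 8)), MulAut.toPerm _ (a7Action e τ)) := rfl

theorem splitHom_semidirectHom_inl (w : Multiplicative (Fin 4 → ZMod 2))
    (τ : alternatingGroup (Fin 7)) (k : Fin 8) :
    splitHom (semidirectHom e ⟨w, τ⟩) (label (Sum.inl k)) =
      label (Sum.inl ((alternatingInclusion τ : Equiv.Perm (Fin 8)) k)) := by
  rw [semidirectHom_apply, Prod.mk_mul_mk, splitHom_label]
  rfl

theorem splitHom_semidirectHom_inr (w v : Multiplicative (Fin 4 → ZMod 2))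
    (τ : alternatingGroup (Fin 7)) :
    splitHom (semidirectHom e ⟨w, τ⟩) (label (Sum.inr v)) =
      label (Sum.inr (w * a7Action e τ v)) := by
  rw [semidirectHom_apply, Prod.mk_mul_mk, splitHom_label]
  rfl

theorem semidirectHom_injective : Function.Injective (semidirectHom e) := by
  rw [injective_iff_map_eq_one]
  rintro ⟨w, τ⟩ h
  rw [semidirectHom_apply, Prod.ext_iff] at h
  obtain ⟨h1, h2⟩ := h
  have hτ : τ = 1 := alternatingInclusion_injective (Subtype.ext (by simpa using h1))
  subst hτ
  have hw : w * 1 = 1 := by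
    have := congrArg (fun f : Equiv.Perm _ => f 1) h2
    simpa using this
  rw [mul_one] at hw
  subst hw
  rfl

/-- The defining property of the isomorphism `A₈ ≅ SL(4, 2)` for which the octad and its complement
carry compatible actions. -/
def IsCompatible (e : alternatingGroup (Fin 8) ≃* SL(4, ZMod 2)) : Prop :=
  ∀ (π : Equiv.Perm (Fin 8)) (A : SL(4, ZMod 2)),
    (π, A) ∈ linearGraph ↔ ∃ h : π ∈ alternatingGroup (Fin 8), e ⟨π, h⟩ = A

theorem splitHom_semidirectHom_mem (he : IsCompatible e)
    (x : Multiplicative (Fin 4 → ZMod 2) ⋊[a7Action e] alternatingGroup (Fin 7)) :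
    splitHom (semidirectHom e x) ∈ M24 := by
  obtain ⟨w, τ⟩ := x
  rw [semidirectHom_apply, map_mul]
  exact mul_mem (splitHom_one_mulLeft_mem w)
    ((he (alternatingInclusion τ) (e (alternatingInclusion τ))).2 ⟨Subtype.property _, rfl⟩)

theorem range_semidirectHom (he : IsCompatible e) :
    ((splitHom.comp (semidirectHom e)).codRestrict M24 (splitHom_semidirectHom_mem he)).range =
      flagStabilizer := by
  have h7 : label (Sum.inl 7) = none := rfl
  ext σ
  constructor
  · rintro ⟨⟨w, τ⟩, rfl⟩
    have hl := splitHom_semidirectHom_inl (e := e) w τ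
    refine mem_flagStabilizer_of_forall_mem ?_ fun x hx => ?_
    · have := hl 7
      rwa [alternatingInclusion_last, h7] at this
    · obtain ⟨k, rfl⟩ := exists_label_inl hx
      have := hl k
      change splitHom (semidirectHom e ⟨w, τ⟩) (label (Sum.inl k)) ∈ octad
      rw [this]
      exact label_inl_mem _
  · rintro ⟨h0, h⟩
    obtain ⟨w, π, A, hσ⟩ := exists_eq_translation_mul_linear σ.2 h
    have hπA : (π, A) ∈ linearGraph := by
      have hmem := σ.2
      rw [hσ, Subgroup.mul_mem_cancel_left _ (splitHom_one_mulLeft_mem w)] at hmem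
      exact hmem
    obtain ⟨hπ, hA⟩ := (he π A).1 hπA
    have hπ7 : π 7 = 7 := by
      rw [← h7, hσ, Equiv.Perm.mul_apply, linearSplitHom_label_inl, splitHom_label] at h0
      exact Sum.inl_injective (label.injective h0)
    obtain ⟨τ, hτ⟩ := exists_alternatingInclusion_eq hπ hπ7
    have hτ' : alternatingInclusion τ = ⟨π, hπ⟩ := Subtype.ext hτ
    refine ⟨⟨w, τ⟩, Subtype.ext ?_⟩
    change splitHom (semidirectHom e ⟨w, τ⟩) = σ
    rw [semidirectHom_apply, map_mul, hσ, linearSplitHom_apply, a7Action_apply, hτ', hA]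

/-- The flag stabilizer is `(ℤ/2)⁴ ⋊ A₇`. -/
theorem nonempty_flagStabilizer_mulEquiv (he : IsCompatible e) : Nonempty (flagStabilizer ≃*
    Multiplicative (Fin 4 → ZMod 2) ⋊[a7Action e] alternatingGroup (Fin 7)) := by
  have hinj : Function.Injective ((splitHom.comp (semidirectHom e)).codRestrict M24
      (splitHom_semidirectHom_mem he)) := fun x y h =>
    semidirectHom_injective (splitHom_injective (congrArg Subtype.val h))
  exact ⟨((MonoidHom.ofInjective hinj).trans
    (MulEquiv.subgroupCongr (range_semidirectHom he))).symm⟩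

/-- A three-cycle acts on `(ℤ/2)⁴` without nonzero fixed vectors, so every vector is a commutator
with it; and `A₇` is perfect. -/
theorem isPerfect_semidirect (he : IsCompatible e) :
    Group.IsPerfect (Multiplicative (Fin 4 → ZMod 2) ⋊[a7Action e] alternatingGroup (Fin 7)) := by
  obtain ⟨hπ, hA⟩ := (he threeCycle threeMatrix).1 threeCycle_mem
  obtain ⟨τ, hτ⟩ := exists_alternatingInclusion_eq hπ (by decide +kernel)
  have hτ' : alternatingInclusion τ = ⟨threeCycle, hπ⟩ := Subtype.ext hτ
  have hfix : ∀ w, ∃ u, slAction threeMatrix u * u⁻¹ = w := by decide +kernel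
  refine ⟨eq_top_iff.2 fun x _ => ?_⟩
  rw [← SemidirectProduct.inl_left_mul_inr_right x]
  refine mul_mem ?_ ?_
  · obtain ⟨u, hu⟩ := hfix x.left
    have hmem := Subgroup.commutator_mem_commutator (H₁ := ⊤) (H₂ := ⊤)
      (Subgroup.mem_top (SemidirectProduct.inr τ :
        Multiplicative (Fin 4 → ZMod 2) ⋊[a7Action e] alternatingGroup (Fin 7)))
      (Subgroup.mem_top (SemidirectProduct.inl u))
    rwa [commutatorElement_def, ← map_inv SemidirectProduct.inr, ← SemidirectProduct.inl_aut,
      a7Action_apply, hτ', hA, ← map_inv, ← map_mul, hu] at hmem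
  · have h5 : commutator (alternatingGroup (Fin 7)) = ⊤ :=
      commutator_alternatingGroup_eq_top (by rw [Nat.card_eq_fintype_card, Fintype.card_fin]; omega)
    let ι : alternatingGroup (Fin 7) →*
        Multiplicative (Fin 4 → ZMod 2) ⋊[a7Action e] alternatingGroup (Fin 7) :=
      SemidirectProduct.inr
    have hmem : ι x.right ∈ (commutator (alternatingGroup (Fin 7))).map ι := by
      rw [h5]
      exact ⟨_, Subgroup.mem_top _, rfl⟩
    rw [commutator_def, Subgroup.map_commutator] at hmem
    exact Subgroup.commutator_mono le_top le_top hmem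

theorem isPerfect_flagStabilizer (he : IsCompatible e) : Group.IsPerfect flagStabilizer := by
  obtain ⟨f⟩ := nonempty_flagStabilizer_mulEquiv he
  have := isPerfect_semidirect he
  exact Group.IsPerfect.ofSurjective (f := f.symm.toMonoidHom) f.symm.surjective

/-- The orbits of the flag stabilizer are `{∞}`, the rest of the octad, and the complement of the
octad. Its normalizer permutes them, and the sizes force it to preserve each of them. -/
theorem normalizer_flagStabilizer (he : IsCompatible e) :
    Subgroup.normalizer (flagStabilizer : Set M24) = flagStabilizer := by
  have hmem : ∀ x, (⟨_, splitHom_semidirectHom_mem he x⟩ : M24) ∈ flagStabilizer := fun x => by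
    rw [← range_semidirectHom he]
    exact ⟨x, rfl⟩
  have htrans : ∀ v w : Multiplicative (Fin 4 → ZMod 2), ∃ g ∈ flagStabilizer,
      (g : Equiv.Perm (Option (ZMod 23))) (label (Sum.inr v)) = label (Sum.inr w) := by
    intro v w
    refine ⟨_, hmem ⟨w * v⁻¹, 1⟩, ?_⟩
    exact (splitHom_semidirectHom_inr _ _ _).trans (by simp)
  have hfix : ∀ x, (∀ g ∈ flagStabilizer, (g : Equiv.Perm (Option (ZMod 23))) x = x) →
      x = none := by
    intro x hx
    obtain ⟨k | v, rfl⟩ := label.surjective x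
    · by_contra hk
      have hk7 : k ≠ 7 := by
        rintro rfl
        exact hk rfl
      have key : ∀ k : Fin 8, k ≠ 7 → ∃ a b : Fin 8, k ≠ a ∧ k ≠ b ∧ a ≠ b ∧
          (Equiv.swap k a * Equiv.swap k b) 7 = 7 ∧ (Equiv.swap k a * Equiv.swap k b) k ≠ k := by
        decide +kernel
      obtain ⟨a, b, ha, hb, hab, h7, hne⟩ := key k hk7
      obtain ⟨τ, hτ⟩ := exists_alternatingInclusion_eq
        (Equiv.Perm.isThreeCycle_swap_mul_swap_same ha hb hab).mem_alternatingGroup h7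
      have := (splitHom_semidirectHom_inl (e := e) 1 τ k).symm.trans (hx _ (hmem ⟨1, τ⟩))
      rw [hτ] at this
      exact hne (Sum.inl_injective (label.injective this))
    · have key : ∀ v : Multiplicative (Fin 4 → ZMod 2), ∃ w, w ≠ v := exists_ne
      obtain ⟨w, hw⟩ := key v
      obtain ⟨g, hg, e⟩ := htrans v w
      rw [hx g hg] at e
      exact absurd (Sum.inr_injective (label.injective e)).symm hw
  refine le_antisymm (fun n hn => ?_) Subgroup.le_normalizer
  have hconj : ∀ g ∈ flagStabilizer, ∃ h ∈ flagStabilizer, g * n = n * h := fun g hg =>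
    ⟨n⁻¹ * g * n, (Subgroup.mem_normalizer_iff''.1 hn g).1 hg, by group⟩
  have happ : ∀ g h : M24, g * n = n * h → ∀ x, (g : Equiv.Perm (Option (ZMod 23)))
      ((n : Equiv.Perm (Option (ZMod 23))) x) = (n : Equiv.Perm (Option (ZMod 23)))
        ((h : Equiv.Perm (Option (ZMod 23))) x) := fun g h e x =>
    congrArg (fun f : M24 => (f : Equiv.Perm (Option (ZMod 23))) x) e
  refine mem_flagStabilizer_of_forall_mem (hfix _ fun g hg => ?_) fun x hx => ?_
  · obtain ⟨h, hh, e⟩ := hconj g hg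
    rw [happ g h e, hh.1]
  · by_contra hnx
    obtain ⟨v, hv⟩ := exists_label_inr hnx
    have hsub : (Finset.univ : Finset (Multiplicative (Fin 4 → ZMod 2))).image
        (fun w => label (Sum.inr w)) ⊆
          octad.image (n : Equiv.Perm (Option (ZMod 23))) := by
      intro y hy
      obtain ⟨w, -, rfl⟩ := Finset.mem_image.1 hy
      obtain ⟨g, hg, e⟩ := htrans v w
      obtain ⟨h, hh, e'⟩ := hconj g hg
      rw [← e, ← hv, happ g h e']
      exact Finset.mem_image_of_mem _ ((hh.2 x).2 hx)
    have hcard := Finset.card_le_card hsub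
    rw [Finset.card_image_of_injective (f := fun w => label (Sum.inr w)) _
      (label.injective.comp Sum.inr_injective)] at hcard
    have h16 : (Finset.univ : Finset (Multiplicative (Fin 4 → ZMod 2))).card = 16 := by
      decide +kernel
    have h8 : octad.card = 8 := by decide +kernel
    have := Finset.card_image_le (s := octad) (f := (n : Equiv.Perm (Option (ZMod 23))))
    omega

end Semidirect

/-! ### Algebras with a basis of arrows of an action groupoid -/

section ActionGroupoid

/-- `e` is a basis of `A` by the arrows of the action groupoid of a group `Γ` on a set `X`, where
`(x, a)` stands for the arrow `a` with target `x` and source `ρ a⁻¹ x`, and composable arrows are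
multiplied by composition. -/
structure IsActionBasis {X Γ A : Type*} [Fintype X] [Group Γ] [Ring A] [Algebra ℂ A]
    (ρ : Γ → X → X) (e : Module.Basis (X × Γ) ℂ A) : Prop where
  one_act : ∀ x, ρ 1 x = x
  mul_act : ∀ a b x, ρ (a * b) x = ρ a (ρ b x)
  mul_of_eq : ∀ x a b, e (ρ a x, a) * e (x, b) = e (ρ a x, a * b)
  mul_of_ne : ∀ x a y b, x ≠ ρ a y → e (x, a) * e (y, b) = 0
  one_eq : 1 = ∑ x, e (x, 1)

variable {X Γ A : Type*} [Fintype X] [Group Γ] [Ring A] [Algebra ℂ A] {ρ : Γ → X → X}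
  {e : Module.Basis (X × Γ) ℂ A}

/-- An algebra with a separability idempotent `∑ xᵢ ⊗ yᵢ` is semisimple: averaging over it turns a
linear projection onto a left ideal into a linear projection over the algebra. -/
theorem isSemisimpleRing_of_separable {ι : Type*} [Fintype ι] (x y : ι → A)
    (hone : ∑ i, x i * y i = 1)
    (hcomm : ∀ a, ∑ i, (a * x i) ⊗ₜ[ℂ] y i = ∑ i, x i ⊗ₜ[ℂ] (y i * a)) : IsSemisimpleRing A := by
  refine (isSemisimpleModule_iff A A).2 ⟨fun N => ?_⟩
  obtain ⟨f, hf⟩ := (N.restrictScalars ℂ).subtype.exists_leftInverse_of_injective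
    (LinearMap.ker_eq_bot.2 Subtype.val_injective)
  let B : A → A ⊗[ℂ] A →ₗ[ℂ] A := fun m => TensorProduct.lift
    ((LinearMap.mul ℂ A).compl₂ ((N.restrictScalars ℂ).subtype ∘ₗ f ∘ₗ LinearMap.mulRight ℂ m))
  have hB : ∀ m a b, B m (a ⊗ₜ b) = a * (f (b * m) : A) := fun m a b => rfl
  let π : A →ₗ[A] N :=
    { toFun := fun m => ∑ i, x i • (⟨(f (y i * m) : A), (f (y i * m)).2⟩ : N)
      map_add' := fun m n => by
        rw [← Finset.sum_add_distrib]
        refine Finset.sum_congr rfl fun i _ => ?_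
        rw [← smul_add]
        congr 1
        apply Subtype.ext
        simp [mul_add]
      map_smul' := fun a m => by
        apply Subtype.ext
        have h := congrArg (B m) (hcomm a)
        simp only [map_sum, hB] at h
        simp only [RingHom.id_apply, AddSubmonoidClass.coe_finsetSum, SetLike.val_smul,
          smul_eq_mul, Finset.mul_sum, ← mul_assoc]
        exact h.symm }
  refine ⟨LinearMap.ker π, LinearMap.isCompl_of_proj (f := π) fun n => ?_⟩
  apply Subtype.ext
  have hn : ∀ i, (f (y i * n) : A) = y i * n := fun i => by
    have := LinearMap.congr_fun hf ⟨y i * n, N.smul_mem (y i) n.2⟩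
    exact congrArg Subtype.val this
  change ((∑ i, x i • (⟨(f (y i * n) : A), (f (y i * n)).2⟩ : N) : N) : A) = n
  simp only [AddSubmonoidClass.coe_finsetSum, SetLike.val_smul, smul_eq_mul, hn, ← mul_assoc]
  rw [← Finset.sum_mul, hone, one_mul]

namespace IsActionBasis

theorem act_inv_act (he : IsActionBasis ρ e) (a : Γ) (x : X) : ρ a⁻¹ (ρ a x) = x := by
  rw [← he.mul_act, inv_mul_cancel, he.one_act]

theorem act_act_inv (he : IsActionBasis ρ e) (a : Γ) (x : X) : ρ a (ρ a⁻¹ x) = x := by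
  rw [← he.mul_act, mul_inv_cancel, he.one_act]

open Classical in
theorem mul_eq (he : IsActionBasis ρ e) (x : X) (a : Γ) (y : X) (b : Γ) :
    e (x, a) * e (y, b) = if x = ρ a y then e (x, a * b) else 0 := by
  split_ifs with h
  · rw [h, he.mul_of_eq]
  · exact he.mul_of_ne x a y b h

/-- The separability idempotent is the normalized sum of the tensors `g ⊗ g⁻¹` over all arrows. -/
theorem isSemisimpleRing [Fintype Γ] (he : IsActionBasis ρ e) : IsSemisimpleRing A := by
  classical
  refine isSemisimpleRing_of_separable (fun i : X × Γ => e i)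
    (fun i => (Fintype.card Γ : ℂ)⁻¹ • e (ρ i.2⁻¹ i.1, i.2⁻¹)) ?_ fun u => ?_
  · have hΓ : (Fintype.card Γ : ℂ) ≠ 0 := Nat.cast_ne_zero.2 Fintype.card_ne_zero
    have : ∀ (x : X) (a : Γ), e (x, a) * ((Fintype.card Γ : ℂ)⁻¹ • e (ρ a⁻¹ x, a⁻¹)) =
        (Fintype.card Γ : ℂ)⁻¹ • e (x, 1) := fun x a => by
      rw [mul_smul_comm, he.mul_eq, if_pos (he.act_act_inv a x).symm, mul_inv_cancel]
    rw [Fintype.sum_prod_type]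
    simp only [this, Finset.sum_const, Finset.card_univ, he.one_eq]
    refine Finset.sum_congr rfl fun x _ => ?_
    rw [← Nat.cast_smul_eq_nsmul ℂ, smul_smul, mul_inv_cancel₀ hΓ, one_smul]
  · simp only [TensorProduct.tmul_smul, smul_mul_assoc, ← Finset.smul_sum]
    congr 1
    refine LinearMap.congr_fun (f := ∑ i : X × Γ, (TensorProduct.mk ℂ A A).flip
      (e (ρ i.2⁻¹ i.1, i.2⁻¹)) ∘ₗ LinearMap.mulRight ℂ (e i)) (g := ∑ i : X × Γ,
        TensorProduct.mk ℂ A A (e i) ∘ₗ LinearMap.mulLeft ℂ (e (ρ i.2⁻¹ i.1, i.2⁻¹)))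
        (e.ext ?_) u |> fun h => by simpa using h
    rintro ⟨m, s⟩
    simp only [LinearMap.sum_apply, LinearMap.comp_apply, LinearMap.mulRight_apply,
      LinearMap.mulLeft_apply, LinearMap.flip_apply, TensorProduct.mk_apply, he.mul_eq]
    rw [Fintype.sum_prod_type, Fintype.sum_prod_type, Fintype.sum_eq_single (ρ s⁻¹ m),
      Fintype.sum_eq_single m]
    · simp only [he.act_act_inv, if_true]
      refine Fintype.sum_equiv (Equiv.mulLeft s) _ _ fun a => ?_
      rw [Equiv.coe_mulLeft, mul_inv_rev, inv_mul_cancel_right, he.mul_act a⁻¹ s⁻¹ m]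
    · intro x hx
      refine Finset.sum_eq_zero fun a _ => ?_
      rw [if_neg, TensorProduct.tmul_zero]
      intro h
      apply hx
      rw [← he.act_act_inv a x, h, he.act_act_inv]
    · intro x hx
      refine Finset.sum_eq_zero fun a _ => ?_
      rw [if_neg, TensorProduct.zero_tmul]
      rintro rfl
      exact hx (he.act_inv_act s x).symm

open Classical in
/-- A character of the algebra of an action groupoid is concentrated at a fixed point of the action
and restricts to a character of the group there. So it is unique if the fixed point is unique and
the group is perfect. -/
theorem algHom_apply [Group.IsPerfect Γ] (he : IsActionBasis ρ e) {x₀ : X}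
    (h₀ : ∀ x, (∀ a, ρ a x = x) ↔ x = x₀) (χ : A →ₐ[ℂ] ℂ) (x : X) (a : Γ) :
    χ (e (x, a)) = if x = x₀ then 1 else 0 := by
  have hidem : ∀ x a, e (x, 1) * e (x, a) = e (x, a) := fun x a => by
    have := he.mul_of_eq x 1 a
    rwa [he.one_act, one_mul] at this
  have hfix : ∀ x, χ (e (x, 1)) ≠ 0 → x = x₀ := by
    intro x hx
    rw [← h₀]
    intro a
    by_contra hne
    -- `e (ρ a x, a)` factors through the orthogonal idempotents at `ρ a x` and `x`
    have h1 : e (ρ a⁻¹ (ρ a x), a⁻¹) * e (ρ a x, a) = e (x, 1) := by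
      rw [he.mul_of_eq, he.act_inv_act, inv_mul_cancel]
    have h2 : e (x, 1) * e (ρ a x, 1) = 0 := he.mul_of_ne _ _ _ _ (by
      rw [he.one_act]
      exact fun h => hne h.symm)
    have h3 : χ (e (ρ a x, 1)) = 0 := by
      have := congrArg χ h2
      rw [map_mul, map_zero, mul_eq_zero] at this
      exact this.resolve_left hx
    rw [← h1, map_mul, ← hidem (ρ a x) a, map_mul, h3, zero_mul, mul_zero] at hx
    exact hx rfl
  have hx₀ : ∀ a, ρ a x₀ = x₀ := (h₀ x₀).2 rfl
  have hone : χ (e (x₀, 1)) = 1 := by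
    have := congrArg χ he.one_eq
    rw [map_one, map_sum, Fintype.sum_eq_single x₀ fun x hx => by
      by_contra h
      exact hx (hfix x h)] at this
    exact this.symm
  by_cases hx : x = x₀
  · rw [if_pos hx, hx]
    let f : Γ →* ℂ :=
      { toFun := fun a => χ (e (x₀, a))
        map_one' := hone
        map_mul' := fun a b => by
          have := he.mul_of_eq x₀ a b
          rw [hx₀] at this
          rw [← map_mul, this] }
    have hker : commutator Γ ≤ f.toHomUnits.ker := Abelianization.commutator_subset_ker _
    have hmem : a ∈ f.toHomUnits.ker := hker Group.IsPerfect.mem_commutator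
    exact congrArg Units.val hmem
  · have h0 : χ (e (x, 1)) = 0 := by
      by_contra h
      exact hx (hfix x h)
    rw [if_neg hx, ← hidem, map_mul, h0, zero_mul]

end IsActionBasis
end ActionGroupoid

section Characters

open Coalgebra

/-- A Hopf algebra is perfect if the counit is its only character. -/
theorem isPerfectHopf_of_algHom {A : Type*} [Ring A] [HopfAlgebra ℂ A]
    (h : ∀ (χ : A →ₐ[ℂ] ℂ) (a : A), χ a = counit (R := ℂ) a) : IsPerfectHopf A := by
  intro V _ _ _ _ hV a v
  have hex : ∀ a : A, ∃ c : ℂ, ∀ w : V, a • w = c • w := by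
    intro a
    obtain ⟨v₀, hv₀, hspan⟩ := finrank_eq_one_iff'.1 hV
    obtain ⟨c, hc⟩ := hspan (a • v₀)
    refine ⟨c, fun w => ?_⟩
    obtain ⟨d, rfl⟩ := hspan w
    rw [smul_comm, ← hc, smul_comm]
  choose χ hχ using hex
  have : Nontrivial V := Module.nontrivial_of_finrank_pos (R := ℂ) (by omega)
  obtain ⟨v₀, hv₀⟩ := exists_ne (0 : V)
  have hinj : ∀ c d : ℂ, c • v₀ = d • v₀ → c = d := fun c d e => smul_left_injective ℂ hv₀ e
  let f : A →ₐ[ℂ] ℂ := AlgHom.ofLinearMap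
    { toFun := χ
      map_add' := fun a b => hinj _ _ (by rw [← hχ, add_smul, add_smul, hχ, hχ])
      map_smul' := fun c a => hinj _ _ (by
        rw [← hχ, smul_assoc, hχ, RingHom.id_apply, smul_assoc]) }
    (hinj _ _ (by rw [LinearMap.coe_mk, AddHom.coe_mk, ← hχ, one_smul, one_smul]))
    (fun a b => hinj _ _ (by
      simp only [LinearMap.coe_mk, AddHom.coe_mk]
      rw [← hχ, mul_smul, hχ, hχ, smul_smul, mul_comm]))
  rw [hχ, ← h f a]
  rfl

theorem IsPerfectHopf.algHom_apply {A : Type*} [Ring A] [HopfAlgebra ℂ A] (h : IsPerfectHopf A)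
    (χ : A →ₐ[ℂ] ℂ) (a : A) : χ a = counit (R := ℂ) a := by
  let _ : Module A ℂ := Module.compHom ℂ (χ : A →+* ℂ)
  have hsmul : ∀ (a : A) (z : ℂ), a • z = χ a * z := fun a z => rfl
  have : IsScalarTower ℂ A ℂ := ⟨fun c a z => by
    rw [hsmul, hsmul, map_smul, smul_eq_mul, smul_eq_mul, mul_assoc]⟩
  have := h ℂ (Module.finrank_self ℂ) a 1
  rwa [hsmul, mul_one, smul_eq_mul, mul_one] at this

end Characters

/-! ### The bicrossproduct is semisimple and biperfect -/

section Parts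

variable {G : Type*} [Group G] {G₁ G₂ : Subgroup G}

namespace IsExactFactorization

variable (h : IsExactFactorization G₁ G₂)

/-- The factor in `G₁` of an element of `G = G₁ G₂`. -/
noncomputable def left (g : G) : G₁ := ⟨_, (h.exists_mul_eq g).choose_spec.1⟩

/-- The factor in `G₂` of an element of `G = G₁ G₂`. -/
noncomputable def right (g : G) : G₂ := ⟨_, (h.exists_mul_eq g).choose_spec.2.choose_spec.1⟩

theorem left_mul_right (g : G) : (h.left g * h.right g : G) = g :=
  (h.exists_mul_eq g).choose_spec.2.choose_spec.2

theorem mul_inj (h : IsExactFactorization G₁ G₂) {a b : G₁} {x y : G₂}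
    (e : (a * x : G) = b * y) : a = b ∧ x = y := by
  have h₁ : ((b⁻¹ * a : G₁) : G) = ((y * x⁻¹ : G₂) : G) := by
    push_cast
    rw [inv_mul_eq_iff_eq_mul, ← mul_assoc, ← e, mul_inv_cancel_right]
  have h₂ : ((b⁻¹ * a : G₁) : G) ∈ G₁ ⊓ G₂ :=
    ⟨Subtype.property _, by rw [h₁]; exact Subtype.property _⟩
  rw [h.inf_eq_bot, Subgroup.mem_bot] at h₂
  constructor
  · exact (inv_mul_eq_one.1 (Subtype.ext h₂)).symm
  · exact (mul_inv_eq_one.1 (Subtype.ext (h₁.symm.trans h₂))).symm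

theorem left_eq {a : G₁} {x : G₂} {g : G} (e : (a * x : G) = g) : h.left g = a :=
  (h.mul_inj ((h.left_mul_right g).trans e.symm)).1

theorem right_eq {a : G₁} {x : G₂} {g : G} (e : (a * x : G) = g) : h.right g = x :=
  (h.mul_inj ((h.left_mul_right g).trans e.symm)).2

theorem left_coe_mul (a : G₁) (g : G) : h.left (a * g) = a * h.left g :=
  h.left_eq (x := h.right g) (by rw [Subgroup.coe_mul, mul_assoc, h.left_mul_right])

theorem left_inv_coe_mul (a : G₁) (g : G) : h.left ((a : G)⁻¹ * g) = a⁻¹ * h.left g :=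
  h.left_coe_mul a⁻¹ g

theorem right_coe_mul (a : G₁) (g : G) : h.right (a * g) = h.right g :=
  h.right_eq (a := a * h.left g) (by rw [Subgroup.coe_mul, mul_assoc, h.left_mul_right])

theorem right_inv_coe_mul (a : G₁) (g : G) : h.right ((a : G)⁻¹ * g) = h.right g :=
  h.right_coe_mul a⁻¹ g

theorem left_mul_coe (g : G) (x : G₂) : h.left (g * x) = h.left g :=
  h.left_eq (x := h.right g * x) (by rw [Subgroup.coe_mul, ← mul_assoc, h.left_mul_right])

theorem left_mul_inv_coe (g : G) (x : G₂) : h.left (g * (x : G)⁻¹) = h.left g :=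
  h.left_mul_coe g x⁻¹

theorem right_mul_coe (g : G) (x : G₂) : h.right (g * x) = h.right g * x :=
  h.right_eq (a := h.left g) (by rw [Subgroup.coe_mul, ← mul_assoc, h.left_mul_right])

theorem right_mul_inv_coe (g : G) (x : G₂) : h.right (g * (x : G)⁻¹) = h.right g * x⁻¹ :=
  h.right_mul_coe g x⁻¹

theorem left_coe (a : G₁) : h.left a = a := h.left_eq (x := 1) (by simp)

theorem left_coe' (x : G₂) : h.left x = 1 := h.left_eq (x := x) (by simp)

theorem right_coe (x : G₂) : h.right x = x := h.right_eq (a := 1) (by simp)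

theorem left_one : h.left 1 = 1 := h.left_coe 1

theorem right_one : h.right 1 = 1 := h.right_coe 1

theorem symm_act_eq (x : G₂) (a : G₁) : h.symm.act x a = h.left (x * a) :=
  h.symm.act_eq (h.left_mul_right _).symm

theorem coe_act (a : G₁) (x : G₂) : (h.act a x : G) = a * x * h.left ((x : G)⁻¹ * (a : G)⁻¹) := by
  obtain ⟨r, e, -, -, -, -, e₅⟩ := h.act_spec a x
  rw [h.symm_act_eq] at e₅
  push_cast at e₅
  rw [e₅, e, Subgroup.coe_inv, mul_inv_cancel_right]

/-- The factorization as a bijection. -/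
noncomputable def prodEquiv : G₁ × G₂ ≃ G where
  toFun := fun (a, x) => a * x
  invFun g := (h.left g, h.right g)
  left_inv _ := Prod.ext (h.left_eq rfl) (h.right_eq rfl)
  right_inv g := h.left_mul_right g

/-- Nontrivial elements of the two factors are never conjugate. -/
theorem eq_one_of_conj (h : IsExactFactorization G₁ G₂) {a : G₁} {x : G₂} {w : G}
    (e : w * x * w⁻¹ = a) : a = 1 ∧ x = 1 := by
  have h₁ : h.right (a * w) = h.right (w * x) := by rw [← e, inv_mul_cancel_right]
  rw [h.right_coe_mul, h.right_mul_coe, eq_comm, mul_eq_left] at h₁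
  refine ⟨?_, h₁⟩
  rw [h₁] at e
  exact Subtype.ext (by rw [← e]; simp)

/-- If `G₁` is self-normalizing then `1` is its only fixed point on `G₂ = G / G₁`. -/
theorem act_eq_self_iff [Finite G] (hN : Subgroup.normalizer (G₁ : Set G) = G₁) (x : G₂) :
    (∀ a, h.act a x = x) ↔ x = 1 := by
  refine ⟨fun hx => ?_, fun hx a => by rw [hx, h.act_one]⟩
  have hmem : (x : G)⁻¹ ∈ Subgroup.normalizer (G₁ : Set G) := by
    refine Subgroup.mem_normalizer_fintype fun a ha => ?_
    obtain ⟨r, e, -⟩ := h.act_spec ⟨a, ha⟩ x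
    rw [hx] at e
    have : (x : G)⁻¹ * a * ((x : G)⁻¹)⁻¹ = r := by
      rw [inv_inv, mul_assoc, inv_mul_eq_iff_eq_mul]
      exact e
    rw [this]
    exact r.2
  rw [hN, inv_mem_iff] at hmem
  have : (x : G) ∈ G₁ ⊓ G₂ := ⟨hmem, x.2⟩
  rw [h.inf_eq_bot, Subgroup.mem_bot] at this
  exact Subtype.ext this

end IsExactFactorization
end Parts

namespace Bicrossproduct

open Coalgebra HopfAlgebra

attribute [local instance 2000] Fintype.ofFinite

variable {G : Type*} [Group G] [Finite G] {G₁ G₂ : Subgroup G} (h : IsExactFactorization G₁ G₂)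

theorem comul_basis (x : G₂) (a : G₁) : comul (R := ℂ) (basis h (x, a)) =
    ∑ b : G₂, basis h (b, a) ⊗ₜ[ℂ] basis h (b⁻¹ * x, h.symm.act b⁻¹ a) := comulMap_basis h x a

theorem antipode_basis (x : G₂) (a : G₁) : antipode ℂ (basis h (x, a)) =
    basis h ((h.act a⁻¹ x)⁻¹, (h.symm.act x⁻¹ a)⁻¹) := antipodeMap_basis h x a

theorem antipode_antipode (u : Bicrossproduct h) : antipode ℂ (antipode ℂ u) = u := by
  have : antipode ℂ ∘ₗ antipode ℂ = (LinearMap.id : Bicrossproduct h →ₗ[ℂ] _) := by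
    refine (basis h).ext ?_
    rintro ⟨x, a⟩
    rw [LinearMap.comp_apply, antipode_basis, antipode_basis, LinearMap.id_apply]
    obtain ⟨r, -, e₁, -, e₃, -⟩ := h.act_spec a (h.act a⁻¹ x)
    rw [h.act_act_inv] at e₁ e₃
    rw [inv_inv, inv_inv, e₁, e₃, inv_inv]
    have : h.symm.act (h.act a⁻¹ x) r⁻¹ = a⁻¹ := by
      obtain ⟨t, f, -⟩ := h.act_spec a (h.act a⁻¹ x)
      rw [h.act_act_inv] at f
      have ht : t = r := by
        rw [← e₁]
        refine (h.symm.act_eq (a' := (h.act a⁻¹ x)⁻¹) ?_).symm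
        push_cast
        rw [inv_mul_eq_iff_eq_mul, ← mul_assoc, ← f, mul_inv_cancel_right]
      rw [ht] at f
      refine h.symm.act_eq (a' := x) ?_
      push_cast
      rw [eq_inv_mul_iff_mul_eq, ← mul_assoc, f, mul_inv_cancel_right]
    rw [this, inv_inv]
  exact LinearMap.congr_fun this u

theorem isActionBasis : IsActionBasis h.act (basis h) where
  one_act := h.one_act
  mul_act := h.mul_act
  mul_of_eq x a b := by rw [basis_mul, if_pos rfl]
  mul_of_ne x a y b hne := by rw [basis_mul, if_neg hne]
  one_eq := one_def h

open Classical in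
/-- The basis of the dual of the bicrossproduct that is dual to the `δ_x ⊗ a`, written with the
index in `G₁` first: with this order it is an action basis for the action of `G₂` on `G₁`. -/
noncomputable def dualBasis : Module.Basis (G₁ × G₂) ℂ (HopfDual ℂ (Bicrossproduct h)) :=
  ((basis h).dualBasis.map (HopfDual.equiv ℂ (Bicrossproduct h)).symm).reindex
    (Equiv.prodComm G₂ G₁)

open Classical in
theorem dualBasis_apply (a : G₁) (x : G₂) (y : G₂) (b : G₁) :
    dualBasis h (a, x) (basis h (y, b)) = if y = x ∧ b = a then 1 else 0 := by
  rw [dualBasis, Module.Basis.reindex_apply, Module.Basis.map_apply, HopfDual.symm_apply]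
  simp [Finsupp.single_apply, Prod.ext_iff]

theorem dual_ext {f g : HopfDual ℂ (Bicrossproduct h)}
    (e : ∀ x a, f (basis h (x, a)) = g (basis h (x, a))) : f = g :=
  (HopfDual.equiv ℂ _).injective ((basis h).ext fun i => e i.1 i.2)

theorem mul_apply_basis (f g : HopfDual ℂ (Bicrossproduct h)) (x : G₂) (a : G₁) :
    (f * g) (basis h (x, a)) =
      ∑ b : G₂, f (basis h (b, a)) * g (basis h (b⁻¹ * x, h.symm.act b⁻¹ a)) := by
  change LinearMap.mul' ℂ ℂ (TensorProduct.map (HopfDual.equiv ℂ _ f) (HopfDual.equiv ℂ _ g)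
    (comul (basis h (x, a)))) = _
  simp only [comul_basis, map_sum, TensorProduct.map_tmul, LinearMap.mul'_apply,
    HopfDual.equiv_apply]

open Classical in
theorem dualBasis_mul (a b : G₁) (x y : G₂) : dualBasis h (a, x) * dualBasis h (b, y) =
    if a = h.symm.act x b then dualBasis h (a, x * y) else 0 := by
  apply dual_ext
  intro z c
  rw [mul_apply_basis, Fintype.sum_eq_single x fun w hw => by
    rw [dualBasis_apply, if_neg fun e => hw e.1, zero_mul]]
  have h₁ : a = h.symm.act x b ↔ h.symm.act x⁻¹ a = b :=
    ⟨fun e => by rw [e, h.symm.act_inv_act], fun e => by rw [← e, h.symm.act_act_inv]⟩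
  rw [dualBasis_apply, dualBasis_apply]
  by_cases hc : c = a
  · subst hc
    by_cases hb : c = h.symm.act x b
    · rw [if_pos hb, dualBasis_apply]
      simp [h₁.1 hb, inv_mul_eq_iff_eq_mul]
    · rw [if_neg hb, if_pos ⟨rfl, rfl⟩, if_neg fun e => hb (h₁.2 e.2), mul_zero]
      rfl
  · rw [if_neg fun e => hc e.2, zero_mul]
    split_ifs
    · rw [dualBasis_apply, if_neg fun e => hc e.2]
    · rfl

theorem dual_one_def : (1 : HopfDual ℂ (Bicrossproduct h)) = ∑ a : G₁, dualBasis h (a, 1) := by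
  classical
  apply dual_ext
  intro x b
  rw [HopfDual.one_apply, HopfDual.sum_apply]
  simp only [dualBasis_apply]
  refine (counitMap_basis h x b).trans ?_
  by_cases hx : x = 1 <;> simp [hx]

theorem isActionBasis_dual : IsActionBasis h.symm.act (dualBasis h) where
  one_act := h.symm.one_act
  mul_act := h.symm.mul_act
  mul_of_eq x a b := by rw [dualBasis_mul, if_pos rfl]
  mul_of_ne x a y b hne := by rw [dualBasis_mul, if_neg hne]
  one_eq := dual_one_def h

theorem isSemisimpleRing : IsSemisimpleRing (Bicrossproduct h) :=
  (isActionBasis h).isSemisimpleRing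

theorem isPerfectHopf [Group.IsPerfect G₁] (h₁ : Subgroup.normalizer (G₁ : Set G) = G₁) :
    IsPerfectHopf (Bicrossproduct h) := by
  classical
  refine isPerfectHopf_of_algHom fun χ u => ?_
  refine LinearMap.congr_fun (f := χ.toLinearMap) ((basis h).ext ?_) u
  rintro ⟨x, a⟩
  rw [AlgHom.toLinearMap_apply, (isActionBasis h).algHom_apply (h.act_eq_self_iff h₁)]
  convert (counitMap_basis h x a).symm
  rfl

theorem isPerfectHopf_dual [Group.IsPerfect G₂] (h₂ : Subgroup.normalizer (G₂ : Set G) = G₂) :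
    IsPerfectHopf (HopfDual ℂ (Bicrossproduct h)) := by
  classical
  refine isPerfectHopf_of_algHom fun χ u => ?_
  refine LinearMap.congr_fun (f := χ.toLinearMap) ((dualBasis h).ext ?_) u
  rintro ⟨a, x⟩
  rw [AlgHom.toLinearMap_apply, (isActionBasis_dual h).algHom_apply (h.symm.act_eq_self_iff h₂)]
  change _ = (dualBasis h (a, x)) 1
  rw [one_def, ← HopfDual.equiv_apply, map_sum]
  simp only [HopfDual.equiv_apply, dualBasis_apply]
  by_cases ha : a = 1
  · simp [ha]
  · simp [ha, eq_comm]

end Bicrossproduct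

/-! ### The bialgebra of conjugation arrows -/

namespace IsExactFactorization

variable {G : Type*} [Group G] {G₁ G₂ : Subgroup G} (h : IsExactFactorization G₁ G₂)

/-- In the coproduct of the double of a bicrossproduct, the arrows `(g, k)` of the groupoid of `G`
acting on itself by conjugation are split into pairs of arrows, and `(w, k)` is paired with an
arrow whose target is `cofactor w g = a⁻¹ g x⁻¹`, where `w = a x`. -/
noncomputable def cofactor (w g : G) : G := (h.left w : G)⁻¹ * g * (h.right w : G)⁻¹

/-- The arrow with target `cofactor w g` that is paired with `(w, k)`. -/
noncomputable def coarrow (w k : G) : G := (h.left w : G)⁻¹ * k * h.left (k⁻¹ * w * k)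

theorem inv_right (g : G) : (h.right g : G)⁻¹ = g⁻¹ * h.left g := by
  rw [eq_inv_mul_iff_mul_eq, mul_inv_eq_iff_eq_mul, h.left_mul_right]

theorem left_cofactor (w g : G) : h.left (h.cofactor w g) = (h.left w)⁻¹ * h.left g := by
  rw [cofactor, h.left_mul_inv_coe, h.left_inv_coe_mul]

theorem right_cofactor (w g : G) : h.right (h.cofactor w g) = h.right g * (h.right w)⁻¹ := by
  rw [cofactor, h.right_mul_inv_coe, h.right_inv_coe_mul]

theorem cofactor_one_left (g : G) : h.cofactor 1 g = g := by
  simp [cofactor, h.left_one, h.right_one]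

theorem coarrow_one_left (k : G) : h.coarrow 1 k = k := by
  simp [coarrow, h.left_one]

theorem coarrow_one_right (w : G) : h.coarrow w 1 = 1 := by
  simp [coarrow]

theorem cofactor_eq_one (w g : G) : h.cofactor w g = 1 ↔ w = g := by
  rw [cofactor, mul_inv_eq_one, inv_mul_eq_iff_eq_mul, h.left_mul_right, eq_comm]

theorem cofactor_inj (w : G) {g g' : G} : h.cofactor w g = h.cofactor w g' ↔ g = g' := by
  simp [cofactor]

theorem cofactor_cofactor (v w g : G) :
    h.cofactor (h.cofactor v w) (h.cofactor v g) = h.cofactor w g := by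
  rw [cofactor, left_cofactor, right_cofactor]
  simp only [cofactor]
  push_cast
  group

/-- The arrow `coarrow w k` has source `cofactor (k⁻¹ w k) (k⁻¹ g k)`. -/
theorem conj_coarrow (w g k : G) : (h.coarrow w k)⁻¹ * h.cofactor w g * h.coarrow w k =
    h.cofactor (k⁻¹ * w * k) (k⁻¹ * g * k) := by
  rw [cofactor, cofactor, coarrow, h.inv_right, h.inv_right]
  group

theorem coarrow_mul (w k k' : G) :
    h.coarrow w (k * k') = h.coarrow w k * h.coarrow (k⁻¹ * w * k) k' := by
  have : (k * k')⁻¹ * w * (k * k') = k'⁻¹ * (k⁻¹ * w * k) * k' := by group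
  rw [coarrow, coarrow, coarrow, this]
  group

theorem coarrow_coarrow (v w k : G) :
    h.coarrow (h.cofactor v w) (h.coarrow v k) = h.coarrow w k := by
  rw [coarrow, conj_coarrow, left_cofactor, left_cofactor]
  simp only [coarrow]
  push_cast
  group

theorem antipode_cofactor (w g : G) :
    (h.left (h.cofactor w g) : G)⁻¹ * (h.right (h.cofactor w g) : G)⁻¹ =
      (h.left g : G)⁻¹ * w * (h.right g : G)⁻¹ := by
  rw [left_cofactor, right_cofactor]
  push_cast
  conv_rhs => rw [← h.left_mul_right w]
  group

theorem antipode_coarrow (w g k : G) :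
    (h.left (h.cofactor (k⁻¹ * w * k) (k⁻¹ * g * k)) : G)⁻¹ * (h.coarrow w k)⁻¹ *
      h.left (h.cofactor w g) = (h.left (k⁻¹ * g * k) : G)⁻¹ * k⁻¹ * h.left g := by
  rw [left_cofactor, left_cofactor, coarrow]
  push_cast
  group

theorem cofactor_one_right_bijective : Function.Bijective fun w => h.cofactor w 1 := by
  refine Function.Involutive.bijective fun w => ?_
  rw [cofactor, left_cofactor, right_cofactor, h.left_one, h.right_one]
  simp [h.left_mul_right]

/-- The products occurring in the first antipode axiom are nonzero at the unit only, because
nontrivial elements of `G₁` and `G₂` are not conjugate. -/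
theorem antipode_composable_iff (w g k : G) :
    (h.left (k⁻¹ * g * k) : G)⁻¹ * (k⁻¹ * w * k) * (h.right (k⁻¹ * g * k) : G)⁻¹ =
      ((h.left (k⁻¹ * g * k) : G)⁻¹ * k⁻¹ * h.left g) * w *
        ((h.left (k⁻¹ * g * k) : G)⁻¹ * k⁻¹ * h.left g)⁻¹ ↔ g = 1 := by
  constructor
  · intro e
    rw [h.inv_right] at e
    have e' : w * g⁻¹ = h.left g * w * (h.left g : G)⁻¹ := by
      refine mul_left_cancel (a := (h.left (k⁻¹ * g * k) : G)⁻¹ * k⁻¹) (mul_right_cancel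
        (b := k * h.left (k⁻¹ * g * k)) ?_)
      refine Eq.trans ?_ (e.trans ?_) <;> group
    rw [eq_mul_inv_iff_mul_eq, mul_assoc, ← h.inv_right, ← mul_inv_eq_iff_eq_mul] at e'
    have := h.eq_one_of_conj (x := (h.right g)⁻¹) e'
    rw [← h.left_mul_right g, this.1, inv_eq_one.1 this.2]
    simp
  · rintro rfl
    simp [h.left_one, h.right_one]

theorem cofactor_bijective (w : G) : Function.Bijective (h.cofactor w) :=
  ⟨fun _ _ => (h.cofactor_inj w).1, fun g => ⟨h.left w * g * h.right w, by
    rw [cofactor]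
    group⟩⟩

end IsExactFactorization

/-- The quantum double of the bicrossproduct `H(G, G₁, G₂)`. Its algebra is that of the quantum
double of the group algebra of `G`, with a basis consisting of the arrows `(g, k)`, with target `g`
and source `k⁻¹ g k`, of the groupoid of `G` acting on itself by conjugation; the elements are
represented by their coordinate vectors. -/
def Double {G : Type*} [Group G] {G₁ G₂ : Subgroup G} (_h : IsExactFactorization G₁ G₂) : Type _ :=
  G × G →₀ ℂ

namespace Double

open Coalgebra

variable {G : Type*} [Group G] {G₁ G₂ : Subgroup G} (h : IsExactFactorization G₁ G₂)

noncomputable instance : AddCommGroup (Double h) := inferInstanceAs (AddCommGroup (G × G →₀ ℂ))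

noncomputable instance : Module ℂ (Double h) := inferInstanceAs (Module ℂ (G × G →₀ ℂ))

/-- The basis of arrows of the quantum double. -/
noncomputable def basis : Module.Basis (G × G) ℂ (Double h) :=
  Module.Basis.ofRepr (LinearEquiv.refl ℂ (G × G →₀ ℂ))

open Classical in
/-- The product `(g, k)(g', k') = (g, kk')` of arrows with `g = kg'k⁻¹`. -/
noncomputable def mulMap : Double h →ₗ[ℂ] Double h →ₗ[ℂ] Double h :=
  (basis h).constr ℂ fun i => (basis h).constr ℂ fun j =>
    if i.1 = i.2 * j.1 * i.2⁻¹ then basis h (i.1, i.2 * j.2) else 0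

open Classical in
theorem mulMap_basis (g k g' k' : G) : mulMap h (basis h (g, k)) (basis h (g', k')) =
    if g = k * g' * k⁻¹ then basis h (g, k * k') else 0 := by
  rw [mulMap, Module.Basis.constr_basis, Module.Basis.constr_basis]

theorem mulMap_assoc (u v w : Double h) :
    mulMap h (mulMap h u v) w = mulMap h u (mulMap h v w) := by
  classical
  suffices (mulMap h).compr₂ (mulMap h) =
      (LinearMap.llcomp ℂ _ _ _).flip (mulMap h) ∘ₗ LinearMap.llcomp ℂ _ _ _ ∘ₗ mulMap h from
    LinearMap.congr_fun (LinearMap.congr_fun (LinearMap.congr_fun this u) v) w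
  refine (basis h).ext fun ⟨g, k⟩ => (basis h).ext fun ⟨g', k'⟩ =>
    (basis h).ext fun ⟨g'', k''⟩ => ?_
  change mulMap h (mulMap h _ _) _ = mulMap h _ (mulMap h _ _)
  rw [mulMap_basis, mulMap_basis]
  by_cases h₁ : g = k * g' * k⁻¹ <;> by_cases h₂ : g' = k' * g'' * k'⁻¹
  · rw [if_pos h₁, if_pos h₂, mulMap_basis, mulMap_basis, if_pos h₁, if_pos, mul_assoc]
    rw [h₁, h₂]
    group
  · rw [if_pos h₁, if_neg h₂, mulMap_basis, map_zero, if_neg]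
    rintro h₃
    apply h₂
    rw [h₁] at h₃
    have : k * g' * k⁻¹ = k * (k' * g'' * k'⁻¹) * k⁻¹ := by
      rw [h₃]
      group
    simpa using this
  · rw [if_neg h₁, if_pos h₂, mulMap_basis, map_zero, LinearMap.zero_apply, if_neg h₁]
  · rw [if_neg h₁, if_neg h₂, map_zero, map_zero, LinearMap.zero_apply]

attribute [local instance 2000] Fintype.ofFinite

variable [Finite G]

noncomputable instance : Ring (Double h) where
  __ : AddCommGroup (Double h) := inferInstance
  mul u v := mulMap h u v
  one := ∑ g : G, basis h (g, 1)
  left_distrib u v w := map_add (mulMap h u) v w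
  right_distrib u v w := by
    change mulMap h _ _ = mulMap h _ _ + mulMap h _ _
    rw [map_add, LinearMap.add_apply]
  zero_mul u := by
    change mulMap h _ _ = _
    rw [map_zero, LinearMap.zero_apply]
  mul_zero u := map_zero (mulMap h u)
  mul_assoc := mulMap_assoc h
  one_mul u := by
    change mulMap h (∑ g : G, basis h (g, 1)) u = u
    refine LinearMap.congr_fun (g := LinearMap.id) ((basis h).ext fun ⟨g, k⟩ => ?_) u
    classical
    simp [map_sum, LinearMap.sum_apply, mulMap_basis]
  mul_one u := by
    change mulMap h u (∑ g : G, basis h (g, 1)) = u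
    refine LinearMap.congr_fun (f := (mulMap h).flip _) (g := LinearMap.id)
      ((basis h).ext fun ⟨g, k⟩ => ?_) u
    rw [LinearMap.flip_apply, map_sum, Fintype.sum_eq_single (k⁻¹ * g * k) fun y hy => by
      rw [mulMap_basis, if_neg]
      rintro rfl
      apply hy
      group]
    rw [mulMap_basis, if_pos (by group), mul_one, LinearMap.id_apply]

noncomputable instance : Algebra ℂ (Double h) :=
  Algebra.ofModule
    (fun c u v => by
      change mulMap h _ _ = c • mulMap h _ _
      rw [map_smul, LinearMap.smul_apply])
    (fun c u v => map_smul (mulMap h u) c v)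

open Classical in
theorem basis_mul (g k g' k' : G) : basis h (g, k) * basis h (g', k') =
    if g = k * g' * k⁻¹ then basis h (g, k * k') else 0 := mulMap_basis h g k g' k'

theorem one_def : (1 : Double h) = ∑ g : G, basis h (g, 1) := rfl

theorem isActionBasis : IsActionBasis (fun k g : G => k * g * k⁻¹) (basis h) where
  one_act g := by simp
  mul_act k l g := by group
  mul_of_eq g k l := by rw [basis_mul, if_pos rfl]
  mul_of_ne g k g' l hne := by rw [basis_mul, if_neg hne]
  one_eq := rfl

/-- A multiplicativity statement for linear maps on an algebra that has only to be checked on a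
basis. -/
theorem map_mul_of_basis {ι A B : Type*} [Ring A] [Algebra ℂ A] [Ring B] [Algebra ℂ B]
    (b : Module.Basis ι ℂ A) (f : A →ₗ[ℂ] B) (hf : ∀ i j, f (b i * b j) = f (b i) * f (b j))
    (u v : A) : f (u * v) = f u * f v := by
  suffices (LinearMap.mul ℂ A).compr₂ f = (LinearMap.mul ℂ B).compl₁₂ f f from
    LinearMap.congr_fun (LinearMap.congr_fun this u) v
  exact b.ext fun i => b.ext fun j => hf i j

/-- The coproduct of the quantum double. -/
noncomputable def comulMap : Double h →ₗ[ℂ] Double h ⊗[ℂ] Double h :=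
  (basis h).constr ℂ fun i =>
    ∑ w : G, basis h (h.cofactor w i.1, h.coarrow w i.2) ⊗ₜ[ℂ] basis h (w, i.2)

open Classical in
/-- The counit of the quantum double. -/
noncomputable def counitMap : Double h →ₗ[ℂ] ℂ :=
  (basis h).constr ℂ fun i => if i.1 = 1 then 1 else 0

/-- The antipode of the quantum double: it maps the arrow `(g, k)` with source `g' = ax` to an arrow
with target `a⁻¹x⁻¹`. -/
noncomputable def antipodeMap : Double h →ₗ[ℂ] Double h :=
  (basis h).constr ℂ fun i =>
    let g' := i.2⁻¹ * i.1 * i.2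
    basis h ((h.left g' : G)⁻¹ * (h.right g' : G)⁻¹, (h.left g' : G)⁻¹ * i.2⁻¹ * h.left i.1)

theorem comulMap_basis (g k : G) : comulMap h (basis h (g, k)) =
    ∑ w : G, basis h (h.cofactor w g, h.coarrow w k) ⊗ₜ[ℂ] basis h (w, k) := by
  rw [comulMap, Module.Basis.constr_basis]

open Classical in
theorem counitMap_basis (g k : G) : counitMap h (basis h (g, k)) = if g = 1 then 1 else 0 := by
  rw [counitMap, Module.Basis.constr_basis]

theorem antipodeMap_basis (g k : G) : antipodeMap h (basis h (g, k)) =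
    basis h ((h.left (k⁻¹ * g * k) : G)⁻¹ * (h.right (k⁻¹ * g * k) : G)⁻¹,
      (h.left (k⁻¹ * g * k) : G)⁻¹ * k⁻¹ * h.left g) := by
  rw [antipodeMap, Module.Basis.constr_basis]

noncomputable instance : Coalgebra ℂ (Double h) where
  comul := comulMap h
  counit := counitMap h
  coassoc := by
    refine (basis h).ext fun ⟨g, k⟩ => ?_
    simp only [LinearMap.comp_apply, LinearEquiv.coe_coe, comulMap_basis, map_sum,
      LinearMap.rTensor_tmul, LinearMap.lTensor_tmul, TensorProduct.tmul_sum,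
      TensorProduct.sum_tmul, TensorProduct.assoc_tmul]
    conv_rhs => rw [Finset.sum_comm]
    refine Finset.sum_congr rfl fun v _ => ?_
    refine (Fintype.sum_bijective _ (h.cofactor_bijective v) _ _ fun w => ?_).symm
    rw [h.cofactor_cofactor, h.coarrow_coarrow]
  rTensor_counit_comp_comul := by
    refine (basis h).ext fun ⟨g, k⟩ => ?_
    classical
    simp [comulMap_basis, counitMap_basis, TensorProduct.ite_tmul, h.cofactor_eq_one]
  lTensor_counit_comp_comul := by
    refine (basis h).ext fun ⟨g, k⟩ => ?_
    classical
    simp [comulMap_basis, counitMap_basis, TensorProduct.tmul_ite, h.cofactor_one_left,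
      h.coarrow_one_left]

theorem comulMap_mul (u v : Double h) : comulMap h (u * v) = comulMap h u * comulMap h v := by
  classical
  refine map_mul_of_basis (basis h) (comulMap h) ?_ u v
  rintro ⟨g, k⟩ ⟨g', k'⟩
  rw [basis_mul, comulMap_basis, comulMap_basis, Finset.sum_mul_sum, apply_ite (comulMap h),
    map_zero, comulMap_basis]
  have key : ∀ w, ∑ w', (basis h (h.cofactor w g, h.coarrow w k) ⊗ₜ[ℂ] basis h (w, k)) *
      (basis h (h.cofactor w' g', h.coarrow w' k') ⊗ₜ[ℂ] basis h (w', k')) =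
      if g = k * g' * k⁻¹ then basis h (h.cofactor w g, h.coarrow w (k * k')) ⊗ₜ[ℂ]
        basis h (w, k * k') else 0 := by
    intro w
    rw [Fintype.sum_eq_single (k⁻¹ * w * k) fun w' hw => by
      rw [Algebra.TensorProduct.tmul_mul_tmul, basis_mul h w, if_neg, TensorProduct.tmul_zero]
      rintro rfl
      apply hw
      group]
    have e := h.conj_coarrow w g k
    have : h.cofactor w g = h.coarrow w k * h.cofactor (k⁻¹ * w * k) g' * (h.coarrow w k)⁻¹ ↔
        g = k * g' * k⁻¹ := by
      rw [eq_mul_inv_iff_mul_eq, ← inv_mul_eq_iff_eq_mul, ← mul_assoc, e, h.cofactor_inj,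
        eq_mul_inv_iff_mul_eq, ← inv_mul_eq_iff_eq_mul, ← mul_assoc]
    rw [Algebra.TensorProduct.tmul_mul_tmul, basis_mul, basis_mul h w,
      if_pos (show w = k * (k⁻¹ * w * k) * k⁻¹ by group), ← h.coarrow_mul]
    simp only [this]
    split_ifs
    · rfl
    · rw [TensorProduct.zero_tmul]
  simp only [key]
  split_ifs <;> simp

noncomputable instance : Bialgebra ℂ (Double h) :=
  Bialgebra.mk' ℂ (Double h)
    (by
      change counitMap h 1 = 1
      classical
      simp [one_def, counitMap_basis])
    (by
      intro u v
      refine map_mul_of_basis (basis h) (counitMap h) ?_ u v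
      rintro ⟨g, k⟩ ⟨g', k'⟩
      rw [basis_mul, apply_ite (counitMap h), map_zero, counitMap_basis, counitMap_basis,
        counitMap_basis]
      by_cases hg : g' = 1
      · by_cases hg₁ : g = 1 <;> simp [hg, hg₁]
      · by_cases hg₁ : g = 1
        · simp [hg, hg₁, eq_comm]
        · simp [hg₁])
    (by
      change comulMap h 1 = 1
      simp only [one_def, map_sum, comulMap_basis, Algebra.TensorProduct.one_def,
        TensorProduct.sum_tmul, TensorProduct.tmul_sum, h.coarrow_one_right]
      rw [Finset.sum_comm]
      refine Finset.sum_congr rfl fun w _ => ?_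
      exact Fintype.sum_bijective _ (h.cofactor_bijective w) _ _ fun g => rfl)
    (by
      intro u v
      exact comulMap_mul h u v)

noncomputable instance : HopfAlgebra ℂ (Double h) where
  antipode := antipodeMap h
  mul_antipode_rTensor_comul := by
    classical
    refine (basis h).ext ?_
    rintro ⟨g, k⟩
    change LinearMap.mul' ℂ _ ((antipodeMap h).rTensor _ (comulMap h _)) =
      algebraMap ℂ _ (counitMap h _)
    simp only [comulMap_basis, counitMap_basis, map_sum, LinearMap.rTensor_tmul,
      LinearMap.mul'_apply]
    have key : ∀ w, antipodeMap h (basis h (h.cofactor w g, h.coarrow w k)) * basis h (w, k) =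
        if g = 1 then basis h (k⁻¹ * w * k, 1) else 0 := by
      intro w
      rw [antipodeMap_basis, h.conj_coarrow, h.antipode_cofactor, h.antipode_coarrow, basis_mul]
      by_cases hg : g = 1
      · rw [if_pos ((h.antipode_composable_iff w g k).2 hg), if_pos hg, hg]
        simp [h.left_one, h.right_one]
      · rw [if_neg fun e => hg ((h.antipode_composable_iff w g k).1 e), if_neg hg]
    simp only [key]
    by_cases hg : g = 1
    · subst hg
      simp only [if_true, map_one, one_def]
      refine Fintype.sum_bijective (fun w => k⁻¹ * w * k) ⟨?_, ?_⟩ _ _ fun w => ?_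
      · intro w w' e
        simpa using e
      · intro w
        exact ⟨k * w * k⁻¹, by group⟩
      · rfl
    · simp [hg]
  mul_antipode_lTensor_comul := by
    classical
    refine (basis h).ext ?_
    rintro ⟨g, k⟩
    change LinearMap.mul' ℂ _ ((antipodeMap h).lTensor _ (comulMap h _)) =
      algebraMap ℂ _ (counitMap h _)
    simp only [comulMap_basis, counitMap_basis, map_sum, LinearMap.lTensor_tmul,
      LinearMap.mul'_apply]
    have key : ∀ w, basis h (h.cofactor w g, h.coarrow w k) * antipodeMap h (basis h (w, k)) =
        if g = 1 then basis h (h.cofactor w 1, 1) else 0 := by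
      intro w
      have e : (h.left (k⁻¹ * w * k) : G)⁻¹ * (h.right (k⁻¹ * w * k) : G)⁻¹ =
          h.cofactor (k⁻¹ * w * k) 1 := by rw [IsExactFactorization.cofactor, mul_one]
      have e' : h.cofactor w g = h.coarrow w k * ((h.left (k⁻¹ * w * k) : G)⁻¹ *
          (h.right (k⁻¹ * w * k) : G)⁻¹) * (h.coarrow w k)⁻¹ ↔ g = 1 := by
        rw [eq_mul_inv_iff_mul_eq, ← inv_mul_eq_iff_eq_mul, ← mul_assoc, h.conj_coarrow, e,
          h.cofactor_inj, mul_eq_one_iff_eq_inv, inv_mul_eq_iff_eq_mul, mul_inv_cancel]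
      rw [antipodeMap_basis, basis_mul]
      by_cases hg : g = 1
      · rw [if_pos (e'.2 hg), if_pos hg, hg, IsExactFactorization.coarrow]
        congr 2
        group
      · rw [if_neg fun c => hg (e'.1 c), if_neg hg]
    simp only [key]
    by_cases hg : g = 1
    · subst hg
      simp only [if_true, map_one, one_def]
      exact Fintype.sum_bijective _ h.cofactor_one_right_bijective _ _ fun w => rfl
    · simp [hg]

end Double

/-! ### Group-like elements of a quantum double -/

section GroupLike

open Coalgebra HopfAlgebra

variable {H : Type*} [Ring H] [HopfAlgebra ℂ H]

theorem HopfDual.mul_apply' (f g : HopfDual ℂ H) (x : H) :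
    (f * g) x = LinearMap.mul' ℂ ℂ (TensorProduct.map (HopfDual.equiv ℂ H f) (HopfDual.equiv ℂ H g)
      (comul x)) := rfl

variable [FiniteDimensional ℂ H]

/-- A group-like element of the dual is a character. -/
theorem HopfDual.eq_one_of_comul_eq (hH : IsPerfectHopf H) {f : HopfDual ℂ H}
    (hf : comul (R := ℂ) f = f ⊗ₜ[ℂ] f) (h0 : f ≠ 0) : f = 1 := by
  have hmul : ∀ x y, f (x * y) = f x * f y := fun x y => by
    have := dualPairing_dualComul f (x ⊗ₜ[ℂ] y)
    change dualPairing (comul (R := ℂ) f) _ = _ at this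
    rw [hf, dualPairing_tmul, LinearMap.mul'_apply] at this
    exact this.symm
  have h1 : f 1 = 1 := by
    by_contra hne
    have h2 := hmul 1 1
    rw [mul_one] at h2
    have h3 : f 1 = 0 := by
      by_contra h4
      exact hne (mul_left_cancel₀ h4 (by rw [← h2, mul_one]))
    apply h0
    apply DFunLike.ext
    intro x
    rw [← one_mul x, hmul, h3, zero_mul]
    rfl
  apply DFunLike.ext
  intro x
  rw [HopfDual.one_apply, ← hH.algHom_apply (AlgHom.ofLinearMap (HopfDual.equiv ℂ H f) h1 hmul)]
  rfl

/-- Evaluation at a group-like element is a character of the dual. -/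
theorem eq_one_of_comul_eq (hH : IsPerfectHopf (HopfDual ℂ H)) {u : H}
    (hu : comul (R := ℂ) u = u ⊗ₜ[ℂ] u) (h0 : u ≠ 0) : u = 1 := by
  have h1 : counit (R := ℂ) u = (1 : ℂ) := by
    have := rTensor_counit_comul (R := ℂ) u
    rw [hu, LinearMap.rTensor_tmul] at this
    have := congrArg (TensorProduct.lid ℂ H) this
    rw [TensorProduct.lid_tmul, TensorProduct.lid_tmul] at this
    exact smul_left_injective ℂ h0 this
  let χ : HopfDual ℂ H →ₐ[ℂ] ℂ := AlgHom.ofLinearMap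
    (LinearMap.applyₗ u ∘ₗ (HopfDual.equiv ℂ H).toLinearMap) h1 fun f g => by
      change (f * g) u = f u * g u
      rw [HopfDual.mul_apply', hu]
      rfl
  rw [← sub_eq_zero, ← Module.forall_dual_apply_eq_zero_iff ℂ]
  intro φ
  have : φ u = φ 1 := hH.algHom_apply χ ((HopfDual.equiv ℂ H).symm φ)
  rw [map_sub, this, sub_self]

variable {D : Type*} [Ring D] [HopfAlgebra ℂ D]

/-- The quantum double of a biperfect Hopf algebra has no nontrivial group-like elements: as a
coalgebra it is `H^{*cop} ⊗ H`, so a group-like element is a tensor product of group-like elements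
of `H^*` and `H`. -/
theorem IsQuantumDouble.eq_one_of_isGroupLikeElem (hD : IsQuantumDouble H D) (hH : IsBiperfect H)
    {z : D} (hz : IsGroupLikeElem ℂ z) : z = 1 := by
  obtain ⟨S, E, hS, hmul, hcomul⟩ := hD
  let π₁ : HopfDual ℂ H ⊗[ℂ] H →ₗ[ℂ] HopfDual ℂ H :=
    (TensorProduct.rid ℂ _).toLinearMap ∘ₗ (counit (R := ℂ) (A := H)).lTensor _
  let π₂ : HopfDual ℂ H ⊗[ℂ] H →ₗ[ℂ] H :=
    (TensorProduct.lid ℂ _).toLinearMap ∘ₗ (counit (R := ℂ) (A := HopfDual ℂ H)).rTensor _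
  have hπ₁ : ∀ f u, π₁ (f ⊗ₜ u) = counit (R := ℂ) u • f := fun f u => by simp [π₁]
  have hπ₂ : ∀ f u, π₂ (f ⊗ₜ u) = counit (R := ℂ) f • u := fun f u => by simp [π₂]
  have hsplit : ∀ (V W : Type _) [AddCommGroup V] [Module ℂ V] [AddCommGroup W] [Module ℂ W]
      (p : HopfDual ℂ H ⊗[ℂ] H →ₗ[ℂ] V) (q : HopfDual ℂ H ⊗[ℂ] H →ₗ[ℂ] W) (f u),
      TensorProduct.map (p ∘ₗ E.symm.toLinearMap) (q ∘ₗ E.symm.toLinearMap)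
        (comul (E (f ⊗ₜ[ℂ] u))) = TensorProduct.map p q
          (TensorProduct.tensorTensorTensorComm ℂ (HopfDual ℂ H) (HopfDual ℂ H) H H
            (TensorProduct.comm ℂ (HopfDual ℂ H) (HopfDual ℂ H) (comul f) ⊗ₜ[ℂ] comul u)) := by
    intro V W _ _ _ _ p q f u
    rw [hcomul, TensorProduct.map_map]
    congr 2 <;> (ext; simp)
  have h12 : ∀ t, TensorProduct.map (π₁ ∘ₗ E.symm.toLinearMap) (π₂ ∘ₗ E.symm.toLinearMap)
      (comul (E t)) = t := by
    intro t
    induction t with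
    | zero => simp
    | add t₁ t₂ h₁ h₂ => simp only [map_add, h₁, h₂]
    | tmul f u =>
      rw [hsplit]
      have : ∀ (a : HopfDual ℂ H ⊗[ℂ] HopfDual ℂ H) (b : H ⊗[ℂ] H), TensorProduct.map π₁ π₂
          (TensorProduct.tensorTensorTensorComm ℂ (HopfDual ℂ H) (HopfDual ℂ H) H H
            (TensorProduct.comm ℂ (HopfDual ℂ H) (HopfDual ℂ H) a ⊗ₜ[ℂ] b)) =
          TensorProduct.lid ℂ _ ((counit (R := ℂ)).rTensor _ a) ⊗ₜ[ℂ]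
            TensorProduct.lid ℂ _ ((counit (R := ℂ)).rTensor _ b) := by
        intro a b
        induction a with
        | zero => simp
        | add a₁ a₂ h₁ h₂ => simp only [map_add, TensorProduct.add_tmul, h₁, h₂]
        | tmul f₁ f₂ =>
          induction b with
          | zero => simp
          | add b₁ b₂ h₁ h₂ => simp only [map_add, TensorProduct.tmul_add, h₁, h₂]
          | tmul u₁ u₂ => simp [hπ₁, hπ₂, ← TensorProduct.smul_tmul', smul_smul, mul_comm]
      rw [this, rTensor_counit_comul, rTensor_counit_comul]
      simp
  have h11 : ∀ f u, TensorProduct.map (π₁ ∘ₗ E.symm.toLinearMap) (π₁ ∘ₗ E.symm.toLinearMap)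
      (comul (E (f ⊗ₜ u))) = TensorProduct.comm ℂ _ _ (comul (π₁ (f ⊗ₜ u))) := by
    intro f u
    rw [hsplit]
    have : ∀ (a : HopfDual ℂ H ⊗[ℂ] HopfDual ℂ H) (b : H ⊗[ℂ] H), TensorProduct.map π₁ π₁
        (TensorProduct.tensorTensorTensorComm ℂ (HopfDual ℂ H) (HopfDual ℂ H) H H
          (a ⊗ₜ[ℂ] b)) = counit (R := ℂ) (TensorProduct.lid ℂ _ ((counit (R := ℂ)).rTensor _ b)) •
            a := by
      intro a b
      induction a with
      | zero => simp
      | add a₁ a₂ h₁ h₂ => simp only [map_add, TensorProduct.add_tmul, h₁, h₂, smul_add]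
      | tmul f₁ f₂ =>
        induction b with
        | zero => simp
        | add b₁ b₂ h₁ h₂ => simp only [map_add, TensorProduct.tmul_add, h₁, h₂, add_smul]
        | tmul u₁ u₂ => simp [hπ₁, ← TensorProduct.smul_tmul', smul_smul, mul_comm]
    rw [this, rTensor_counit_comul, hπ₁]
    simp
  have h22 : ∀ f u, TensorProduct.map (π₂ ∘ₗ E.symm.toLinearMap) (π₂ ∘ₗ E.symm.toLinearMap)
      (comul (E (f ⊗ₜ u))) = comul (π₂ (f ⊗ₜ u)) := by
    intro f u
    rw [hsplit]
    have : ∀ (a : HopfDual ℂ H ⊗[ℂ] HopfDual ℂ H) (b : H ⊗[ℂ] H), TensorProduct.map π₂ π₂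
        (TensorProduct.tensorTensorTensorComm ℂ (HopfDual ℂ H) (HopfDual ℂ H) H H
          (TensorProduct.comm ℂ _ _ a ⊗ₜ[ℂ] b)) =
            counit (R := ℂ) (TensorProduct.lid ℂ _ ((counit (R := ℂ)).rTensor _ a)) • b := by
      intro a b
      induction b with
      | zero => simp
      | add b₁ b₂ h₁ h₂ => simp only [map_add, TensorProduct.tmul_add, h₁, h₂, smul_add]
      | tmul u₁ u₂ =>
        induction a with
        | zero => simp
        | add a₁ a₂ h₁ h₂ => simp only [map_add, TensorProduct.add_tmul, h₁, h₂, add_smul]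
        | tmul f₁ f₂ => simp [hπ₂, ← TensorProduct.smul_tmul', smul_smul]
    rw [this, rTensor_counit_comul, hπ₂]
    simp
  have hz0 : z ≠ 0 := by
    rintro rfl
    simpa using hz.counit_eq_one
  have hprod : E.symm z = π₁ (E.symm z) ⊗ₜ π₂ (E.symm z) := by
    have := h12 (E.symm z)
    rw [E.apply_symm_apply, hz.comul_eq_tmul_self] at this
    exact this.symm
  have hne : π₁ (E.symm z) ≠ 0 ∧ π₂ (E.symm z) ≠ 0 := by
    constructor <;> intro h0 <;> rw [h0] at hprod
    · exact hz0 (E.symm.injective (by rw [hprod, TensorProduct.zero_tmul, map_zero]))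
    · exact hz0 (E.symm.injective (by rw [hprod, TensorProduct.tmul_zero, map_zero]))
  have h₁ : π₁ (E.symm z) = 1 := by
    refine HopfDual.eq_one_of_comul_eq hH.1 ?_ hne.1
    have := h11 (π₁ (E.symm z)) (π₂ (E.symm z))
    rw [← hprod, E.apply_symm_apply, hz.comul_eq_tmul_self, TensorProduct.map_tmul,
      LinearMap.comp_apply] at this
    apply (TensorProduct.comm ℂ (HopfDual ℂ H) (HopfDual ℂ H)).injective
    rw [← this]
    rfl
  have h₂ : π₂ (E.symm z) = 1 := by
    refine BiHopf.eq_one_of_comul_eq hH.2 ?_ hne.2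
    have := h22 (π₁ (E.symm z)) (π₂ (E.symm z))
    rw [← hprod, E.apply_symm_apply, hz.comul_eq_tmul_self, TensorProduct.map_tmul,
      LinearMap.comp_apply] at this
    exact this.symm
  rw [h₁, h₂] at hprod
  have hone : ∀ v, E ((1 : HopfDual ℂ H) ⊗ₜ[ℂ] (1 : H)) * E v = E v := by
    intro v
    induction v with
    | zero => simp
    | add v₁ v₂ h₁ h₂ => simp only [map_add, mul_add, h₁, h₂]
    | tmul g v =>
      have hS1 : S.symm 1 = 1 := by
        rw [LinearEquiv.symm_apply_eq, hS, antipode_one]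
      rw [hmul 1 g 1 v 1 (fun _ => 1) (fun _ => 1) (fun _ => 1) (by
        simp [Bialgebra.comul_one, Algebra.TensorProduct.one_def])]
      rw [Fin.sum_univ_one, hS1, one_mul, one_mul]
      congr 2
      apply DFunLike.ext
      intro x
      change g (1 * (x * 1)) = g x
      rw [one_mul, mul_one]
  have hz1 : z = E ((1 : HopfDual ℂ H) ⊗ₜ[ℂ] (1 : H)) := by rw [← hprod, E.apply_symm_apply]
  have := hone (E.symm 1)
  rw [E.apply_symm_apply, mul_one] at this
  rw [hz1, this]

end GroupLike

/-! ### The embeddings of a bicrossproduct and of its dual -/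

theorem sum_ite_of_iff {α M : Type*} [Fintype α] [AddCommMonoid M] {P : α → Prop}
    [DecidablePred P] {Q : Prop} [Decidable Q] (a₀ : α) (hP : ∀ a, P a ↔ a = a₀ ∧ Q) (f : α → M) :
    ∑ a, (if P a then f a else 0) = if Q then f a₀ else 0 := by
  rw [Fintype.sum_eq_single a₀ fun a ha => if_neg fun h => ha ((hP a).1 h).1]
  simp [hP]

namespace IsExactFactorization

variable {G : Type*} [Group G] {G₁ G₂ : Subgroup G} (h : IsExactFactorization G₁ G₂)

theorem left_mul_left (x y : G₂) (a : G₁) :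
    h.left (x * h.left (y * a)) = h.left ((x * y : G₂) * a) := by
  rw [← h.symm_act_eq, ← h.symm_act_eq, ← h.symm_act_eq, h.symm.mul_act]

theorem left_mul_left_inv (x : G₂) (a : G₁) : h.left (x * h.left ((x : G)⁻¹ * a)) = a := by
  have := h.left_mul_left x x⁻¹ a
  rw [mul_inv_cancel, Subgroup.coe_one, one_mul, h.left_coe] at this
  exact this

theorem left_inv_mul_left (x : G₂) (a : G₁) : h.left ((x : G)⁻¹ * h.left (x * a)) = a := by
  have := h.left_mul_left x⁻¹ x a
  rw [inv_mul_cancel, Subgroup.coe_one, one_mul, h.left_coe] at this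
  exact this

theorem mul_left_eq (x : G₂) (a : G₁) :
    (x * h.left ((x : G)⁻¹ * a) : G) = a * h.act a⁻¹ x := by
  rw [h.coe_act, Subgroup.coe_inv, inv_inv]
  group

/-- The bijection of index sets underlying the identification of `H^* ⊗ H` with the quantum
double. -/
noncomputable def doubleIndex : (G₁ × G₂) × (G₂ × G₁) ≃ G × G where
  toFun := fun ((a, x), (y, b)) =>
    (x * h.left ((x : G)⁻¹ * a) * y * (x : G)⁻¹, x * h.left ((y : G)⁻¹ * b))
  invFun := fun (g, k) =>
    let x := (h.right k⁻¹)⁻¹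
    let y := h.right ((x : G)⁻¹ * g * x)
    ((h.left (x * h.left ((x : G)⁻¹ * g * x)), x), (y, h.left (y * ((h.left k⁻¹)⁻¹ : G₁))))
  left_inv := by
    rintro ⟨⟨a, x⟩, ⟨y, b⟩⟩
    have e : h.right (x * h.left ((y : G)⁻¹ * b) : G)⁻¹ = x⁻¹ :=
      h.right_eq (a := (h.left ((y : G)⁻¹ * b))⁻¹) (by push_cast; group)
    have e' : h.left (x * h.left ((y : G)⁻¹ * b) : G)⁻¹ = (h.left ((y : G)⁻¹ * b))⁻¹ :=
      h.left_eq (x := x⁻¹) (by push_cast; group)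
    have e'' : (x : G)⁻¹ * (x * h.left ((x : G)⁻¹ * a) * y * (x : G)⁻¹) * x =
        h.left ((x : G)⁻¹ * a) * y := by group
    simp only [e, e', inv_inv, e'', h.left_mul_coe, h.left_coe, h.right_coe_mul, h.right_coe,
      h.left_mul_left_inv]
  right_inv := by
    rintro ⟨g, k⟩
    simp only [h.left_inv_mul_left, Prod.mk.injEq]
    constructor
    · rw [mul_assoc (((h.right k⁻¹)⁻¹ : G₂) : G), h.left_mul_right]
      group
    · push_cast
      rw [← mul_inv_rev, h.left_mul_right, inv_inv]

theorem doubleIndex_apply (a : G₁) (x y : G₂) (b : G₁) : h.doubleIndex ((a, x), (y, b)) =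
    ((x : G) * h.left ((x : G)⁻¹ * a) * y * (x : G)⁻¹, (x : G) * h.left ((y : G)⁻¹ * b)) := rfl

theorem conj_eq_iff (a b : G₁) (x y z : G₂) : (a * y : G) = x * (b * z) * (x : G)⁻¹ ↔
    a = h.left (x * b) ∧ y = h.right (x * b) * z * x⁻¹ := by
  have : (x * (b * z) * (x : G)⁻¹ : G) = h.left (x * b) * (h.right (x * b) * z * x⁻¹ : G₂) := by
    push_cast
    rw [← mul_assoc, ← mul_assoc (h.left _ : G), ← mul_assoc (h.left _ : G), h.left_mul_right,
      mul_assoc (x : G)]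
  rw [this]
  exact ⟨fun e => h.mul_inj e, fun e => by rw [e.1, e.2]⟩

theorem cofactor_mul (a b : G₁) (x y : G₂) :
    h.cofactor (b * y) (a * x) = (b⁻¹ * a : G₁) * (x * y⁻¹ : G₂) := by
  rw [cofactor, h.left_mul_coe, h.left_coe, h.right_coe_mul, h.right_coe]
  push_cast
  group

theorem coarrow_coe_left (b c : G₁) (y : G₂) : h.coarrow (b * y) c = h.left (y * c) := by
  rw [coarrow, h.left_mul_coe, h.left_coe, ← Subgroup.coe_inv _ c, mul_assoc (c⁻¹ : G₁).1,
    mul_assoc, h.left_coe_mul, mul_assoc, h.left_coe_mul]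
  push_cast
  group

theorem coarrow_coe_right (b : G₁) (x y : G₂) : h.coarrow (b * y) x = h.act b⁻¹ x := by
  rw [coarrow, h.left_mul_coe, h.left_mul_coe, h.left_coe, ← mul_assoc, h.left_mul_coe, h.coe_act]
  push_cast
  rw [inv_inv]

/-- The sum over `G` as a double sum over the two factors. -/
theorem sum_prod (h : IsExactFactorization G₁ G₂) {M : Type*} [AddCommMonoid M] [Fintype G]
    [Fintype G₁] [Fintype G₂] (f : G → M) : ∑ a : G₁, ∑ y : G₂, f (a * y) = ∑ g, f g := by
  rw [← Fintype.sum_prod_type']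
  exact Fintype.sum_equiv h.prodEquiv _ _ fun _ => rfl

end IsExactFactorization

namespace Bicrossproduct

open Coalgebra

attribute [local instance 2000] Fintype.ofFinite

variable {G : Type*} [Group G] [Finite G] {G₁ G₂ : Subgroup G} (h : IsExactFactorization G₁ G₂)

theorem comul_dualBasis (a : G₁) (x : G₂) : comul (R := ℂ) (dualBasis h (a, x)) =
    ∑ b : G₁, dualBasis h (b, x) ⊗ₜ[ℂ] dualBasis h (b⁻¹ * a, h.act b⁻¹ x) := by
  classical
  apply dualPairing.injective
  refine ((basis h).tensorProduct (basis h)).ext ?_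
  rintro ⟨⟨y, c⟩, ⟨z, c'⟩⟩
  rw [Module.Basis.tensorProduct_apply]
  refine (dualPairing_dualComul _ _).trans ?_
  rw [LinearMap.mul'_apply, basis_mul, map_sum, LinearMap.sum_apply]
  simp only [dualPairing_tmul, dualBasis_apply]
  rw [Fintype.sum_eq_single c fun b hb => by rw [if_neg fun e => hb e.2.symm, zero_mul]]
  by_cases hy : y = x
  · subst hy
    have e : y = h.act c z ↔ z = h.act c⁻¹ y :=
      ⟨fun e => by rw [e, h.act_inv_act], fun e => by rw [e, h.act_act_inv]⟩
    by_cases hz : y = h.act c z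
    · rw [if_pos hz, dualBasis_apply]
      simp [← e, ← hz, eq_inv_mul_iff_mul_eq]
    · rw [if_neg hz]
      simp only [← e, hz]
      simp [← HopfDual.equiv_apply]
  · rw [if_neg (c := y = x ∧ c = c) fun e => hy e.1, zero_mul]
    split_ifs
    · rw [dualBasis_apply, if_neg fun e => hy e.1]
    · rw [← HopfDual.equiv_apply, map_zero]

end Bicrossproduct

namespace Double

open Coalgebra HopfAlgebra Bicrossproduct

attribute [local instance 2000] Fintype.ofFinite

variable {G : Type*} [Group G] [Finite G] {G₁ G₂ : Subgroup G} (h : IsExactFactorization G₁ G₂)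

theorem comul_basis (g k : G) : comul (R := ℂ) (basis h (g, k)) =
    ∑ w : G, basis h (h.cofactor w g, h.coarrow w k) ⊗ₜ[ℂ] basis h (w, k) := comulMap_basis h g k

/-- The inclusion of the bicrossproduct in its quantum double: `δ_y ⊗ b` is the sum of the arrows
`b'` whose target has `y` as its factor in `G₂`, where `b' = y⁻¹ · b`. -/
noncomputable def ofBicrossproduct : Bicrossproduct h →ₗ[ℂ] Double h :=
  (Bicrossproduct.basis h).constr ℂ fun i =>
    ∑ a : G₁, basis h (a * i.1, h.left ((i.1 : G)⁻¹ * i.2))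

/-- The inclusion of the dual of the bicrossproduct in the quantum double: the element with index
`(a, x)` of the dual basis is the sum of the arrows `x` whose target has `a` as its factor in
`G₁`. -/
noncomputable def ofDual : HopfDual ℂ (Bicrossproduct h) →ₗ[ℂ] Double h :=
  (dualBasis h).constr ℂ fun i => ∑ y : G₂, basis h (i.1 * y, i.2)

theorem ofBicrossproduct_basis (y : G₂) (b : G₁) :
    ofBicrossproduct h (Bicrossproduct.basis h (y, b)) =
      ∑ a : G₁, basis h (a * y, h.left ((y : G)⁻¹ * b)) := by
  rw [ofBicrossproduct, Module.Basis.constr_basis]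

theorem ofDual_dualBasis (a : G₁) (x : G₂) :
    ofDual h (dualBasis h (a, x)) = ∑ y : G₂, basis h (a * y, x) := by
  rw [ofDual, Module.Basis.constr_basis]

theorem ofBicrossproduct_one : ofBicrossproduct h 1 = 1 := by
  rw [Bicrossproduct.one_def, map_sum]
  simp only [ofBicrossproduct_basis]
  rw [Finset.sum_comm, one_def, ← h.sum_prod]
  refine Finset.sum_congr rfl fun a _ => Finset.sum_congr rfl fun y _ => ?_
  rw [← Subgroup.coe_inv, Subgroup.coe_one, mul_one, h.left_coe']
  rfl

theorem ofDual_one : ofDual h 1 = 1 := by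
  rw [dual_one_def, map_sum]
  simp only [ofDual_dualBasis]
  rw [one_def, ← h.sum_prod]
  rfl

theorem ofBicrossproduct_mul (u v : Bicrossproduct h) :
    ofBicrossproduct h (u * v) = ofBicrossproduct h u * ofBicrossproduct h v := by
  classical
  refine map_mul_of_basis (Bicrossproduct.basis h) _ ?_ u v
  rintro ⟨y, b⟩ ⟨z, c⟩
  have e₀ : y = h.act b z ↔ z = h.act b⁻¹ y :=
    ⟨fun e => by rw [e, h.act_inv_act], fun e => by rw [e, h.act_act_inv]⟩
  rw [Bicrossproduct.basis_mul, apply_ite (ofBicrossproduct h), map_zero, ofBicrossproduct_basis,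
    ofBicrossproduct_basis, ofBicrossproduct_basis, Finset.sum_mul_sum]
  have key : ∀ a : G₁, ∑ a' : G₁, basis h (a * y, h.left ((y : G)⁻¹ * b)) *
      basis h (a' * z, h.left ((z : G)⁻¹ * c)) = if y = h.act b z then
        basis h (a * y, h.left ((y : G)⁻¹ * (b * c : G₁))) else 0 := by
    intro a
    set b' := h.left ((y : G)⁻¹ * b) with hb'
    have e : ∀ a' : G₁, (a * y : G) = b' * (a' * z) * (b' : G)⁻¹ ↔
        a' = b'⁻¹ * a * b ∧ y = h.act b z := by
      intro a'
      have : (b' : G)⁻¹ * (a * y * b') = (b'⁻¹ * a * b : G₁) * h.act b⁻¹ y := by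
        rw [mul_assoc (a : G), hb', h.mul_left_eq]
        push_cast
        group
      rw [eq_mul_inv_iff_mul_eq, ← inv_mul_eq_iff_eq_mul, this, e₀]
      constructor
      · intro e
        exact ⟨(h.mul_inj e).1.symm, (h.mul_inj e).2.symm⟩
      · rintro ⟨e, e'⟩
        rw [e, e']
    simp only [basis_mul]
    rw [sum_ite_of_iff _ e]
    by_cases hy : y = h.act b z
    · rw [if_pos hy, if_pos hy, e₀.1 hy]
      congr 2
      have : (y : G)⁻¹ * (b * c : G₁) = b' * (((h.act b⁻¹ y : G₂) : G)⁻¹ * c) := by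
        have := h.mul_left_eq y b
        rw [← hb', ← eq_inv_mul_iff_mul_eq] at this
        rw [this]
        push_cast
        group
      rw [this, h.left_coe_mul]
      rfl
    · rw [if_neg hy, if_neg hy]
  simp only [key]
  split_ifs <;> simp

theorem ofDual_mul (f g : HopfDual ℂ (Bicrossproduct h)) :
    ofDual h (f * g) = ofDual h f * ofDual h g := by
  classical
  refine map_mul_of_basis (dualBasis h) _ ?_ f g
  rintro ⟨a, x⟩ ⟨b, y⟩
  rw [dualBasis_mul, apply_ite (ofDual h), map_zero, ofDual_dualBasis, ofDual_dualBasis,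
    ofDual_dualBasis, Finset.sum_mul_sum, h.symm_act_eq]
  have key : ∀ z : G₂, ∑ z' : G₂, basis h (a * z, x) * basis h (b * z', y) =
      if a = h.left (x * b) then basis h (a * z, (x * y : G₂)) else 0 := by
    intro z
    have e : ∀ z' : G₂, (a * z : G) = x * (b * z') * (x : G)⁻¹ ↔
        z' = (h.right (x * b))⁻¹ * z * x ∧ a = h.left (x * b) := by
      intro z'
      rw [h.conj_eq_iff, and_comm, eq_mul_inv_iff_mul_eq, ← inv_mul_eq_iff_eq_mul, ← mul_assoc,
        eq_comm (b := z')]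
    simp only [basis_mul]
    rw [sum_ite_of_iff _ e]
    rfl
  simp only [key]
  split_ifs <;> simp

theorem comul_ofBicrossproduct (u : Bicrossproduct h) : comul (R := ℂ) (ofBicrossproduct h u) =
    TensorProduct.map (ofBicrossproduct h) (ofBicrossproduct h) (comul u) := by
  suffices comul ∘ₗ ofBicrossproduct h =
      TensorProduct.map (ofBicrossproduct h) (ofBicrossproduct h) ∘ₗ comul from
    LinearMap.congr_fun this u
  refine (Bicrossproduct.basis h).ext ?_
  rintro ⟨y, b⟩
  rw [LinearMap.comp_apply, LinearMap.comp_apply, ofBicrossproduct_basis, map_sum,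
    Bicrossproduct.comul_basis, map_sum]
  simp only [comul_basis, TensorProduct.map_tmul, ofBicrossproduct_basis]
  simp only [← h.sum_prod (G₁ := G₁) (G₂ := G₂), TensorProduct.sum_tmul, TensorProduct.tmul_sum]
  rw [Finset.sum_comm]
  conv_lhs => enter [2, a]; rw [Finset.sum_comm]
  rw [Finset.sum_comm]
  refine Fintype.sum_equiv ((Equiv.inv G₂).trans (Equiv.mulLeft y)) _ _ fun r => ?_
  refine Finset.sum_congr rfl fun c _ => Fintype.sum_equiv (Equiv.mulLeft c⁻¹) _ _ fun a => ?_
  have e : (y * r⁻¹)⁻¹ * y = r := by group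
  simp only [Equiv.trans_apply, Equiv.inv_apply, Equiv.coe_mulLeft, e, h.cofactor_mul,
    h.coarrow_coe_left, h.symm_act_eq]
  rw [← Subgroup.coe_inv _ y, ← Subgroup.coe_inv _ r, h.left_mul_left, h.left_mul_left]
  congr 5 <;> (push_cast; group)

theorem comul_ofDual (f : HopfDual ℂ (Bicrossproduct h)) : comul (R := ℂ) (ofDual h f) =
    TensorProduct.map (ofDual h) (ofDual h) (TensorProduct.comm ℂ _ _ (comul f)) := by
  suffices comul ∘ₗ ofDual h = TensorProduct.map (ofDual h) (ofDual h) ∘ₗ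
      (TensorProduct.comm ℂ _ _).toLinearMap ∘ₗ comul from LinearMap.congr_fun this f
  refine (dualBasis h).ext ?_
  rintro ⟨a, x⟩
  rw [LinearMap.comp_apply, LinearMap.comp_apply, LinearMap.comp_apply, ofDual_dualBasis, map_sum,
    comul_dualBasis, map_sum, map_sum]
  simp only [comul_basis, LinearEquiv.coe_coe, TensorProduct.comm_tmul, TensorProduct.map_tmul,
    ofDual_dualBasis]
  simp only [← h.sum_prod (G₁ := G₁) (G₂ := G₂), TensorProduct.sum_tmul, TensorProduct.tmul_sum]
  rw [Finset.sum_comm]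
  refine Finset.sum_congr rfl fun b _ => ?_
  rw [Finset.sum_comm]
  refine Finset.sum_congr rfl fun z _ => Fintype.sum_equiv (Equiv.mulRight z⁻¹) _ _ fun y => ?_
  rw [h.cofactor_mul, h.coarrow_coe_right]
  rfl

/-- The identification of `H^* ⊗ H` with the quantum double of `H`. -/
noncomputable def tensorEquiv :
    HopfDual ℂ (Bicrossproduct h) ⊗[ℂ] Bicrossproduct h ≃ₗ[ℂ] Double h :=
  ((dualBasis h).tensorProduct (Bicrossproduct.basis h)).equiv (basis h) h.doubleIndex

theorem tensorEquiv_tmul (f : HopfDual ℂ (Bicrossproduct h)) (u : Bicrossproduct h) :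
    tensorEquiv h (f ⊗ₜ u) = ofDual h f * ofBicrossproduct h u := by
  classical
  suffices (tensorEquiv h).toLinearMap =
      LinearMap.mul' ℂ _ ∘ₗ TensorProduct.map (ofDual h) (ofBicrossproduct h) from
    LinearMap.congr_fun this (f ⊗ₜ u)
  refine ((dualBasis h).tensorProduct (Bicrossproduct.basis h)).ext ?_
  rintro ⟨⟨a, x⟩, ⟨y, b⟩⟩
  rw [LinearEquiv.coe_coe, tensorEquiv, Module.Basis.equiv_apply, LinearMap.comp_apply,
    Module.Basis.tensorProduct_apply, TensorProduct.map_tmul, LinearMap.mul'_apply,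
    ofDual_dualBasis, ofBicrossproduct_basis, Finset.sum_mul_sum, h.doubleIndex_apply]
  have key : ∀ c : G₁, ∑ z : G₂, basis h (a * z, x) * basis h (c * y, h.left ((y : G)⁻¹ * b)) =
      if c = h.left ((x : G)⁻¹ * a) then basis h (a * (h.right (x * c) * y * x⁻¹ : G₂),
        x * h.left ((y : G)⁻¹ * b)) else 0 := by
    intro c
    simp only [basis_mul, h.conj_eq_iff]
    rw [sum_ite_of_iff (h.right (x * c) * y * x⁻¹) (Q := c = h.left ((x : G)⁻¹ * a)) fun z => ?_]
    rw [and_comm]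
    refine and_congr_right fun _ => ⟨?_, ?_⟩
    · rintro rfl
      rw [h.left_inv_mul_left]
    · rintro rfl
      rw [h.left_mul_left_inv]
  rw [Finset.sum_comm]
  simp only [key, Finset.sum_ite_eq', Finset.mem_univ, if_true]
  congr 2
  conv_lhs => rw [← h.left_mul_right (x * h.left ((x : G)⁻¹ * a))]
  rw [h.left_mul_left_inv]
  push_cast
  group

end Double

/-! ### The quantum double of a bicrossproduct -/

section Hit

open Coalgebra HopfAlgebra

variable {H D : Type*} [Ring H] [HopfAlgebra ℂ H] [Ring D] [Algebra ℂ D]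

theorem HopfDual.hit_apply (a b x : H) (f : HopfDual ℂ H) :
    HopfDual.hit a b f x = f (b * (x * a)) := rfl

theorem HopfDual.hit_add_left (a a' b : H) (f : HopfDual ℂ H) :
    HopfDual.hit (a + a') b f = HopfDual.hit a b f + HopfDual.hit a' b f := by
  apply DFunLike.ext
  intro x
  change HopfDual.equiv ℂ H f (b * (x * (a + a'))) =
    HopfDual.equiv ℂ H f (b * (x * a)) + HopfDual.equiv ℂ H f (b * (x * a'))
  rw [mul_add, mul_add, map_add]

theorem HopfDual.hit_smul_left (c : ℂ) (a b : H) (f : HopfDual ℂ H) :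
    HopfDual.hit (c • a) b f = c • HopfDual.hit a b f := by
  apply DFunLike.ext
  intro x
  change HopfDual.equiv ℂ H f (b * (x * (c • a))) = c • HopfDual.equiv ℂ H f (b * (x * a))
  rw [mul_smul_comm, mul_smul_comm, map_smul]

theorem HopfDual.hit_add_right (a b b' : H) (f : HopfDual ℂ H) :
    HopfDual.hit a (b + b') f = HopfDual.hit a b f + HopfDual.hit a b' f := by
  apply DFunLike.ext
  intro x
  change HopfDual.equiv ℂ H f ((b + b') * (x * a)) =
    HopfDual.equiv ℂ H f (b * (x * a)) + HopfDual.equiv ℂ H f (b' * (x * a))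
  rw [add_mul, map_add]

theorem HopfDual.hit_smul_right (c : ℂ) (a b : H) (f : HopfDual ℂ H) :
    HopfDual.hit a (c • b) f = c • HopfDual.hit a b f := by
  apply DFunLike.ext
  intro x
  change HopfDual.equiv ℂ H f ((c • b) * (x * a)) = c • HopfDual.equiv ℂ H f (b * (x * a))
  rw [smul_mul_assoc, map_smul]

/-- For linear maps `i : H → D` and `j : H^* → D` and an element `g` of `H^*`, the linear map
`u₁ ⊗ u₂ ⊗ u₃ ↦ j (u₁ ⇀ g ↼ S u₃) i (u₂)`. -/
noncomputable def crossMap (i : H →ₗ[ℂ] D) (j : HopfDual ℂ H →ₗ[ℂ] D) (g : HopfDual ℂ H) :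
    H ⊗[ℂ] (H ⊗[ℂ] H) →ₗ[ℂ] D :=
  TensorProduct.lift
    { toFun := fun u₁ => TensorProduct.lift (LinearMap.mk₂ ℂ
        (fun u₂ u₃ => j (HopfDual.hit u₁ (antipode ℂ u₃) g) * i u₂)
        (fun u u' v => by rw [map_add, mul_add])
        (fun c u v => by rw [map_smul, mul_smul_comm])
        (fun u v v' => by rw [map_add, HopfDual.hit_add_right, map_add, add_mul])
        (fun c u v => by rw [map_smul, HopfDual.hit_smul_right, map_smul, smul_mul_assoc]))
      map_add' := fun u u' => TensorProduct.ext' fun x y => by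
        simp [HopfDual.hit_add_left, add_mul]
      map_smul' := fun c u => TensorProduct.ext' fun x y => by
        simp [HopfDual.hit_smul_left] }

theorem crossMap_tmul (i : H →ₗ[ℂ] D) (j : HopfDual ℂ H →ₗ[ℂ] D) (g : HopfDual ℂ H) (u₁ u₂ u₃ : H) :
    crossMap i j g (u₁ ⊗ₜ (u₂ ⊗ₜ u₃)) = j (HopfDual.hit u₁ (antipode ℂ u₃) g) * i u₂ := rfl

end Hit

namespace Double

open Coalgebra HopfAlgebra Bicrossproduct

attribute [local instance 2000] Fintype.ofFinite

variable {G : Type*} [Group G] [Finite G] {G₁ G₂ : Subgroup G} (h : IsExactFactorization G₁ G₂)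

theorem ofDual_apply (f : HopfDual ℂ (Bicrossproduct h)) : ofDual h f =
    ∑ a : G₁, ∑ y : G₂, ∑ x : G₂, f (Bicrossproduct.basis h (x, a)) • basis h (a * y, x) := by
  classical
  suffices ofDual h = ∑ a : G₁, ∑ y : G₂, ∑ x : G₂, ((LinearMap.applyₗ
      (Bicrossproduct.basis h (x, a))) ∘ₗ (HopfDual.equiv ℂ _).toLinearMap).smulRight
        (basis h (a * y, x)) by
    rw [this]
    simp [HopfDual.equiv_apply]
  refine (dualBasis h).ext ?_
  rintro ⟨a, x⟩
  rw [ofDual_dualBasis]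
  simp only [LinearMap.sum_apply, LinearMap.smulRight_apply, LinearMap.comp_apply,
    LinearEquiv.coe_coe, LinearMap.applyₗ_apply_apply, HopfDual.equiv_apply, dualBasis_apply]
  rw [Fintype.sum_eq_single a fun b hb => Finset.sum_eq_zero fun y _ => Finset.sum_eq_zero
    fun z _ => by rw [if_neg fun e => hb e.2, zero_smul]]
  refine Finset.sum_congr rfl fun y _ => ?_
  rw [Fintype.sum_eq_single x fun z hz => by rw [if_neg fun e => hz e.1, zero_smul]]
  simp

theorem ofBicrossproduct_mul_ofDual_basis (y : G₂) (b : G₁) (g : HopfDual ℂ (Bicrossproduct h)) :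
    ofBicrossproduct h (Bicrossproduct.basis h (y, b)) * ofDual h g = ∑ a : G₁, ∑ x : G₂,
      g (Bicrossproduct.basis h (x, (h.left ((y : G)⁻¹ * b))⁻¹ * a * b)) •
        basis h (a * y, h.left ((y : G)⁻¹ * b) * x) := by
  classical
  rw [ofDual_apply, ofBicrossproduct_basis, Finset.sum_mul]
  refine Finset.sum_congr rfl fun a _ => ?_
  set b' := h.left ((y : G)⁻¹ * b) with hb'
  have e : ∀ (c : G₁) (z : G₂), (a * y : G) = b' * (c * z) * (b' : G)⁻¹ ↔
      c = b'⁻¹ * a * b ∧ z = h.act b⁻¹ y := by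
    intro c z
    have : (b' : G)⁻¹ * (a * y * b') = (b'⁻¹ * a * b : G₁) * h.act b⁻¹ y := by
      rw [mul_assoc (a : G), hb', h.mul_left_eq]
      push_cast
      group
    rw [eq_mul_inv_iff_mul_eq, ← inv_mul_eq_iff_eq_mul, this]
    exact ⟨fun e => ⟨(h.mul_inj e).1.symm, (h.mul_inj e).2.symm⟩, fun e => by rw [e.1, e.2]⟩
  simp only [Finset.mul_sum, mul_smul_comm, basis_mul, e]
  rw [Fintype.sum_eq_single (b'⁻¹ * a * b) fun c hc => by simp [hc],
    Fintype.sum_eq_single (h.act b⁻¹ y) fun z hz => by simp [hz]]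
  simp

theorem ofDual_mul_ofBicrossproduct_basis (f : HopfDual ℂ (Bicrossproduct h)) (t : G₂) (b : G₁) :
    ofDual h f * ofBicrossproduct h (Bicrossproduct.basis h (t, b)) = ∑ a : G₁, ∑ x : G₂,
      f (Bicrossproduct.basis h (x, a)) •
        basis h (x * h.left ((x : G)⁻¹ * a) * t * (x : G)⁻¹, x * h.left ((t : G)⁻¹ * b)) := by
  rw [ofDual_apply, Finset.sum_mul]
  refine Finset.sum_congr rfl fun a _ => ?_
  rw [Finset.sum_comm, Finset.sum_mul]
  refine Finset.sum_congr rfl fun x _ => ?_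
  rw [← Finset.smul_sum, ← ofDual_dualBasis, smul_mul_assoc, ← tensorEquiv_tmul, tensorEquiv,
    ← Module.Basis.tensorProduct_apply, Module.Basis.equiv_apply, h.doubleIndex_apply]

/-- The antipode of the bicrossproduct, with its first index written through the second. -/
theorem antipode_basis_eq (z : G₂) (c : G₁) :
    antipode ℂ (Bicrossproduct.basis h (z, c)) = Bicrossproduct.basis h
      (h.act (h.symm.act z⁻¹ c)⁻¹ z⁻¹, (h.symm.act z⁻¹ c)⁻¹) := by
  obtain ⟨r, -, e₁, -, e₃, -⟩ := h.act_spec c (h.act c⁻¹ z)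
  rw [h.act_act_inv] at e₁ e₃
  rw [antipode_basis, e₁, ← e₃, h.act_inv_act]

open Classical in
theorem ofDual_hit_mul_ofBicrossproduct (s t v : G₂) (b c d : G₁)
    (g : HopfDual ℂ (Bicrossproduct h)) :
    ofDual h (HopfDual.hit (Bicrossproduct.basis h (s, b)) (Bicrossproduct.basis h (v, d)) g) *
      ofBicrossproduct h (Bicrossproduct.basis h (t, c)) =
      ∑ a : G₁, if v = h.act d (h.act a s) then g (Bicrossproduct.basis h (v, d * (a * b))) •
        basis h (a * s * t * (h.act a s : G)⁻¹, h.act a s * h.left ((t : G)⁻¹ * c)) else 0 := by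
  rw [ofDual_mul_ofBicrossproduct_basis]
  refine Finset.sum_congr rfl fun a _ => ?_
  have hz : ∀ z, g (0 : Bicrossproduct h) • z = (0 : Double h) := fun z => by
    rw [← HopfDual.equiv_apply, map_zero, zero_smul]
  rw [Fintype.sum_eq_single (h.act a s) fun x hx => by
    rw [HopfDual.hit_apply, Bicrossproduct.basis_mul, if_neg hx, mul_zero, hz]]
  rw [HopfDual.hit_apply, Bicrossproduct.basis_mul, if_pos rfl, Bicrossproduct.basis_mul,
    h.mul_left_eq, h.act_inv_act]
  split_ifs
  · rfl
  · rw [hz]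

/-- The cross relation of the quantum double, which moves elements of `H` past elements of `H^*`. -/
theorem ofBicrossproduct_mul_ofDual (u : Bicrossproduct h) (g : HopfDual ℂ (Bicrossproduct h)) :
    ofBicrossproduct h u * ofDual h g = crossMap (ofBicrossproduct h) (ofDual h) g
      ((comul (R := ℂ)).lTensor _ (comul u)) := by
  classical
  suffices LinearMap.mulRight ℂ (ofDual h g) ∘ₗ ofBicrossproduct h =
      crossMap (ofBicrossproduct h) (ofDual h) g ∘ₗ (comul (R := ℂ)).lTensor _ ∘ₗ comul from
    LinearMap.congr_fun this u
  refine (Bicrossproduct.basis h).ext ?_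
  rintro ⟨y, b⟩
  rw [LinearMap.comp_apply, LinearMap.mulRight_apply, ofBicrossproduct_mul_ofDual_basis]
  simp only [LinearMap.comp_apply, Bicrossproduct.comul_basis, map_sum, LinearMap.lTensor_tmul,
    TensorProduct.tmul_sum, crossMap_tmul, antipode_basis_eq, ofDual_hit_mul_ofBicrossproduct,
    ← h.symm.mul_act]
  set b' := h.left ((y : G)⁻¹ * b) with hb'
  have e₁ : ∀ s t : G₂, h.symm.act ((t⁻¹ * (s⁻¹ * y))⁻¹ * (t⁻¹ * s⁻¹)) b = b' := fun s t => by
    rw [h.symm_act_eq, hb', ← Subgroup.coe_inv]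
    congr 4
    group
  simp only [e₁, h.act_inj]
  conv_rhs => enter [2, s]; rw [Finset.sum_comm]
  conv_rhs => rw [Finset.sum_comm]
  refine Finset.sum_congr rfl fun a _ => ?_
  have e₂ : ∀ s t : G₂, (t⁻¹ * (s⁻¹ * y))⁻¹ = h.act a s ↔ t = s⁻¹ * (y * h.act a s) ∧ True := by
    intro s t
    rw [and_true]
    constructor
    · intro e
      rw [← e]
      group
    · rintro rfl
      group
  have key := fun s => sum_ite_of_iff (M := Double h) _ (e₂ s)
  simp only [key, if_true]
  refine Fintype.sum_bijective (fun x => h.act a⁻¹ (h.act b' x)) ?_ _ _ fun x => ?_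
  · refine ⟨fun x x' e => by simpa only [h.act_inj] using e, fun x => ⟨h.act b'⁻¹ (h.act a x), ?_⟩⟩
    simp only [h.act_act_inv, h.act_inv_act]
  · set s := h.act a⁻¹ (h.act b' x) with hs
    set w := h.act b' x with hw
    have hs' : h.act a s = w := by rw [hs, h.act_act_inv]
    have e₃ : ((s⁻¹ * (y * w))⁻¹ * (s⁻¹ * y))⁻¹ = w := by group
    have e₄ : h.left (((s⁻¹ * (y * w) : G₂) : G)⁻¹ * h.symm.act s⁻¹ b) =
        h.left ((w : G)⁻¹ * b') := by
      rw [h.symm_act_eq, hb', ← Subgroup.coe_inv _ y, ← Subgroup.coe_inv _ w,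
        ← Subgroup.coe_inv _ (s⁻¹ * (y * w)), h.left_mul_left, h.left_mul_left,
        show (s⁻¹ * (y * w))⁻¹ * s⁻¹ = w⁻¹ * y⁻¹ by group]
    have e₅ : (a * s * (s⁻¹ * (y * w) : G₂) * (w : G)⁻¹ : G) = a * y := by
      push_cast
      group
    rw [hs', e₃, e₄, h.mul_left_eq, ← mul_assoc b'⁻¹, e₅, hw, h.act_inv_act]

theorem isQuantumDouble : IsQuantumDouble (Bicrossproduct h) (Double h) := by
  refine ⟨LinearEquiv.ofInvolutive (antipode ℂ) (antipode_antipode h), tensorEquiv h, fun u => rfl,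
    fun f g u v n u₁ u₂ u₃ hu => ?_, fun f u => ?_⟩
  · have := ofBicrossproduct_mul_ofDual h u g
    rw [hu, map_sum] at this
    rw [tensorEquiv_tmul, tensorEquiv_tmul, mul_assoc, ← mul_assoc (ofBicrossproduct h u), this,
      Finset.sum_mul, Finset.mul_sum]
    refine Finset.sum_congr rfl fun i _ => ?_
    rw [tensorEquiv_tmul, ofDual_mul, ofBicrossproduct_mul, crossMap_tmul, mul_assoc, mul_assoc]
    rfl
  · rw [tensorEquiv_tmul, Bialgebra.comul_mul, comul_ofDual, comul_ofBicrossproduct]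
    generalize TensorProduct.comm ℂ _ _ (comul f) = a
    generalize (comul u : Bicrossproduct h ⊗[ℂ] Bicrossproduct h) = b
    induction a with
    | zero => simp
    | add a₁ a₂ h₁ h₂ => simp only [map_add, TensorProduct.add_tmul, add_mul, h₁, h₂]
    | tmul f₁ f₂ =>
      induction b with
      | zero => simp
      | add b₁ b₂ h₁ h₂ => simp only [map_add, TensorProduct.tmul_add, mul_add, h₁, h₂]
      | tmul v₁ v₂ => simp [tensorEquiv_tmul]

end Double

/-! ### The universal R-matrix -/

namespace Double

open Coalgebra HopfAlgebra Bicrossproduct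

attribute [local instance 2000] Fintype.ofFinite

variable {G : Type*} [Group G] [Finite G] {G₁ G₂ : Subgroup G} (h : IsExactFactorization G₁ G₂)

/-- The element of `D ⊗ D` that corresponds to a linear map `f : H → D` through the inclusion of
`H^*` in `D`, that is, `∑ f(eᵢ) ⊗ eⁱ` for dual bases of `H` and `H^*`. -/
noncomputable def canonicalElement (f : Bicrossproduct h →ₗ[ℂ] Double h) :
    Double h ⊗[ℂ] Double h :=
  ∑ b : G₁, ∑ y : G₂, f (Bicrossproduct.basis h (y, b)) ⊗ₜ[ℂ] ofDual h (dualBasis h (b, y))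

/-- A sum over products of elements of the dual basis, re-indexed by the elements of the dual basis
that occur as products. -/
theorem sum_dualBasis_mul {M : Type*} [AddCommMonoid M]
    (F : G₂ → G₁ → G₂ → G₁ → HopfDual ℂ (Bicrossproduct h) → M) (hF : ∀ x a y b, F x a y b 0 = 0) :
    ∑ a : G₁, ∑ x : G₂, ∑ b : G₁, ∑ y : G₂, F x a y b (dualBasis h (a, x) * dualBasis h (b, y)) =
      ∑ a : G₁, ∑ y : G₂, ∑ x : G₂,
        F x a (x⁻¹ * y) (h.symm.act x⁻¹ a) (dualBasis h (a, y)) := by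
  classical
  refine Finset.sum_congr rfl fun a _ => ?_
  rw [Finset.sum_comm (s := Finset.univ) (t := Finset.univ) (f := fun y x => F x a (x⁻¹ * y) _ _)]
  refine Finset.sum_congr rfl fun x _ => ?_
  rw [Fintype.sum_eq_single (h.symm.act x⁻¹ a) fun b hb => Finset.sum_eq_zero fun y _ => by
    rw [dualBasis_mul, if_neg, hF]
    rintro rfl
    exact hb (h.symm.act_inv_act x b).symm]
  refine Fintype.sum_equiv (Equiv.mulLeft x) _ _ fun y => ?_
  rw [dualBasis_mul, if_pos (h.symm.act_act_inv x a).symm, Equiv.coe_mulLeft, inv_mul_cancel_left]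

/-- Convolution of linear maps corresponds to the product of the canonical elements. -/
theorem canonicalElement_mul (f g : Bicrossproduct h →ₗ[ℂ] Double h) :
    canonicalElement h f * canonicalElement h g =
      canonicalElement h (LinearMap.mul' ℂ _ ∘ₗ TensorProduct.map f g ∘ₗ comul) := by
  simp only [canonicalElement, Finset.sum_mul]
  simp only [Finset.mul_sum, Algebra.TensorProduct.tmul_mul_tmul, ← ofDual_mul]
  rw [sum_dualBasis_mul h (fun x a y b f' => (f (Bicrossproduct.basis h (x, a)) *
    g (Bicrossproduct.basis h (y, b))) ⊗ₜ[ℂ] ofDual h f') fun x a y b => by simp]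
  refine Finset.sum_congr rfl fun a _ => Finset.sum_congr rfl fun y _ => ?_
  rw [LinearMap.comp_apply, LinearMap.comp_apply, Bicrossproduct.comul_basis]
  simp only [map_sum, TensorProduct.map_tmul, LinearMap.mul'_apply, TensorProduct.sum_tmul]

theorem canonicalElement_counit :
    canonicalElement h (Algebra.linearMap ℂ (Double h) ∘ₗ counit) = 1 := by
  classical
  rw [canonicalElement, Algebra.TensorProduct.one_def]
  nth_rw 2 [← ofDual_one h]
  rw [dual_one_def, map_sum, TensorProduct.tmul_sum]
  refine Finset.sum_congr rfl fun b _ => ?_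
  have : ∀ y : G₂, counit (R := ℂ) (Bicrossproduct.basis h (y, b)) = if y = 1 then (1 : ℂ) else 0 :=
    fun y => (Bicrossproduct.counitMap_basis h y b).trans (by congr)
  rw [Fintype.sum_eq_single 1 fun y hy => by
    rw [LinearMap.comp_apply, this, if_neg hy, map_zero, TensorProduct.zero_tmul]]
  rw [LinearMap.comp_apply, this, if_pos rfl, Algebra.linearMap_apply, map_one]

/-- The universal R-matrix of the quantum double. -/
noncomputable def rMatrix : Double h ⊗[ℂ] Double h := canonicalElement h (ofBicrossproduct h)

/-- The inverse of the R-matrix is `(S ⊗ id)(R)`. -/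
theorem isUnit_rMatrix : IsUnit (rMatrix h) := by
  have hconv : ∀ f g : Bicrossproduct h →ₗ[ℂ] Bicrossproduct h, ∀ u,
      (LinearMap.mul' ℂ _ ∘ₗ TensorProduct.map (ofBicrossproduct h ∘ₗ f) (ofBicrossproduct h ∘ₗ g))
        u = ofBicrossproduct h (LinearMap.mul' ℂ _ (TensorProduct.map f g u)) := by
    intro f g u
    induction u with
    | zero => simp
    | add u₁ u₂ h₁ h₂ => simp only [map_add, h₁, h₂]
    | tmul u v => simp [ofBicrossproduct_mul]
  have hone : ∀ u : Bicrossproduct h, ofBicrossproduct h (algebraMap ℂ _ (counit (R := ℂ) u)) =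
      (Algebra.linearMap ℂ (Double h) ∘ₗ counit) u := fun u => by
    rw [Algebra.algebraMap_eq_smul_one, map_smul, ofBicrossproduct_one, LinearMap.comp_apply,
      Algebra.linearMap_apply, Algebra.algebraMap_eq_smul_one]
  refine isUnit_iff_exists.2 ⟨canonicalElement h (ofBicrossproduct h ∘ₗ antipode ℂ), ?_, ?_⟩
  · rw [rMatrix, canonicalElement_mul, ← canonicalElement_counit]
    congr 1
    apply LinearMap.ext
    intro u
    rw [← hone, ← mul_antipode_lTensor_comul_apply]
    exact hconv LinearMap.id (antipode ℂ) (comul u)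
  · rw [rMatrix, canonicalElement_mul, ← canonicalElement_counit]
    congr 1
    apply LinearMap.ext
    intro u
    rw [← hone, ← mul_antipode_rTensor_comul_apply]
    exact hconv (antipode ℂ) LinearMap.id (comul u)

/-- The R-matrix in the basis of pairs of arrows. -/
theorem rMatrix_eq : rMatrix h = ∑ g : G, ∑ w : G,
    basis h (g, h.left ((h.right g : G)⁻¹ * w)) ⊗ₜ[ℂ] basis h (w, h.right g) := by
  rw [rMatrix, canonicalElement]
  simp only [← h.sum_prod (G₁ := G₁) (G₂ := G₂), ofBicrossproduct_basis, ofDual_dualBasis,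
    TensorProduct.sum_tmul, TensorProduct.tmul_sum]
  rw [Finset.sum_comm]
  conv_rhs => rw [Finset.sum_comm]
  refine Finset.sum_congr rfl fun y _ => ?_
  conv_lhs => enter [2, b]; rw [Finset.sum_comm]
  rw [Finset.sum_comm]
  refine Finset.sum_congr rfl fun a _ => Finset.sum_congr rfl fun b _ =>
    Finset.sum_congr rfl fun z _ => ?_
  rw [h.right_coe_mul, h.right_coe, ← mul_assoc, h.left_mul_coe]

/-- The R-matrix intertwines the coproduct and the opposite coproduct. -/
theorem comm_comul_mul_rMatrix (u : Double h) :
    TensorProduct.comm ℂ _ _ (comul u) * rMatrix h = rMatrix h * comul u := by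
  classical
  suffices LinearMap.mulRight ℂ (rMatrix h) ∘ₗ (TensorProduct.comm ℂ _ _).toLinearMap ∘ₗ comul =
      LinearMap.mulLeft ℂ (rMatrix h) ∘ₗ comul from LinearMap.congr_fun this u
  refine (basis h).ext ?_
  rintro ⟨g, k⟩
  simp only [LinearMap.comp_apply, LinearMap.mulRight_apply, LinearMap.mulLeft_apply, comul_basis,
    LinearEquiv.coe_coe, map_sum, TensorProduct.comm_tmul, rMatrix_eq, Finset.sum_mul]
  simp only [Finset.mul_sum]
  conv_rhs => rw [Finset.sum_comm]
  refine Finset.sum_congr rfl fun u _ => ?_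
  -- both sides are the sum of the following tensors
  trans basis h (u, k * h.left (k⁻¹ * (u⁻¹ * g) * k)) ⊗ₜ[ℂ]
    basis h (h.cofactor u g, h.right u * k)
  · rw [Fintype.sum_eq_single (k⁻¹ * u * k) fun l hl => Finset.sum_eq_zero fun w _ => by
      rw [Algebra.TensorProduct.tmul_mul_tmul, basis_mul, if_neg, TensorProduct.zero_tmul]
      rintro rfl
      apply hl
      group]
    rw [Fintype.sum_eq_single (h.cofactor (k⁻¹ * u * k) (k⁻¹ * g * k)) fun w hw => by
      rw [Algebra.TensorProduct.tmul_mul_tmul, basis_mul h (h.cofactor u g), if_neg,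
        TensorProduct.tmul_zero]
      intro e
      apply hw
      rw [← h.conj_coarrow, e]
      group]
    rw [Algebra.TensorProduct.tmul_mul_tmul, basis_mul, if_pos (by group), basis_mul, if_pos]
    · have e₁ : h.left ((h.right (k⁻¹ * u * k) : G)⁻¹ *
          h.cofactor (k⁻¹ * u * k) (k⁻¹ * g * k)) = h.left (k⁻¹ * (u⁻¹ * g) * k) := by
        rw [IsExactFactorization.cofactor, ← mul_assoc, ← mul_assoc, ← mul_inv_rev,
          h.left_mul_right, h.left_mul_inv_coe]
        congr 1
        group
      have e₂ : h.coarrow u k * h.right (k⁻¹ * u * k) = h.right u * k := by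
        rw [IsExactFactorization.coarrow, mul_assoc, h.left_mul_right]
        have := h.inv_right u
        rw [inv_eq_iff_eq_inv] at this
        rw [this]
        group
      rw [e₁, e₂]
    · rw [← h.conj_coarrow]
      group
  · have key : ∀ v, ∑ w,
        (basis h (u, h.left ((h.right u : G)⁻¹ * w)) ⊗ₜ[ℂ] basis h (w, h.right u)) *
        (basis h (h.cofactor v g, h.coarrow v k) ⊗ₜ[ℂ] basis h (v, k)) =
        if u = g * v⁻¹ then basis h (u, k * h.left (k⁻¹ * v * k)) ⊗ₜ[ℂ]
          basis h (h.right u * v * (h.right u : G)⁻¹, h.right u * k) else 0 := by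
      intro v
      rw [Fintype.sum_eq_single (h.right u * v * (h.right u : G)⁻¹) fun w hw => by
        rw [Algebra.TensorProduct.tmul_mul_tmul, basis_mul h w, if_neg hw, TensorProduct.tmul_zero]]
      have e₁ : h.left ((h.right u : G)⁻¹ * (h.right u * v * (h.right u : G)⁻¹)) = h.left v := by
        rw [← mul_assoc, ← mul_assoc, inv_mul_cancel, one_mul, h.left_mul_inv_coe]
      have e₂ : h.left v * h.cofactor v g * (h.left v : G)⁻¹ = g * v⁻¹ := by
        rw [IsExactFactorization.cofactor, h.inv_right]
        group
      have e₃ : h.left v * h.coarrow v k = k * h.left (k⁻¹ * v * k) := by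
        rw [IsExactFactorization.coarrow]
        group
      rw [Algebra.TensorProduct.tmul_mul_tmul, e₁, basis_mul, basis_mul h (_ * v * _), if_pos rfl,
        e₂, e₃]
      split_ifs
      · rfl
      · rw [TensorProduct.zero_tmul]
    simp only [key]
    rw [sum_ite_of_iff (M := Double h ⊗[ℂ] Double h) (u⁻¹ * g) (Q := True) fun v => ?_,
      if_pos trivial]
    · have e : h.right u * (u⁻¹ * g) * (h.right u : G)⁻¹ = h.cofactor u g := by
        rw [IsExactFactorization.cofactor]
        congr 1
        rw [← mul_assoc]
        congr 1
        rw [mul_inv_eq_iff_eq_mul, eq_inv_mul_iff_mul_eq, h.left_mul_right]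
      rw [e]
    · rw [and_true, eq_mul_inv_iff_mul_eq, eq_inv_mul_iff_mul_eq]

set_option maxSynthPendingDepth 3 in
/-- This identity holds because the product of `H^*` is dual to the coproduct of `H`. -/
theorem comul_rTensor_rMatrix : TensorProduct.assoc ℂ _ _ _
    ((comul (R := ℂ) (A := Double h)).rTensor (Double h) (rMatrix h)) =
      (TensorProduct.mk ℂ _ _ 1).lTensor _ (rMatrix h) * ((1 : Double h) ⊗ₜ[ℂ] rMatrix h) := by
  simp only [rMatrix, canonicalElement, map_sum, LinearMap.rTensor_tmul, comul_ofBicrossproduct,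
    Bicrossproduct.comul_basis, TensorProduct.map_tmul, TensorProduct.sum_tmul,
    TensorProduct.assoc_tmul, LinearMap.lTensor_tmul, TensorProduct.mk_apply, Finset.sum_mul,
    TensorProduct.tmul_sum]
  simp only [Finset.mul_sum, Algebra.TensorProduct.tmul_mul_tmul, one_mul, mul_one, ← ofDual_mul]
  rw [sum_dualBasis_mul h (fun x a y b f' =>
    ofBicrossproduct h (Bicrossproduct.basis h (x, a)) ⊗ₜ[ℂ]
    (ofBicrossproduct h (Bicrossproduct.basis h (y, b)) ⊗ₜ[ℂ] ofDual h f')) fun x a y b => by simp]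

set_option maxSynthPendingDepth 3 in
/-- This identity holds because the coproduct of `H^*` is dual to the product of `H`. -/
theorem comul_lTensor_rMatrix : (comul (R := ℂ) (A := Double h)).lTensor (Double h) (rMatrix h) =
    (TensorProduct.mk ℂ _ _ 1).lTensor _ (rMatrix h) *
      TensorProduct.assoc ℂ _ _ _ (rMatrix h ⊗ₜ[ℂ] (1 : Double h)) := by
  classical
  simp only [rMatrix, canonicalElement, map_sum, LinearMap.lTensor_tmul, comul_ofDual,
    comul_dualBasis, TensorProduct.comm_tmul, TensorProduct.map_tmul, TensorProduct.sum_tmul,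
    TensorProduct.assoc_tmul, TensorProduct.mk_apply, Finset.sum_mul, TensorProduct.tmul_sum]
  simp only [Finset.mul_sum, Algebra.TensorProduct.tmul_mul_tmul, one_mul, mul_one,
    ← ofBicrossproduct_mul]
  have key : ∀ (c : G₁) (y : G₂), ∑ b : G₁, ∑ z : G₂, ofBicrossproduct h
      (Bicrossproduct.basis h (y, c) * Bicrossproduct.basis h (z, b)) ⊗ₜ[ℂ]
        (ofDual h (dualBasis h (b, z)) ⊗ₜ[ℂ] ofDual h (dualBasis h (c, y))) =
      ∑ b : G₁, ofBicrossproduct h (Bicrossproduct.basis h (y, b)) ⊗ₜ[ℂ]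
        (ofDual h (dualBasis h (c⁻¹ * b, h.act c⁻¹ y)) ⊗ₜ[ℂ] ofDual h (dualBasis h (c, y))) := by
    intro c y
    refine Fintype.sum_equiv (Equiv.mulLeft c) _ _ fun b => ?_
    rw [Fintype.sum_eq_single (h.act c⁻¹ y) fun z hz => by
      rw [Bicrossproduct.basis_mul, if_neg, map_zero, TensorProduct.zero_tmul]
      rintro rfl
      exact hz (h.act_inv_act c z).symm]
    rw [Bicrossproduct.basis_mul, if_pos (h.act_act_inv c y).symm, Equiv.coe_mulLeft,
      inv_mul_cancel_left]
  simp only [key]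
  rw [Finset.sum_comm]
  conv_rhs => rw [Finset.sum_comm]
  refine Finset.sum_congr rfl fun y _ => ?_
  rw [Finset.sum_comm]

theorem isQuasitriangular : IsQuasitriangular (Double h) :=
  ⟨rMatrix h, isUnit_rMatrix h, comm_comul_mul_rMatrix h, comul_rTensor_rMatrix h,
    comul_lTensor_rMatrix h⟩

theorem isSemisimpleRing : IsSemisimpleRing (Double h) := (isActionBasis h).isSemisimpleRing

theorem one_lt_finrank [Nontrivial G] : 1 < Module.finrank ℂ (Double h) := by
  rw [Module.finrank_eq_card_basis (basis h)]
  exact Fintype.one_lt_card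

end Double

/-- An exact factorization of a finite group into perfect self-normalizing subgroups gives a
biperfect bicrossproduct. -/
theorem Bicrossproduct.isBiperfect {G : Type*} [Group G] [Finite G] {G₁ G₂ : Subgroup G}
    (h : IsExactFactorization G₁ G₂) [Group.IsPerfect G₁] [Group.IsPerfect G₂]
    (h₁ : Subgroup.normalizer (G₁ : Set G) = G₁) (h₂ : Subgroup.normalizer (G₂ : Set G) = G₂) :
    IsBiperfect (Bicrossproduct h) :=
  ⟨isPerfectHopf h h₁, isPerfectHopf_dual h h₂⟩

end BiHopf

theorem theorem3p1 :
    ∃ G₁ G₂ : Subgroup BiHopf.M24,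
      -- the two subgroups
      Nonempty (G₁ ≃* PSL(2, ZMod 23)) ∧
      (∃ e : alternatingGroup (Fin 8) ≃* SL(4, ZMod 2),
        Nonempty (G₂ ≃* Multiplicative (Fin 4 → ZMod 2) ⋊[BiHopf.a7Action e]
          alternatingGroup (Fin 7))) ∧
      -- they are perfect and self-normalizing
      Group.IsPerfect G₁ ∧ Group.IsPerfect G₂ ∧
      Subgroup.normalizer (G₁ : Set BiHopf.M24) = G₁ ∧
      Subgroup.normalizer (G₂ : Set BiHopf.M24) = G₂ ∧
      -- they form an exact factorization, and `H(M₂₄, G₁, G₂)` is semisimple and biperfect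
      ∃ h : BiHopf.IsExactFactorization G₁ G₂,
        IsSemisimpleRing (BiHopf.Bicrossproduct h) ∧
        BiHopf.IsBiperfect (BiHopf.Bicrossproduct h) ∧
        -- the quantum double of `H(M₂₄, G₁, G₂)` is a quasitriangular semisimple Hopf algebra of
        -- dimension greater than one without nontrivial group-like elements
        ∃ (D : Type) (_ : Ring D) (_ : HopfAlgebra ℂ D),
          BiHopf.IsQuantumDouble (BiHopf.Bicrossproduct h) D ∧
          1 < Module.finrank ℂ D ∧
          IsSemisimpleRing D ∧
          BiHopf.IsQuasitriangular D ∧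
          ∀ g : D, IsGroupLikeElem ℂ g → g = 1 := by
  obtain ⟨e, he⟩ := BiHopf.exists_mulEquiv_alternatingGroup_specialLinearGroup
  have e₂ := BiHopf.nonempty_flagStabilizer_mulEquiv he
  have p₁ := BiHopf.isPerfect_pslSubgroup
  have p₂ := BiHopf.isPerfect_flagStabilizer he
  have n₁ := BiHopf.normalizer_pslSubgroup
  have n₂ := BiHopf.normalizer_flagStabilizer he
  have h := BiHopf.isExactFactorization_psl_flagStabilizer
  have hH := BiHopf.Bicrossproduct.isBiperfect h n₁ n₂
  have hD := BiHopf.Double.isQuantumDouble h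
  have : Nontrivial BiHopf.M24 := by
    obtain ⟨f⟩ := e₂
    have : Function.Injective fun v : Multiplicative (Fin 4 → ZMod 2) =>
        (f.symm (SemidirectProduct.inl v) : BiHopf.M24) :=
      Subtype.val_injective.comp (f.symm.injective.comp SemidirectProduct.inl_injective)
    exact this.nontrivial
  exact ⟨BiHopf.pslSubgroup, BiHopf.flagStabilizer, BiHopf.nonempty_pslSubgroup_mulEquiv, ⟨e, e₂⟩,
    p₁, p₂, n₁, n₂, h, BiHopf.Bicrossproduct.isSemisimpleRing h, hH,
    BiHopf.Double h, inferInstance, inferInstance, hD, BiHopf.Double.one_lt_finrank h,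
    BiHopf.Double.isSemisimpleRing h, BiHopf.Double.isQuasitriangular h,
    fun _ hg => hD.eq_one_of_isGroupLikeElem hH hg⟩
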